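/- Notation. Let $0<\sigma<1/2$ and $m\in\mathbb N$; matrices carry the Frobenius norm. For a measurable kernel $K:\mathbb R^2\to M_m(\mathbb R)$, $s\in\mathbb R$, $1<p<\infty$, $1\le q<\infty$, put $$\|K\|_{A^{s}_{p,q}}=\Big(\int_{\mathbb R}|h|^{1-qs}\,\|K(\cdot,\cdot+h)\|_{L^p(\mathbb R)}^q\,dh\Big)^{1/q},$$ and let $A^s_{p,q}$ be the set of $K\in L^1_{loc}(\mathbb R^2,M_m(\mathbb R))$ for which this is finite. For Schwartz functions $f$ on $\mathbb R$ let $(-\Delta)^{\sigma/2}f(x)=\int_{\mathbb R}\frac{f(x)-f(y)}{|x-y|^{1+\sigma}}\,dy$. For a locally integrable $f$ and $g\in L^2(\mathbb R)$ we write $(-\Delta)^{\sigma/2}f=g$ if there are Schwartz functions $\varphi_n$ with $\varphi_n\to f$ in $L^1_{loc}(\mathbb R)$ and $(-\Delta)^{\sigma/2}\varphi_n\to g$ in $L^2(\mathbb R)$. For a kernel $K$, a measurable kernel $L$ is $(-\Delta)^{\sigma/2}K$ if, for a.e. $h$, $L(\cdot,\cdot+h)=(-\Delta)^{\sigma/2}[x\mapsto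 K(x,x+h)]$ entrywise. Put $\|P\|_{\dot H^{1/2}}=\big(\int_{\mathbb R}|h|^{-2}\|P(\cdot+h)-P\|_{L^2}^2\,dh\big)^{1/2}$ and $\|v\|_{L^{2,\infty}}=\sup_{t>0}t\,|\{|v|>t\}|^{1/2}$. Let $$\mathcal T_K(v)(x)=\int_{\mathbb R}\big[K^t(x,y)v(x)+K(x,y)v(y)\big]\,dy ,$$ where $K^t(x,y)$ is the transpose of the matrix $K(x,y)$. As a distribution, $\mathcal T_K(v)$ is given by $$\langle\psi,\mathcal T_K(v)\rangle=\lim_{\varepsilon\to0^+}\iint_{|x-y|>\varepsilon}\psi(x)\cdot\big[K^t(x,y)v(x)+K(x,y)v(y)\big]\,dx\,dy ,$$ whenever the integrals converge absolutely for every $\varepsilon>0$ and the limit exists. Proposition. Let $0<\sigma<1/2$. There is a constant $C_\sigma$, depending only on $\sigma$, with the following property. Let $m\in\mathbb N$, let $K\in L^1_{loc}(\mathbb R^2,M_m(\mathbb R))$ be such that $(-\Delta)^{\sigma/2}K$ exists in the above sense and $\|(-\Delta)^{\sigma/2}K\|_{A^{-\sigma}_{2,2}}<\infty$, and let $P\in\dot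 H^{1/2}(\mathbb R,O(m))$, that is, $P$ is measurable, $P(x)$ is an orthogonal matrix for a.e. $x$, and $\|P\|_{\dot H^{1/2}}<\infty$. Put $G(x,y)=P(x)K(x,y)P^t(y)$ and $$\mathcal G[v](x)=\int_{\mathbb R}\big(P(x)-P(y)\big)K^t(x,y)\,v(x)\,dy .$$ 1. $G\in A^{-\sigma}_{p,2}$ for $\frac1p=\frac12-\sigma$. 2. For $v\in L^{2,\infty}(\mathbb R,\mathbb R^m)$ the function $(x,y)\mapsto(P(x)-P(y))K^t(x,y)v(x)$ is integrable on $\mathbb R^2$, and $\mathcal G$ is a linear operator from $L^{2,\infty}(\mathbb R,\mathbb R^m)$ to $L^1(\mathbb R,\mathbb R^m)$ with $$\|\mathcal G[v]\|_{L^1}\le C_\sigma\,\|(-\Delta)^{\sigma/2}K\|_{A^{-\sigma}_{2,2}}\,\|P\|_{\dot H^{1/2}}\,\|v\|_{L^{2,\infty}} .$$ 3. For $v\in L^{2,\infty}(\mathbb R,\mathbb R^m)$, $$P\,\mathcal T_K(v)=\mathcal T_G(Pv)+\mathcal G[v]$$ in both of the following senses. (a) For a.e. $x$, the integral defining $\mathcal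 T_K(v)(x)$ converges absolutely if and only if the one defining $\mathcal T_G(Pv)(x)$ does, and then the identity holds at $x$. (b) For every $\varphi\in C_c^\infty(\mathbb R,\mathbb R^m)$, $\langle P^t\varphi,\mathcal T_K(v)\rangle$ exists if and only if $\langle\varphi,\mathcal T_G(Pv)\rangle$ exists, and then $$\langle P^t\varphi,\mathcal T_K(v)\rangle=\langle\varphi,\mathcal T_G(Pv)\rangle+\int_{\mathbb R}\varphi\cdot\mathcal G[v]\,dx ;$$ if $K$ is anti-self-dual, $K(x,y)=-K^t(y,x)$ for a.e. $(x,y)$, then both pairings exist. -/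

import Mathlib

open MeasureTheory Filter Topology
open scoped ENNReal NNReal Matrix SchwartzMap ContDiff

namespace MultiComm

/-- Real `m × m` matrices. -/
abbrev Mat (m : ℕ) : Type := Matrix (Fin m) (Fin m) ℝ

/-- Euclidean space of dimension `m`. -/
abbrev Vec (m : ℕ) : Type := EuclideanSpace ℝ (Fin m)

/-- The Frobenius (Hilbert-Schmidt) norm of a matrix. -/
noncomputable def frob {m : ℕ} (A : Mat m) : ℝ :=
  Real.sqrt (∑ i, ∑ j, (A i j) ^ 2)

/-- The action of a matrix on a vector of Euclidean space. -/
noncomputable def act {m : ℕ} (A : Mat m) (w : Vec m) : Vec m :=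
  WithLp.toLp 2 (A *ᵥ w.ofLp)

/-- The norm `(∫ |h|^(1 - q s) ‖K(·, · + h)‖_{L^p}^q dh)^(1/q)` of the Besov type space `A^s_{p,q}`
of kernels on the line. -/
noncomputable def kernelNorm {m : ℕ} (s p q : ℝ) (K : ℝ → ℝ → Mat m) : ℝ≥0∞ :=
  (∫⁻ h : ℝ, ENNReal.ofReal (|h| ^ (1 - q * s)) *
    (eLpNorm (fun x : ℝ => frob (K x (x + h))) (ENNReal.ofReal p) volume) ^ q) ^ (1 / q)

/-- Local integrability of a kernel on the plane (entry by entry). -/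
def LocIntegrableKernel {m : ℕ} (K : ℝ → ℝ → Mat m) : Prop :=
  ∀ i j : Fin m, LocallyIntegrable (fun z : ℝ × ℝ => K z.1 z.2 i j) volume

/-- Membership in `A^s_{p,q}`: a locally integrable kernel with finite norm. -/
def MemKernelSpace {m : ℕ} (s p q : ℝ) (K : ℝ → ℝ → Mat m) : Prop :=
  LocIntegrableKernel K ∧ kernelNorm s p q K < ⊤

/-- The operator `(-Δ)^(σ/2)` on Schwartz functions of the line, as the singular integral
`∫ (f(x) - f(y)) / |x - y|^(1 + σ) dy`. For `0 < σ < 1` this integral converges absolutely, so that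
no principal value has to be taken. -/
noncomputable def fracLaplacian (σ : ℝ) (f : 𝓢(ℝ, ℝ)) (x : ℝ) : ℝ :=
  ∫ y : ℝ, (f x - f y) / |x - y| ^ (1 + σ)

/-- `g = (-Δ)^(σ/2) f` with `g` in `L²`, for `f` in the homogeneous Sobolev space of order `σ` on the
line, realised for `0 < σ < 1/2` as the completion of the Schwartz functions: there are Schwartz
functions `φ n` that tend to `f` in `L¹_loc` and for which `(-Δ)^(σ/2) (φ n)` tends to `g` in `L²`.
In particular `f` has no additive constant (which the fractional Laplacian would not see). -/
def IsFracLaplacian (σ : ℝ) (f g : ℝ → ℝ) : Prop :=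
  MemLp g 2 volume ∧
  ∃ φ : ℕ → 𝓢(ℝ, ℝ),
    (∀ R : ℝ, Tendsto (fun n => ∫⁻ x in Set.Icc (-R) R, ‖φ n x - f x‖ₑ) atTop (𝓝 0)) ∧
    Tendsto (fun n => eLpNorm (fun x => fracLaplacian σ (φ n) x - g x) 2 volume) atTop (𝓝 0)

/-- `L = (-Δ_x)^(σ/2) K` for kernels `K` and `L`: the operator acts, entry by entry, on the functions
`x ↦ K(x, x + h)` with `h` fixed. -/
def IsKernelFracLaplacian {m : ℕ} (σ : ℝ) (K L : ℝ → ℝ → Mat m) : Prop :=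
  AEStronglyMeasurable (Function.uncurry L) volume ∧
  ∀ᵐ h : ℝ, ∀ i j : Fin m,
    IsFracLaplacian σ (fun x => K x (x + h) i j) (fun x => L x (x + h) i j)

/-- The homogeneous Sobolev norm of order `1/2`,
`(∫ |h|^(-2) ‖P(· + h) - P‖_{L²}² dh)^(1/2)`. -/
noncomputable def halfSobolevNorm {m : ℕ} (P : ℝ → Mat m) : ℝ≥0∞ :=
  (∫⁻ h : ℝ, ENNReal.ofReal (|h| ^ (-2 : ℝ)) *
    (eLpNorm (fun x : ℝ => frob (P (x + h) - P x)) 2 volume) ^ (2 : ℝ)) ^ (1 / 2 : ℝ)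

/-- Maps in the homogeneous Sobolev space of order `1/2` on the line with values in the orthogonal
group `O(m)`. -/
def MemHalfSobolevOrthogonal {m : ℕ} (P : ℝ → Mat m) : Prop :=
  AEStronglyMeasurable P volume ∧
  (∀ᵐ x : ℝ, P x ∈ Matrix.orthogonalGroup (Fin m) ℝ) ∧ halfSobolevNorm P < ⊤

/-- The quasi-norm `sup_t t |{‖v‖ > t}|^(1/2)` of the weak space `L^{2,∞}`. -/
noncomputable def weakL2Norm {m : ℕ} (v : ℝ → Vec m) : ℝ≥0∞ :=
  ⨆ t : ℝ≥0, (t : ℝ≥0∞) * (volume {x : ℝ | (t : ℝ≥0∞) < ‖v x‖ₑ}) ^ (1 / 2 : ℝ)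

/-- Membership in `L^{2,∞}`. -/
def MemWeakL2 {m : ℕ} (v : ℝ → Vec m) : Prop :=
  AEStronglyMeasurable v volume ∧ weakL2Norm v < ⊤

/-- The kernel is anti-self-dual: `K(x, y) = - K(y, x)ᵗ` almost everywhere. -/
def AntiSelfDual {m : ℕ} (K : ℝ → ℝ → Mat m) : Prop :=
  ∀ᵐ z : ℝ × ℝ, K z.1 z.2 = -(K z.2 z.1)ᵀ

/-- The integrand `K(x, y)ᵗ v(x) + K(x, y) v(y)` of the multi-commutator. -/
noncomputable def commIntegrand {m : ℕ} (K : ℝ → ℝ → Mat m) (v : ℝ → Vec m) (x y : ℝ) : Vec m :=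
  act (K x y)ᵀ (v x) + act (K x y) (v y)

/-- The multi-commutator `T_K(v)(x) = ∫ [K(x, y)ᵗ v(x) + K(x, y) v(y)] dy` at a point where the
integral converges absolutely. -/
noncomputable def comm {m : ℕ} (K : ℝ → ℝ → Mat m) (v : ℝ → Vec m) (x : ℝ) : Vec m :=
  ∫ y : ℝ, commIntegrand K v x y

/-- The distribution `T_K(v)` takes the value `a` on `ψ`: the integral
`∬ ψ(x) · [K(x, y)ᵗ v(x) + K(x, y) v(y)] dx dy` converges absolutely away from the diagonal, and it
equals `a` as a principal value at the diagonal. -/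
def HasCommPairing {m : ℕ} (K : ℝ → ℝ → Mat m) (v : ℝ → Vec m) (ψ : ℝ → Vec m) (a : ℝ) : Prop :=
  (∀ ε : ℝ, 0 < ε → IntegrableOn
    (fun z : ℝ × ℝ => inner ℝ (ψ z.1) (commIntegrand K v z.1 z.2)) {z | ε < |z.1 - z.2|} volume) ∧
  Tendsto (fun ε : ℝ => ∫ z in {z : ℝ × ℝ | ε < |z.1 - z.2|},
    inner ℝ (ψ z.1) (commIntegrand K v z.1 z.2)) (𝓝[>] 0) (𝓝 a)

/-- The conjugated kernel `G(x, y) = P(x) K(x, y) P(y)ᵗ`. -/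
def conjKernel {m : ℕ} (P : ℝ → Mat m) (K : ℝ → ℝ → Mat m) (x y : ℝ) : Mat m :=
  P x * K x y * (P y)ᵀ

/-- The integrand `(P(x) - P(y)) K(x, y)ᵗ v(x)` of the remainder. -/
noncomputable def remIntegrand {m : ℕ} (P : ℝ → Mat m) (K : ℝ → ℝ → Mat m) (v : ℝ → Vec m)
    (x y : ℝ) : Vec m :=
  act ((P x - P y) * (K x y)ᵀ) (v x)

/-- The remainder operator `v ↦ ∫ (P(x) - P(y)) K(x, y)ᵗ v(x) dy`. -/
noncomputable def remOp {m : ℕ} (P : ℝ → Mat m) (K : ℝ → ℝ → Mat m) (v : ℝ → Vec m) (x : ℝ) :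
    Vec m :=
  ∫ y : ℝ, remIntegrand P K v x y

end MultiComm

/-! ### Changes of variable on the line, and Plancherel for the Fourier integral. -/

namespace MultiComm

open scoped FourierTransform RealInnerProductSpace

/-! The identity is algebra. Since Pᵗ P = 1, one has Gᵗ(x,y) P(x) = P(y) Kᵗ(x,y) and G(x,y) P(y) =
P(x) K(x,y), so P(x) times the integrand of T_K(v) exceeds the integrand of T_G(Pv) by exactly (P(x)
- P(y)) Kᵗ(x,y) v(x). Once this term is known to be integrable on the plane
(`lintegral_remIntegrand_le`), it can be added to or removed from any of the integrals, at a point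
or truncated near the diagonal.

On each line y = x + h the Sobolev embedding into L^p, 1/p = 1/2 - σ, places K in A^{-σ}_{p,2}
(`schwartz_sobolev`, `kernelNorm_sobolev`). Orthogonal factors preserve the Frobenius norm, so G
lies there too.

The trilinear integral is the hard point. Against L^p and weak L², Hölder would require P(x) -
P(x+h) in the Lorentz space L^{1/σ,1}, whereas the norm of P controls only L² norms of differences.
The difference is therefore telescoped through averages over intervals of length 2^{-n}|h| shrinking
to each of the two endpoints (`enorm_sub_le_tsum`). An increment at length r is bounded by a mean
oscillation whose supremum is at most r^{-1/2} times the bound for its L² norm. Cutting v at a level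
proportional to r^{-1/2} and using the L² bound below it and the sup bound above it gives the factor
r^{-(1/2-σ)} (`WeakBound.lintegral_mul_mul_le`). Cauchy-Schwarz in h then leaves 2^{-nσ}, which is
summable (`lintegral_sub_mul_le`).

For an anti-self-dual kernel, exchanging x and y in half of the truncated integral moves the
difference onto the test function. The factor min(1, |x-y|) so gained makes the integral absolutely
convergent (`exists_hasCommPairing`). -/

theorem lintegral_comp_mul_left (f : ℝ → ℝ≥0∞) {c : ℝ} (hc : c ≠ 0) :
    ∫⁻ h, f (c * h) = ENNReal.ofReal |c⁻¹| * ∫⁻ h, f h := by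
  rw [← smul_eq_mul, ← lintegral_smul_measure, ← Real.map_volume_mul_left hc]
  exact ((Homeomorph.mulLeft₀ c hc).measurableEmbedding.lintegral_map f).symm

theorem lintegral_comp_abs_le {f : ℝ → ℝ≥0∞} (hf : ∀ x, f (-x) = f x) :
    ∫⁻ h, f h = 2 * ∫⁻ h in Set.Ioi (0 : ℝ), f h := by
  rw [← lintegral_add_compl f (measurableSet_Iic (a := (0 : ℝ))), Set.compl_Iic, two_mul]
  congr 1
  rw [setLIntegral_congr (Iio_ae_eq_Iic (a := (0 : ℝ))).symm]
  have h := (Measure.measurePreserving_neg (volume : Measure ℝ)).setLIntegral_comp_preimage_emb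
    (Homeomorph.neg ℝ).measurableEmbedding f (Set.Iio 0)
  rw [← h]
  simp [hf]

/-- Convergence at the origin uses `s < 1`, at infinity `0 < s`. The multipliers, the fractional
Laplacian and the symmetrised pairing are all reduced to this integral. -/
theorem lintegral_min_rpow_lt_top {s : ℝ} (hs : 0 < s) (hs' : s < 1) :
    ∫⁻ h : ℝ, ENNReal.ofReal (|h| ^ (-1 - s) * min 1 |h|) < ⊤ := by
  rw [lintegral_comp_abs_le (by simp)]
  refine ENNReal.mul_lt_top (by simp) ?_
  rw [← Set.Ioc_union_Ioi_eq_Ioi (zero_le_one' ℝ)]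
  refine (lintegral_union_le _ _ _).trans_lt (ENNReal.add_lt_top.2 ⟨?_, ?_⟩)
  · have : IntegrableOn (fun h : ℝ => h ^ (-s)) (Set.Ioc 0 1) := by
      rw [← intervalIntegrable_iff_integrableOn_Ioc_of_le zero_le_one]
      exact intervalIntegral.intervalIntegrable_rpow' (by linarith)
    refine lt_of_eq_of_lt (setLIntegral_congr_fun measurableSet_Ioc fun h hh => ?_)
      this.lintegral_lt_top
    have h0 : 0 < h := hh.1
    simp only [abs_of_pos h0, min_eq_right hh.2]
    rw [← Real.rpow_add_one h0.ne']
    congr 2; ring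
  · have : IntegrableOn (fun h : ℝ => h ^ (-1 - s)) (Set.Ioi 1) :=
      integrableOn_Ioi_rpow_of_lt (by linarith) one_pos
    refine lt_of_eq_of_lt (setLIntegral_congr_fun measurableSet_Ioi fun h hh => ?_)
      this.lintegral_lt_top
    have h0 : 1 < h := hh
    simp only [abs_of_pos (zero_lt_one.trans h0), min_eq_left h0.le, mul_one]

/-- Tested against a smooth compactly supported function, both transforms pass to the test function,
so they agree as distributions. Plancherel then holds for the Fourier integral itself, in which the
multipliers are computed. -/
theorem fourier_ae_eq_Lp_fourier {g : ℝ → ℂ} (hg : Integrable g) (hg2 : MemLp g 2) :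
    𝓕 g =ᵐ[volume] (𝓕 (hg2.toLp g) : Lp (α := ℝ) ℂ 2) := by
  have hcont : Continuous (𝓕 g) :=
    VectorFourier.fourierIntegral_continuous Real.continuous_fourierChar
      continuous_inner hg
  refine ae_eq_of_integral_contDiff_smul_eq hcont.locallyIntegrable
    ((Lp.memLp _).locallyIntegrable (by norm_num)) fun u hu hus => ?_
  have hus' : HasCompactSupport (fun x => (u x : ℂ)) := hus.comp_left (g := Complex.ofReal) rfl
  have hu' : ContDiff ℝ ∞ (fun x => (u x : ℂ)) := Complex.ofRealCLM.contDiff.comp hu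
  let U : 𝓢(ℝ, ℂ) := hus'.toSchwartzMap hu'
  have hU : ∀ x, U x = (u x : ℂ) := fun x => rfl
  have h1 := congrArg (fun T : 𝓢'(ℝ, ℂ) => T U)
    (Lp.fourier_toTemperedDistribution_eq (hg2.toLp g))
  simp only [TemperedDistribution.fourier_apply, Lp.toTemperedDistribution_apply, hU] at h1
  simp only [smul_eq_mul, Complex.real_smul] at h1 ⊢
  rw [← h1]
  have h2 := VectorFourier.integral_fourierIntegral_smul_eq_flip (L := innerₗ ℝ)
    (μ := volume) (ν := volume) (f := U) (g := g)
    Real.continuous_fourierChar continuous_inner U.integrable hg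
  have h3 : ∫ x, (𝓕 U) x * (hg2.toLp g) x = ∫ x, (𝓕 U) x * g x := by
    refine integral_congr_ae ?_
    filter_upwards [hg2.coeFn_toLp] with x hx
    rw [hx]
  rw [h3]
  simp only [smul_eq_mul, flip_innerₗ] at h2
  exact h2.symm

theorem eLpNorm_fourier {g : ℝ → ℂ} (hg : Integrable g) (hg2 : MemLp g 2) :
    eLpNorm (𝓕 g) 2 volume = eLpNorm g 2 volume := by
  rw [eLpNorm_congr_ae (fourier_ae_eq_Lp_fourier hg hg2), ← Lp.enorm_def,
    ← eLpNorm_congr_ae hg2.coeFn_toLp, ← Lp.enorm_def, ← ofReal_norm, ← ofReal_norm,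
    Lp.norm_fourier_eq]

theorem lintegral_fourier_sq {g : ℝ → ℂ} (hg : Integrable g) (hg2 : MemLp g 2) :
    ∫⁻ x, ‖𝓕 g x‖ₑ ^ 2 = ∫⁻ x, ‖g x‖ₑ ^ 2 := by
  have h := eLpNorm_fourier hg hg2
  rw [eLpNorm_eq_lintegral_rpow_enorm_toReal (by norm_num) (by norm_num),
    eLpNorm_eq_lintegral_rpow_enorm_toReal (by norm_num) (by norm_num)] at h
  have h' := ENNReal.rpow_left_injective (by norm_num) h
  simpa using h'

end MultiComm

/-! ### Multipliers of the Gagliardo seminorm and of the fractional Laplacian. -/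

namespace MultiComm

open scoped FourierTransform RealInnerProductSpace

/-- The multiplier `∫ |h|^(-1-t) |1 - e(hξ)|² dh`. -/
noncomputable def symbolInt (t ξ : ℝ) : ℝ≥0∞ :=
  ∫⁻ h : ℝ, ENNReal.ofReal (|h| ^ (-1 - t)) * ‖1 - (Real.fourierChar (h * ξ) : ℂ)‖ₑ ^ 2

/-- Homogeneity from the substitution h ↦ ξh. It is first obtained up to the finite nonzero factor
|ξ|^(-1-t), which is then cancelled. -/
theorem symbolInt_eq {t : ℝ} (ht : 0 < t) (ξ : ℝ) :
    symbolInt t ξ = ENNReal.ofReal (|ξ| ^ t) * symbolInt t 1 := by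
  rcases eq_or_ne ξ 0 with rfl | hξ
  · simp [symbolInt, Real.zero_rpow ht.ne']
  have h := lintegral_comp_mul_left (fun h : ℝ => ENNReal.ofReal (|h| ^ (-1 - t)) *
    ‖1 - (Real.fourierChar (h * 1) : ℂ)‖ₑ ^ 2) hξ
  have hpos : 0 < |ξ| := abs_pos.2 hξ
  have h2 : ENNReal.ofReal (|ξ| ^ (-1 - t)) * symbolInt t ξ
      = ENNReal.ofReal |ξ⁻¹| * symbolInt t 1 := by
    unfold symbolInt
    rw [← h, ← lintegral_const_mul' _ _ ENNReal.ofReal_ne_top]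
    refine lintegral_congr fun x => ?_
    rw [abs_mul, Real.mul_rpow (abs_nonneg _) (abs_nonneg _),
      ENNReal.ofReal_mul (by positivity), mul_assoc, mul_one, mul_comm ξ x]
  have h3 : ENNReal.ofReal (|ξ| ^ (1 + t)) * ENNReal.ofReal (|ξ| ^ (-1 - t)) = 1 := by
    rw [← ENNReal.ofReal_mul (by positivity), ← Real.rpow_add hpos]
    simp
  have h4 : ENNReal.ofReal (|ξ| ^ (1 + t)) * ENNReal.ofReal |ξ⁻¹| = ENNReal.ofReal (|ξ| ^ t) := by
    rw [← ENNReal.ofReal_mul (by positivity), abs_inv, ← Real.rpow_neg_one,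
      ← Real.rpow_add hpos]
    congr 2; ring
  rw [← one_mul (symbolInt t ξ), ← h3, mul_assoc, h2, ← mul_assoc, h4]

theorem norm_one_sub_fourierChar_le (x : ℝ) :
    ‖1 - (Real.fourierChar x : ℂ)‖ ≤ 2 * Real.pi * min 1 |x| := by
  have h1 : ‖1 - (Real.fourierChar x : ℂ)‖ ≤ 2 := by
    have h : ‖(Real.fourierChar x : ℂ)‖ = 1 := Circle.norm_coe _
    refine (norm_sub_le _ _).trans ?_
    rw [h, norm_one]; norm_num
  have h2 : ‖1 - (Real.fourierChar x : ℂ)‖ ≤ 2 * Real.pi * |x| := by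
    rw [norm_sub_rev, Real.fourierChar_apply, mul_comm _ Complex.I]
    refine (Real.norm_exp_I_mul_ofReal_sub_one_le).trans ?_
    simp [abs_of_pos Real.pi_pos]
  have := Real.pi_gt_three
  rcases le_total 1 |x| with h | h
  · rw [min_eq_left h]; linarith
  · rw [min_eq_right h]; exact h2

theorem symbolInt_one_lt_top {t : ℝ} (ht : 0 < t) (ht' : t < 1) : symbolInt t 1 < ⊤ := by
  have : symbolInt t 1 ≤ ENNReal.ofReal ((2 * Real.pi) ^ 2) *
      ∫⁻ h : ℝ, ENNReal.ofReal (|h| ^ (-1 - t) * min 1 |h|) := by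
    unfold symbolInt
    rw [← lintegral_const_mul' _ _ ENNReal.ofReal_ne_top]
    refine lintegral_mono fun h => ?_
    rw [← ofReal_norm, ← ENNReal.ofReal_pow (norm_nonneg _), ← ENNReal.ofReal_mul (by positivity),
      ← ENNReal.ofReal_mul (by positivity)]
    refine ENNReal.ofReal_le_ofReal ?_
    have h0 : (0 : ℝ) ≤ min 1 |h| := by positivity
    -- Giving up one power restricts the order to t < 1, which suffices: only t = s and t = 2s with
    -- s < 1/2 occur.
    have h1 : min 1 |h| ^ 2 ≤ min 1 |h| := by
      have : min 1 |h| ≤ 1 := min_le_left _ _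
      nlinarith
    have h2 := norm_one_sub_fourierChar_le (h * 1)
    rw [mul_one] at h2 ⊢
    calc |h| ^ (-1 - t) * ‖1 - (Real.fourierChar h : ℂ)‖ ^ 2
        ≤ |h| ^ (-1 - t) * (2 * Real.pi * min 1 |h|) ^ 2 := by gcongr
      _ = (2 * Real.pi) ^ 2 * (|h| ^ (-1 - t) * min 1 |h| ^ 2) := by ring
      _ ≤ _ := by gcongr
  exact this.trans_lt (ENNReal.mul_lt_top ENNReal.ofReal_lt_top (lintegral_min_rpow_lt_top ht ht'))

theorem measurable_symbol (t ξ : ℝ) : Measurable fun h : ℝ =>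
    ENNReal.ofReal (|h| ^ (-1 - t)) * ‖1 - (Real.fourierChar (h * ξ) : ℂ)‖ₑ ^ 2 := by
  have : Continuous fun h : ℝ => (Real.fourierChar (h * ξ) : ℂ) :=
    continuous_subtype_val.comp (Real.continuous_fourierChar.comp (by fun_prop))
  have := this.measurable
  fun_prop

theorem symbolInt_one_ne_zero (t : ℝ) : symbolInt t 1 ≠ 0 := by
  intro h
  rw [symbolInt, lintegral_eq_zero_iff (measurable_symbol t 1)] at h
  have h2 : volume (Set.Ioo (0 : ℝ) 1) = 0 := by
    refine measure_mono_null (fun x hx => ?_) h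
    have hx0 : 0 < x := hx.1
    simp only [Set.mem_compl_iff, Set.mem_ofPred_eq, Pi.zero_apply, mul_eq_zero, not_or, mul_one,
      ENNReal.ofReal_eq_zero, not_le]
    refine ⟨by positivity, ?_⟩
    simp only [ne_eq, pow_eq_zero_iff, OfNat.ofNat_ne_zero, not_false_eq_true, enorm_eq_zero,
      sub_eq_zero]
    intro hc
    rw [eq_comm, Real.fourierChar_apply, Complex.exp_eq_one_iff] at hc
    obtain ⟨n, hn⟩ := hc
    have h3 : ((2 * Real.pi * x : ℝ) : ℂ) = ((n * (2 * Real.pi) : ℝ) : ℂ) := by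
      apply mul_right_cancel₀ Complex.I_ne_zero
      rw [hn]; push_cast; ring
    have h4 := Complex.ofReal_injective h3
    have h5 : x = n := by
      have := Real.pi_pos
      apply mul_left_cancel₀ (show 2 * Real.pi ≠ 0 by positivity)
      linarith
    have h6 : (0 : ℝ) < n := h5 ▸ hx.1
    have h7 : (n : ℝ) < 1 := h5 ▸ hx.2
    norm_cast at h6 h7
    omega
  simp at h2

/-- The symbol of the fractional Laplacian of order `s`. -/
noncomputable def symbol (s ξ : ℝ) : ℂ :=
  ∫ h : ℝ, ((|h| ^ (-1 - s) : ℝ) : ℂ) * (1 - (Real.fourierChar (h * ξ) : ℂ))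

theorem integrable_symbol {s : ℝ} (hs : 0 < s) (hs' : s < 1) (ξ : ℝ) :
    Integrable fun h : ℝ => ((|h| ^ (-1 - s) : ℝ) : ℂ) * (1 - (Real.fourierChar (h * ξ) : ℂ)) := by
  have hc : Continuous fun h : ℝ => (Real.fourierChar (h * ξ) : ℂ) :=
    continuous_subtype_val.comp (Real.continuous_fourierChar.comp (by fun_prop))
  have hm := hc.measurable
  refine ⟨Measurable.aestronglyMeasurable (by fun_prop), ?_⟩
  have : ∫⁻ h : ℝ, ‖((|h| ^ (-1 - s) : ℝ) : ℂ) * (1 - (Real.fourierChar (h * ξ) : ℂ))‖ₑ ≤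
      ENNReal.ofReal (2 * Real.pi * max 1 |ξ|) *
      ∫⁻ h : ℝ, ENNReal.ofReal (|h| ^ (-1 - s) * min 1 |h|) := by
    rw [← lintegral_const_mul' _ _ ENNReal.ofReal_ne_top]
    refine lintegral_mono fun h => ?_
    rw [← ofReal_norm, ← ENNReal.ofReal_mul (by positivity)]
    refine ENNReal.ofReal_le_ofReal ?_
    rw [norm_mul, Complex.norm_real, Real.norm_of_nonneg (by positivity)]
    have h2 := norm_one_sub_fourierChar_le (h * ξ)
    have h3 : min 1 |h * ξ| ≤ max 1 |ξ| * min 1 |h| := by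
      rw [abs_mul]
      rcases le_total 1 |h| with h' | h'
      · rw [min_eq_left h', mul_one]
        exact (min_le_left _ _).trans (le_max_left _ _)
      · rw [min_eq_right h', mul_comm]
        refine (min_le_right _ _).trans ?_
        gcongr
        exact le_max_right _ _
    calc |h| ^ (-1 - s) * ‖1 - (Real.fourierChar (h * ξ) : ℂ)‖
        ≤ |h| ^ (-1 - s) * (2 * Real.pi * (max 1 |ξ| * min 1 |h|)) := by
          gcongr
          exact h2.trans (by gcongr)
      _ = _ := by ring
  exact this.trans_lt (ENNReal.mul_lt_top ENNReal.ofReal_lt_top (lintegral_min_rpow_lt_top hs hs'))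

/-- On the unit circle Re(1 - e) = |1 - e|²/2, so the left side is twice the real part of the
symbol. A lower bound for the symbol is all that is needed, hence its imaginary part is never
computed. -/
theorem symbolInt_le_enorm_symbol {s : ℝ} (hs : 0 < s) (hs' : s < 1) (ξ : ℝ) :
    symbolInt s ξ ≤ 2 * ‖symbol s ξ‖ₑ := by
  have hi := integrable_symbol hs hs' ξ
  have hre : ∀ h : ℝ, (((|h| ^ (-1 - s) : ℝ) : ℂ) * (1 - (Real.fourierChar (h * ξ) : ℂ))).re
      = |h| ^ (-1 - s) * (‖1 - (Real.fourierChar (h * ξ) : ℂ)‖ ^ 2 / 2) := by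
    intro h
    rw [Complex.re_ofReal_mul]
    congr 1
    have h1 : Complex.normSq (Real.fourierChar (h * ξ) : ℂ) = 1 := Circle.normSq_coe _
    rw [← Complex.normSq_eq_norm_sq, Complex.normSq_apply] at *
    simp only [Complex.sub_re, Complex.one_re, Complex.sub_im, Complex.one_im]
    linarith
  have h1 : (symbol s ξ).re = ∫ h : ℝ,
      |h| ^ (-1 - s) * (‖1 - (Real.fourierChar (h * ξ) : ℂ)‖ ^ 2 / 2) := by
    rw [symbol, ← RCLike.re_eq_complex_re, ← integral_re hi]
    exact integral_congr_ae (.of_forall hre)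
  have h2 : ENNReal.ofReal ((symbol s ξ).re) = ∫⁻ h : ℝ,
      ENNReal.ofReal (|h| ^ (-1 - s) * (‖1 - (Real.fourierChar (h * ξ) : ℂ)‖ ^ 2 / 2)) := by
    rw [h1, ofReal_integral_eq_lintegral_ofReal]
    · exact hi.re.congr (.of_forall hre)
    · exact .of_forall fun h => by positivity
  calc symbolInt s ξ = 2 * ENNReal.ofReal ((symbol s ξ).re) := by
        rw [h2, symbolInt, ← lintegral_const_mul' _ _ (by simp)]
        refine lintegral_congr fun h => ?_
        rw [← ofReal_norm, ← ENNReal.ofReal_pow (norm_nonneg _),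
          ← ENNReal.ofReal_mul (by positivity),
          show (2 : ℝ≥0∞) = ENNReal.ofReal 2 by simp, ← ENNReal.ofReal_mul (by positivity)]
        congr 1; ring
    _ ≤ 2 * ‖symbol s ξ‖ₑ := by
        gcongr
        rw [← ofReal_norm]
        exact ENNReal.ofReal_le_ofReal (Complex.re_le_norm _)

/-- The triangle inequality serves for |h| ≥ 1 and the fundamental theorem of calculus for |h| ≤ 1.
This makes the integrand of the fractional Laplacian integrable in (x, h), so that Fubini applies to
its Fourier transform. -/
theorem lintegral_enorm_sub_translate_le (φ : 𝓢(ℝ, ℝ)) :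
    ∃ C : ℝ≥0, ∀ h : ℝ, ∫⁻ x, ‖φ x - φ (x + h)‖ₑ ≤ C * ENNReal.ofReal (min 1 |h|) := by
  have hφ : ∫⁻ x, ‖φ x‖ₑ ≠ ⊤ := φ.integrable.2.ne
  have hd : ∫⁻ x, ‖deriv φ x‖ₑ ≠ ⊤ := (SchwartzMap.derivCLM ℝ ℝ φ).integrable.2.ne
  set A := ∫⁻ x, ‖φ x‖ₑ
  set B := ∫⁻ x, ‖deriv φ x‖ₑ
  have h1 : ∀ h : ℝ, ∫⁻ x, ‖φ x - φ (x + h)‖ₑ ≤ 2 * A := fun h => by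
    calc ∫⁻ x, ‖φ x - φ (x + h)‖ₑ ≤ ∫⁻ x, (‖φ x‖ₑ + ‖φ (x + h)‖ₑ) :=
          lintegral_mono fun x => enorm_sub_le
      _ = A + A := by
        rw [lintegral_add_left φ.continuous.measurable.enorm,
          lintegral_add_right_eq_self (fun x => ‖φ x‖ₑ)]
      _ = _ := (two_mul _).symm
  have hdc : Continuous (deriv φ) := (SchwartzMap.derivCLM ℝ ℝ φ).continuous
  have h2 : ∀ h : ℝ, ∫⁻ x, ‖φ x - φ (x + h)‖ₑ ≤ ENNReal.ofReal |h| * B := fun h => by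
    have hpt : ∀ x, ‖φ x - φ (x + h)‖ₑ ≤
        ∫⁻ t in Set.Ioc (0 : ℝ) 1, ENNReal.ofReal |h| * ‖deriv φ (x + t * h)‖ₑ := fun x => by
      have hder : ∀ t ∈ Set.uIcc (0 : ℝ) 1,
          HasDerivAt (fun t : ℝ => φ (x + t * h)) (deriv φ (x + t * h) * h) t := fun t _ => by
        have hl : HasDerivAt (fun t : ℝ => x + t * h) h t := by
          simpa using ((hasDerivAt_id t).mul_const h).const_add x
        exact (φ.hasDerivAt _).comp t hl
      have hc : Continuous fun t : ℝ => deriv φ (x + t * h) * h := by fun_prop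
      have hint := intervalIntegral.integral_eq_sub_of_hasDerivAt hder
        (hc.intervalIntegrable 0 1)
      simp only [one_mul, zero_mul, add_zero] at hint
      rw [← neg_sub (φ (x + h)), enorm_neg, ← hint, intervalIntegral.integral_of_le zero_le_one]
      refine (enorm_integral_le_lintegral_enorm _).trans (le_of_eq ?_)
      refine lintegral_congr fun t => ?_
      rw [enorm_mul, mul_comm, Real.enorm_eq_ofReal_abs h]
    calc ∫⁻ x, ‖φ x - φ (x + h)‖ₑ
        ≤ ∫⁻ x, ∫⁻ t in Set.Ioc (0 : ℝ) 1, ENNReal.ofReal |h| * ‖deriv φ (x + t * h)‖ₑ :=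
          lintegral_mono hpt
      _ = ∫⁻ t in Set.Ioc (0 : ℝ) 1, ∫⁻ x, ENNReal.ofReal |h| * ‖deriv φ (x + t * h)‖ₑ := by
          rw [lintegral_lintegral_swap]
          have : Continuous fun p : ℝ × ℝ => deriv φ (p.1 + p.2 * h) := by fun_prop
          exact (this.measurable.enorm.const_mul _).aemeasurable
      _ = ∫⁻ t in Set.Ioc (0 : ℝ) 1, ENNReal.ofReal |h| * B := by
          refine lintegral_congr fun t => ?_
          rw [lintegral_const_mul' _ _ ENNReal.ofReal_ne_top,
            lintegral_add_right_eq_self (fun x => ‖deriv φ x‖ₑ)]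
      _ = _ := by simp
  refine ⟨(max (2 * A) B).toNNReal, fun h => ?_⟩
  rw [ENNReal.coe_toNNReal (by simp [A, B, hφ, hd, ENNReal.mul_eq_top])]
  rcases le_total 1 |h| with h' | h'
  · rw [min_eq_left h']
    simpa using Or.inl (h1 h)
  · rw [min_eq_right h', mul_comm]
    exact (h2 h).trans (by gcongr; exact le_max_right _ _)

end MultiComm

/-! ### The Gagliardo seminorm is controlled by the fractional Laplacian. -/

namespace MultiComm

open scoped FourierTransform RealInnerProductSpace

theorem enorm_ofReal_complex (r : ℝ) : ‖(r : ℂ)‖ₑ = ‖r‖ₑ := by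
  rw [← ofReal_norm, ← ofReal_norm, Complex.norm_real]

theorem fourier_comp_add_right (f : ℝ → ℂ) (h ξ : ℝ) :
    𝓕 (fun x => f (x + h)) ξ = Real.fourierChar (h * ξ) * 𝓕 f ξ := by
  have := congrFun (VectorFourier.fourierIntegral_comp_add_right Real.fourierChar volume
    (innerₗ ℝ) f h) ξ
  refine this.trans ?_
  have hi : innerₗ ℝ h ξ = h * ξ := by simp [mul_comm]
  rw [Circle.smul_def, smul_eq_mul, hi]
  rfl

theorem integrable_fourierChar_smul {f : ℝ → ℂ} (hf : Integrable f) (ξ : ℝ) :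
    Integrable fun v => Real.fourierChar (-(v * ξ)) • f v := by
  have h := (Real.fourierIntegral_convergent_iff ξ).2 hf
  have hi : ∀ v : ℝ, inner ℝ v ξ = v * ξ := fun v => by simp [mul_comm]
  simpa only [hi] using h

theorem fourier_sub_translate {f : ℝ → ℂ} (hf : Integrable f) (h ξ : ℝ) :
    𝓕 (fun x => f x - f (x + h)) ξ = (1 - Real.fourierChar (h * ξ)) * 𝓕 f ξ := by
  rw [sub_mul, one_mul, ← fourier_comp_add_right, Real.fourier_real_eq, Real.fourier_real_eq,
    Real.fourier_real_eq, ← integral_sub]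
  · simp only [smul_sub]
  · exact integrable_fourierChar_smul hf ξ
  · exact integrable_fourierChar_smul (hf.comp_add_right h) ξ

theorem fracLaplacian_eq (s : ℝ) (φ : 𝓢(ℝ, ℝ)) (x : ℝ) :
    (fracLaplacian s φ x : ℂ) = ∫ h : ℝ, ((φ x - φ (x + h) : ℝ) : ℂ) * ((|h| ^ (-1 - s) : ℝ) : ℂ) := by
  have h1 : fracLaplacian s φ x = ∫ h : ℝ, (φ x - φ (x + h)) * |h| ^ (-1 - s) := by
    rw [fracLaplacian, ← integral_add_left_eq_self _ x]
    refine integral_congr_ae (.of_forall fun h => ?_)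
    simp only [sub_add_cancel_left, abs_neg]
    rw [div_eq_mul_inv, ← Real.rpow_neg (abs_nonneg _)]
    congr 2; ring
  rw [h1, ← integral_complex_ofReal]
  simp

theorem integrable_fracLaplacian_kernel {s : ℝ} (hs : 0 < s) (hs' : s < 1) (φ : 𝓢(ℝ, ℝ)) :
    Integrable (fun z : ℝ × ℝ =>
      ((φ z.1 - φ (z.1 + z.2) : ℝ) : ℂ) * ((|z.2| ^ (-1 - s) : ℝ) : ℂ)) := by
  have hφ := φ.continuous.measurable
  have hm : Measurable (fun z : ℝ × ℝ =>
      ((φ z.1 - φ (z.1 + z.2) : ℝ) : ℂ) * ((|z.2| ^ (-1 - s) : ℝ) : ℂ)) := by fun_prop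
  refine ⟨hm.aestronglyMeasurable, ?_⟩
  obtain ⟨C, hC⟩ := lintegral_enorm_sub_translate_le φ
  rw [HasFiniteIntegral, Measure.volume_eq_prod, lintegral_prod_symm' _ hm.enorm]
  refine lt_of_le_of_lt ?_ (ENNReal.mul_lt_top (ENNReal.coe_lt_top (r := C))
    (lintegral_min_rpow_lt_top hs hs'))
  rw [← lintegral_const_mul' _ _ (by simp)]
  refine lintegral_mono fun h => ?_
  simp only [enorm_mul, enorm_ofReal_complex]
  rw [lintegral_mul_const' _ _ (by simp), Real.enorm_of_nonneg (by positivity), mul_comm,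
    ENNReal.ofReal_mul (by positivity), mul_left_comm]
  gcongr
  exact hC h

theorem fourier_fracLaplacian {s : ℝ} (hs : 0 < s) (hs' : s < 1) (φ : 𝓢(ℝ, ℝ)) (ξ : ℝ) :
    𝓕 (fun x => (fracLaplacian s φ x : ℂ)) ξ = symbol s ξ * 𝓕 (fun x => (φ x : ℂ)) ξ := by
  have hI := integrable_fracLaplacian_kernel hs hs' φ
  have hc : Continuous fun z : ℝ × ℝ => (Real.fourierChar (-(z.1 * ξ)) : ℂ) :=
    continuous_subtype_val.comp (Real.continuous_fourierChar.comp (by fun_prop))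
  have hI2 : Integrable (Function.uncurry fun x h : ℝ => (Real.fourierChar (-(x * ξ)) : ℂ) *
      (((φ x - φ (x + h) : ℝ) : ℂ) * ((|h| ^ (-1 - s) : ℝ) : ℂ))) (volume.prod volume) := by
    refine (hI.bdd_mul (c := 1) hc.aestronglyMeasurable (.of_forall fun z => ?_))
    exact (Circle.norm_coe _).le
  rw [Real.fourier_real_eq]
  calc ∫ x, Real.fourierChar (-(x * ξ)) • (fracLaplacian s φ x : ℂ)
      = ∫ x, ∫ h : ℝ, (Real.fourierChar (-(x * ξ)) : ℂ) *
          (((φ x - φ (x + h) : ℝ) : ℂ) * ((|h| ^ (-1 - s) : ℝ) : ℂ)) := by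
        refine integral_congr_ae (.of_forall fun x => ?_)
        simp only [fracLaplacian_eq, Circle.smul_def, smul_eq_mul]
        rw [integral_const_mul]
    _ = ∫ h : ℝ, ∫ x, (Real.fourierChar (-(x * ξ)) : ℂ) *
          (((φ x - φ (x + h) : ℝ) : ℂ) * ((|h| ^ (-1 - s) : ℝ) : ℂ)) := integral_integral_swap hI2
    _ = ∫ h : ℝ, (((|h| ^ (-1 - s) : ℝ) : ℂ) * (1 - (Real.fourierChar (h * ξ) : ℂ))) *
          𝓕 (fun x => (φ x : ℂ)) ξ := by
        refine integral_congr_ae (.of_forall fun h => ?_)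
        have hφ : Integrable (fun x => (φ x : ℂ)) := φ.integrable.ofReal
        dsimp only
        rw [mul_assoc, ← fourier_sub_translate hφ, Real.fourier_real_eq, ← integral_const_mul]
        refine integral_congr_ae (.of_forall fun x => ?_)
        simp only [Circle.smul_def, smul_eq_mul, Complex.ofReal_sub]
        ring
    _ = _ := by rw [integral_mul_const]; rfl

/-- Plancherel in x for each fixed h, then Tonelli in (h, ξ). -/
theorem gagliardo_eq_lintegral_symbolInt (φ : 𝓢(ℝ, ℝ)) (t : ℝ) :
    ∫⁻ h : ℝ, ENNReal.ofReal (|h| ^ (-1 - t)) * ∫⁻ x, ‖φ x - φ (x + h)‖ₑ ^ 2 =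
      ∫⁻ ξ, symbolInt t ξ * ‖𝓕 (fun x => (φ x : ℂ)) ξ‖ₑ ^ 2 := by
  have hφ : Integrable (fun x => (φ x : ℂ)) := φ.integrable.ofReal
  have hφ2 : MemLp (fun x => (φ x : ℂ)) 2 := (φ.memLp 2).ofReal
  have h1 : ∀ h : ℝ, ∫⁻ x, ‖φ x - φ (x + h)‖ₑ ^ 2 =
      ∫⁻ ξ, ‖1 - (Real.fourierChar (h * ξ) : ℂ)‖ₑ ^ 2 * ‖𝓕 (fun x => (φ x : ℂ)) ξ‖ₑ ^ 2 := by
    intro h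
    have h2 : MemLp (fun x => (φ x : ℂ) - (φ (x + h) : ℂ)) 2 :=
      hφ2.sub (hφ2.comp_measurePreserving (measurePreserving_add_right volume h))
    have hsub : Integrable (fun x => (φ x : ℂ) - (φ (x + h) : ℂ)) :=
      hφ.sub (hφ.comp_add_right h)
    have h4 : ∀ x, ‖φ x - φ (x + h)‖ₑ = ‖(φ x : ℂ) - (φ (x + h) : ℂ)‖ₑ := fun x => by
      rw [← enorm_ofReal_complex, Complex.ofReal_sub]
    simp only [h4]
    rw [← lintegral_fourier_sq hsub h2]
    refine lintegral_congr fun ξ => ?_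
    rw [← mul_pow, ← enorm_mul, ← fourier_sub_translate hφ]
  have hcF : Continuous (𝓕 (fun x => (φ x : ℂ))) :=
    VectorFourier.fourierIntegral_continuous Real.continuous_fourierChar continuous_inner hφ
  have hc : Continuous fun z : ℝ × ℝ => (Real.fourierChar (z.1 * z.2) : ℂ) :=
    continuous_subtype_val.comp (Real.continuous_fourierChar.comp (by fun_prop))
  have hm := hc.measurable
  have hmF := hcF.measurable
  have hM : Measurable fun z : ℝ × ℝ => ENNReal.ofReal (|z.1| ^ (-1 - t)) *
      (‖1 - (Real.fourierChar (z.1 * z.2) : ℂ)‖ₑ ^ 2 * ‖𝓕 (fun x => (φ x : ℂ)) z.2‖ₑ ^ 2) := by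
    fun_prop
  simp only [h1]
  calc _ = ∫⁻ h : ℝ, ∫⁻ ξ, ENNReal.ofReal (|h| ^ (-1 - t)) *
      (‖1 - (Real.fourierChar (h * ξ) : ℂ)‖ₑ ^ 2 * ‖𝓕 (fun x => (φ x : ℂ)) ξ‖ₑ ^ 2) := by
        simp only [lintegral_const_mul' _ _ ENNReal.ofReal_ne_top]
    _ = ∫⁻ ξ, ∫⁻ h : ℝ, ENNReal.ofReal (|h| ^ (-1 - t)) *
      (‖1 - (Real.fourierChar (h * ξ) : ℂ)‖ₑ ^ 2 * ‖𝓕 (fun x => (φ x : ℂ)) ξ‖ₑ ^ 2) :=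
        lintegral_lintegral_swap hM.aemeasurable
    _ = _ := by
        refine lintegral_congr fun ξ => ?_
        simp only [symbolInt, ← mul_assoc]
        rw [lintegral_mul_const' _ _ (by finiteness)]

/-- On the Fourier side the seminorm has weight A|ξ|^(2s), while the symbol of order s is at least
B|ξ|^s/2 in modulus, with A and B positive and finite. This explains the constant A(2/B)². -/
theorem gagliardo_le_fracLaplacian {s : ℝ} (hs : 0 < s) (hs' : s < 1 / 2) :
    ∃ C : ℝ≥0, ∀ φ : 𝓢(ℝ, ℝ),
      ∫⁻ h : ℝ, ENNReal.ofReal (|h| ^ (-1 - 2 * s)) * ∫⁻ x, ‖φ x - φ (x + h)‖ₑ ^ 2 ≤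
        C * ∫⁻ x, ‖fracLaplacian s φ x‖ₑ ^ 2 := by
  have hA := symbolInt_one_lt_top (t := 2 * s) (by linarith) (by linarith)
  have hB := symbolInt_one_lt_top hs (by linarith)
  have hB0 := symbolInt_one_ne_zero s
  have hA0 := symbolInt_one_ne_zero (2 * s)
  set A := symbolInt (2 * s) 1
  set B := symbolInt s 1
  have hBinv : B⁻¹ ≠ 0 := ENNReal.inv_ne_zero.2 hB.ne
  have hBinv' : B⁻¹ ≠ ⊤ := ENNReal.inv_ne_top.2 hB0
  have hCtop : A * (2 * B⁻¹) ^ 2 ≠ ⊤ := by finiteness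
  refine ⟨(A * (2 * B⁻¹) ^ 2).toNNReal, fun φ => ?_⟩
  rw [ENNReal.coe_toNNReal hCtop, gagliardo_eq_lintegral_symbolInt]
  -- If this is finite, the fractional Laplacian lies in L¹ ∩ L² and Plancherel applies to it.
  by_cases htop : ∫⁻ x, ‖fracLaplacian s φ x‖ₑ ^ 2 = ⊤
  · rw [htop, ENNReal.mul_top (by positivity)]
    exact le_top
  have hI := (integrable_fracLaplacian_kernel hs (by linarith) φ).integral_prod_left
  have hg : Integrable (fun x => (fracLaplacian s φ x : ℂ)) :=
    hI.congr (.of_forall fun x => (fracLaplacian_eq s φ x).symm)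
  have hg2 : MemLp (fun x => (fracLaplacian s φ x : ℂ)) 2 := by
    refine ⟨hg.aestronglyMeasurable, ?_⟩
    rw [eLpNorm_lt_top_iff_lintegral_rpow_enorm_lt_top (by norm_num) (by norm_num)]
    simpa [enorm_ofReal_complex] using lt_top_iff_ne_top.2 htop
  have h1 := lintegral_fourier_sq hg hg2
  simp only [enorm_ofReal_complex] at h1
  rw [← h1, ← lintegral_const_mul' _ _ hCtop]
  refine lintegral_mono fun ξ => ?_
  rw [fourier_fracLaplacian hs (by linarith), enorm_mul, mul_pow ‖symbol s ξ‖ₑ, ← mul_assoc]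
  refine mul_le_mul' ?_ le_rfl
  have h2 := symbolInt_le_enorm_symbol hs (by linarith) ξ
  rw [symbolInt_eq (by linarith)] at h2 ⊢
  change _ * B ≤ _ at h2
  change _ * A ≤ _
  have h3 : ENNReal.ofReal (|ξ| ^ s) ≤ 2 * B⁻¹ * ‖symbol s ξ‖ₑ := by
    calc ENNReal.ofReal (|ξ| ^ s) = ENNReal.ofReal (|ξ| ^ s) * B * B⁻¹ := by
          rw [mul_assoc, ENNReal.mul_inv_cancel hB0 hB.ne, mul_one]
      _ ≤ 2 * ‖symbol s ξ‖ₑ * B⁻¹ := by gcongr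
      _ = _ := by ring
  have h4 : ENNReal.ofReal (|ξ| ^ (2 * s)) = ENNReal.ofReal (|ξ| ^ s) ^ 2 := by
    rw [← ENNReal.ofReal_pow (by positivity), mul_comm, Real.rpow_mul (abs_nonneg _)]
    norm_cast
  calc _ = A * ENNReal.ofReal (|ξ| ^ s) ^ 2 := by rw [h4, mul_comm]
    _ ≤ A * (2 * B⁻¹ * ‖symbol s ξ‖ₑ) ^ 2 := by gcongr
    _ = _ := by ring

end MultiComm

/-! ### Sobolev inequality by a pointwise interpolation. -/

namespace MultiComm

theorem eLpNorm_ofReal_eq {α E : Type*} [MeasurableSpace α] {μ : Measure α} [NormedAddCommGroup E]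
    {p : ℝ} (hp : 0 < p) (f : α → E) :
    eLpNorm f (ENNReal.ofReal p) μ = (∫⁻ x, ‖f x‖ₑ ^ p ∂μ) ^ (1 / p) := by
  rw [eLpNorm_eq_lintegral_rpow_enorm_toReal (by simpa using hp) ENNReal.ofReal_ne_top,
    ENNReal.toReal_ofReal hp.le]

/-- The density `∫ |h|^(-1-2s) |f(x) - f(x+h)|² dh` of the Gagliardo seminorm. -/
noncomputable def gagliardoDensity (s : ℝ) (f : ℝ → ℝ) (x : ℝ) : ℝ≥0∞ :=
  ∫⁻ h : ℝ, ENNReal.ofReal (|h| ^ (-1 - 2 * s)) * ‖f x - f (x + h)‖ₑ ^ 2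

theorem lintegral_rpow_mul_measure_le {α : Type*} [MeasurableSpace α] {μ : Measure α}
    {f : α → ℝ≥0∞} (hf : AEMeasurable f μ) {θ : ℝ} (hθ : 0 < θ) (hθ' : θ ≤ 1) :
    ∫⁻ x, f x ∂μ ≤ (∫⁻ x, f x ^ (1 / θ) ∂μ) ^ θ * (μ Set.univ) ^ (1 - θ) := by
  have h := ENNReal.lintegral_mul_norm_pow_le (hf.pow_const (1 / θ)) (aemeasurable_const (b := 1))
    hθ.le (sub_nonneg.2 hθ') (by ring)
  simpa [← ENNReal.rpow_mul, hθ.ne'] using h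

/-- Write f(x) = (f(x) - f(x+h)) + f(x+h) and average over 0 < h ≤ t. Cauchy-Schwarz bounds the
first term by the density at x, Hölder the second by the L^p norm with 1/p = 1/2 - s. -/
theorem enorm_le_gagliardoDensity_add {s : ℝ} (hs : 0 < s) (hs' : s < 1 / 2) {f : ℝ → ℝ}
    (hf : Measurable f) (x : ℝ) {t : ℝ} (ht : 0 < t) :
    ‖f x‖ₑ ≤ ENNReal.ofReal (t ^ s) * gagliardoDensity s f x ^ (1 / 2 : ℝ) +
      ENNReal.ofReal (t ^ (-(1 / 2 - s))) * (∫⁻ y, ‖f y‖ₑ ^ (1 / (1 / 2 - s))) ^ (1 / 2 - s) := by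
  set G := gagliardoDensity s f x with hG
  set F := (∫⁻ y, ‖f y‖ₑ ^ (1 / (1 / 2 - s))) ^ (1 / 2 - s)
  have hθ : 0 < 1 / 2 - s := by linarith
  have hvol : ∀ a : ℝ, (volume.restrict (Set.Ioc (0 : ℝ) t) Set.univ) ^ a
      = ENNReal.ofReal (t ^ a) := fun a => by
    rw [Measure.restrict_apply_univ, Real.volume_Ioc, sub_zero, ENNReal.ofReal_rpow_of_pos ht]
  have h1 : ∫⁻ h in Set.Ioc (0 : ℝ) t, ‖f x - f (x + h)‖ₑ ≤
      ENNReal.ofReal (t ^ (1 + s)) * G ^ (1 / 2 : ℝ) := by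
    have hm : Measurable fun h : ℝ => ‖f x - f (x + h)‖ₑ := by fun_prop
    refine (lintegral_rpow_mul_measure_le hm.aemeasurable (θ := 1 / 2) (by norm_num)
      (by norm_num)).trans ?_
    have h2 : ∫⁻ h in Set.Ioc (0 : ℝ) t, ‖f x - f (x + h)‖ₑ ^ (1 / (1 / 2) : ℝ) ≤
        ENNReal.ofReal (t ^ (1 + 2 * s)) * G := by
      rw [hG, gagliardoDensity, ← lintegral_const_mul' _ _ ENNReal.ofReal_ne_top]
      refine (setLIntegral_mono' measurableSet_Ioc fun h hh => ?_).trans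
        (setLIntegral_le_lintegral _ _)
      have h0 : 0 < h := hh.1
      rw [← mul_assoc, ← ENNReal.ofReal_mul (by positivity), abs_of_pos h0]
      have h3 : 1 ≤ t ^ (1 + 2 * s) * h ^ (-1 - 2 * s) := by
        have h4 : h ^ (1 + 2 * s) ≤ t ^ (1 + 2 * s) :=
          Real.rpow_le_rpow h0.le hh.2 (by linarith)
        calc (1 : ℝ) = h ^ (1 + 2 * s) * h ^ (-1 - 2 * s) := by
              rw [← Real.rpow_add h0]; simp
          _ ≤ _ := by gcongr
      have h5 : (1 / (1 / 2) : ℝ) = (2 : ℕ) := by norm_num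
      rw [h5, ENNReal.rpow_natCast]
      refine le_mul_of_one_le_left' ?_
      simpa using ENNReal.ofReal_le_ofReal h3
    rw [hvol]
    calc _ ≤ (ENNReal.ofReal (t ^ (1 + 2 * s)) * G) ^ (1 / 2 : ℝ) *
          ENNReal.ofReal (t ^ (1 - 1 / 2 : ℝ)) := by gcongr
      _ = _ := by
        rw [ENNReal.mul_rpow_of_nonneg _ _ (by norm_num),
          ENNReal.ofReal_rpow_of_pos (by positivity), mul_right_comm,
          ← ENNReal.ofReal_mul (by positivity), ← Real.rpow_mul ht.le, ← Real.rpow_add ht]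
        congr 3; ring
  have h2 : ∫⁻ h in Set.Ioc (0 : ℝ) t, ‖f (x + h)‖ₑ ≤ ENNReal.ofReal (t ^ (1 / 2 + s)) * F := by
    have hm : Measurable fun h : ℝ => ‖f (x + h)‖ₑ := by fun_prop
    refine (lintegral_rpow_mul_measure_le hm.aemeasurable hθ (by linarith)).trans ?_
    rw [hvol, mul_comm, show 1 - (1 / 2 - s) = 1 / 2 + s by ring]
    refine mul_le_mul' le_rfl (ENNReal.rpow_le_rpow ?_ hθ.le)
    refine (setLIntegral_le_lintegral _ _).trans (le_of_eq ?_)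
    exact lintegral_add_left_eq_self (fun y => ‖f y‖ₑ ^ (1 / (1 / 2 - s))) x
  have h3 : ENNReal.ofReal t * ‖f x‖ₑ ≤ ENNReal.ofReal (t ^ (1 + s)) * G ^ (1 / 2 : ℝ) +
      ENNReal.ofReal (t ^ (1 / 2 + s)) * F := by
    calc ENNReal.ofReal t * ‖f x‖ₑ = ∫⁻ h in Set.Ioc (0 : ℝ) t, ‖f x‖ₑ := by
          rw [setLIntegral_const, Real.volume_Ioc, sub_zero, mul_comm]
      _ ≤ ∫⁻ h in Set.Ioc (0 : ℝ) t, (‖f x - f (x + h)‖ₑ + ‖f (x + h)‖ₑ) := by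
          refine lintegral_mono fun h => ?_
          calc ‖f x‖ₑ = ‖(f x - f (x + h)) + f (x + h)‖ₑ := by rw [sub_add_cancel]
            _ ≤ _ := enorm_add_le _ _
      _ = _ + _ := lintegral_add_right _ (by fun_prop)
      _ ≤ _ := add_le_add h1 h2
  have h4 : ∀ a : ℝ, ENNReal.ofReal t⁻¹ * ENNReal.ofReal (t ^ a) = ENNReal.ofReal (t ^ (a - 1)) :=
    fun a => by
      rw [← ENNReal.ofReal_mul (by positivity), ← Real.rpow_neg_one, ← Real.rpow_add ht]
      congr 2; ring
  calc ‖f x‖ₑ = ENNReal.ofReal t⁻¹ * (ENNReal.ofReal t * ‖f x‖ₑ) := by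
        rw [← mul_assoc, ← ENNReal.ofReal_mul (by positivity), inv_mul_cancel₀ ht.ne']; simp
    _ ≤ ENNReal.ofReal t⁻¹ * (ENNReal.ofReal (t ^ (1 + s)) * G ^ (1 / 2 : ℝ) +
      ENNReal.ofReal (t ^ (1 / 2 + s)) * F) := by gcongr
    _ = _ := by
      rw [mul_add, ← mul_assoc, ← mul_assoc, h4, h4]
      congr 4 <;> ring

theorem enorm_rpow_le_gagliardoDensity {s : ℝ} (hs : 0 < s) (hs' : s < 1 / 2) {f : ℝ → ℝ}
    (hf : Measurable f) (x : ℝ) {F : ℝ} (hF : 0 < F)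
    (hfF : (∫⁻ y, ‖f y‖ₑ ^ (1 / (1 / 2 - s))) ^ (1 / 2 - s) = ENNReal.ofReal F) :
    ‖f x‖ₑ ^ (1 / (1 / 2 - s)) ≤
      ENNReal.ofReal (2 ^ (1 / (1 / 2 - s)) * F ^ (1 / (1 / 2 - s) - 2)) *
        gagliardoDensity s f x := by
  have hθ : 0 < 1 / 2 - s := by linarith
  set θ := 1 / 2 - s with hθd
  set c := ENNReal.ofReal (2 ^ (1 / θ) * F ^ (1 / θ - 2))
  -- The density may vanish, in which case no optimal t exists; a positive upper bound d replaces it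
  -- and is let down to the density at the end.
  have key : ∀ d : ℝ, 0 < d → gagliardoDensity s f x ≤ ENNReal.ofReal d →
      ‖f x‖ₑ ^ (1 / θ) ≤ c * ENNReal.ofReal d := by
    intro d hd hGd
    -- This t balances the two terms: each becomes F^(2s) d^(1/2-s).
    have h := enorm_le_gagliardoDensity_add hs hs' hf x (t := F ^ 2 / d) (by positivity)
    rw [hfF] at h
    have h1 : ‖f x‖ₑ ≤ ENNReal.ofReal (2 * (F ^ (2 * s) * d ^ θ)) := by
      refine h.trans ?_
      calc _ ≤ ENNReal.ofReal ((F ^ 2 / d) ^ s) * (ENNReal.ofReal d) ^ (1 / 2 : ℝ) +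
          ENNReal.ofReal ((F ^ 2 / d) ^ (-θ)) * ENNReal.ofReal F := by gcongr
        _ = _ := by
          have e1 : (F ^ 2) ^ s = F ^ (2 * s) := by
            rw [Real.rpow_mul hF.le]; norm_cast
          have e2 : (F ^ 2) ^ (-θ) * F = F ^ (2 * s) := by
            rw [show (F ^ 2 : ℝ) = F ^ (2 : ℝ) by norm_cast, ← Real.rpow_mul hF.le,
              ← Real.rpow_add_one hF.ne']
            congr 1; rw [hθd]; ring
          rw [ENNReal.ofReal_rpow_of_pos hd, ← ENNReal.ofReal_mul (by positivity),
            ← ENNReal.ofReal_mul (by positivity), ← ENNReal.ofReal_add (by positivity)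
            (by positivity), Real.div_rpow (by positivity) hd.le,
            Real.div_rpow (by positivity) hd.le, e1, div_mul_eq_mul_div, div_mul_eq_mul_div, e2,
            Real.rpow_neg hd.le, div_inv_eq_mul, mul_div_assoc, ← Real.rpow_sub hd]
          congr 1; rw [hθd]; ring
    calc ‖f x‖ₑ ^ (1 / θ) ≤ (ENNReal.ofReal (2 * (F ^ (2 * s) * d ^ θ))) ^ (1 / θ) := by gcongr
      _ = _ := by
        rw [ENNReal.ofReal_rpow_of_pos (by positivity), ← ENNReal.ofReal_mul (by positivity),
          Real.mul_rpow (by positivity) (by positivity),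
          Real.mul_rpow (by positivity) (by positivity), ← Real.rpow_mul hF.le,
          ← Real.rpow_mul hd.le, mul_one_div_cancel hθ.ne', Real.rpow_one, ← mul_assoc]
        congr 4
        rw [show s = 1 / 2 - θ by rw [hθd]; ring]
        field_simp
  rcases eq_or_ne (gagliardoDensity s f x) ⊤ with htop | htop
  · rw [htop, ENNReal.mul_top]
    · exact le_top
    · simp only [c, ne_eq, ENNReal.ofReal_eq_zero, not_le]; positivity
  set g := (gagliardoDensity s f x).toReal
  have hg : gagliardoDensity s f x = ENNReal.ofReal g := (ENNReal.ofReal_toReal htop).symm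
  have hg0 : 0 ≤ g := ENNReal.toReal_nonneg
  have hlim : Tendsto (fun ε : ℝ => c * ENNReal.ofReal (g + ε)) (𝓝[>] 0)
      (𝓝 (c * ENNReal.ofReal g)) := by
    refine ENNReal.Tendsto.const_mul ?_ (Or.inr ENNReal.ofReal_ne_top)
    refine ENNReal.tendsto_ofReal (tendsto_nhdsWithin_of_tendsto_nhds ?_)
    have : Continuous fun ε : ℝ => g + ε := by fun_prop
    simpa using this.tendsto 0
  rw [hg]
  refine ge_of_tendsto hlim ?_
  filter_upwards [self_mem_nhdsWithin] with ε hε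
  have hε' : 0 < ε := hε
  exact key _ (by linarith) (by rw [hg]; exact ENNReal.ofReal_le_ofReal (by linarith))

/-- Integrating the pointwise bound gives F^p ≤ 2^p F^(p-2) ∫ density, with F the L^p norm. Dividing
by F^(p-2) requires F to be finite beforehand, which is why the inequality is first proved for
Schwartz functions. -/
theorem eLpNorm_sq_le_gagliardo {s : ℝ} (hs : 0 < s) (hs' : s < 1 / 2) {f : ℝ → ℝ}
    (hf : Measurable f) (hfin : eLpNorm f (ENNReal.ofReal (1 / (1 / 2 - s))) volume ≠ ⊤) :
    eLpNorm f (ENNReal.ofReal (1 / (1 / 2 - s))) volume ^ 2 ≤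
      ENNReal.ofReal (2 ^ (1 / (1 / 2 - s))) * ∫⁻ x, gagliardoDensity s f x := by
  have hθ : 0 < 1 / 2 - s := by linarith
  rw [eLpNorm_ofReal_eq (by positivity), one_div_one_div] at hfin ⊢
  set I := ∫⁻ y, ‖f y‖ₑ ^ (1 / (1 / 2 - s)) with hI
  rcases eq_or_ne (I ^ (1 / 2 - s)) 0 with h0 | h0
  · rw [h0]; simp
  set F := (I ^ (1 / 2 - s)).toReal
  have hF : I ^ (1 / 2 - s) = ENNReal.ofReal F := (ENNReal.ofReal_toReal hfin).symm
  have hFpos : 0 < F := ENNReal.toReal_pos h0 hfin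
  have h1 : I ≤ ENNReal.ofReal (2 ^ (1 / (1 / 2 - s)) * F ^ (1 / (1 / 2 - s) - 2)) *
      ∫⁻ x, gagliardoDensity s f x := by
    rw [← lintegral_const_mul' _ _ ENNReal.ofReal_ne_top]
    exact lintegral_mono fun x => enorm_rpow_le_gagliardoDensity hs hs' hf x hFpos hF
  have h2 : I = ENNReal.ofReal (F ^ (1 / (1 / 2 - s))) := by
    rw [← ENNReal.ofReal_rpow_of_pos hFpos, ← hF, ← ENNReal.rpow_mul,
      mul_one_div_cancel hθ.ne', ENNReal.rpow_one]
  rw [hF, ← ENNReal.ofReal_pow hFpos.le]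
  have e : F ^ 2 = F ^ (2 - 1 / (1 / 2 - s)) * F ^ (1 / (1 / 2 - s)) := by
    rw [← Real.rpow_add hFpos]
    norm_num
  rw [e, ENNReal.ofReal_mul (by positivity), ← h2]
  refine (mul_le_mul' le_rfl h1).trans (le_of_eq ?_)
  rw [← mul_assoc, ← ENNReal.ofReal_mul (by positivity), mul_left_comm, ← Real.rpow_add hFpos]
  simp

end MultiComm

/-! ### Sobolev inequality for limits of Schwartz functions and for matrices. -/

namespace MultiComm

theorem aestronglyMeasurable_fracLaplacian (s : ℝ) (φ : 𝓢(ℝ, ℝ)) :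
    AEStronglyMeasurable (fracLaplacian s φ) volume := by
  have hφ := φ.continuous.measurable
  have hm : Measurable (Function.uncurry fun x y : ℝ => (φ x - φ y) / |x - y| ^ (1 + s)) := by
    unfold Function.uncurry
    fun_prop
  exact hm.stronglyMeasurable.integral_prod_right.aestronglyMeasurable

theorem le_rpow_half_mul_of_sq_le {X B C Y : ℝ≥0∞} (h : X ^ 2 ≤ B * (C * Y)) :
    X ≤ (B * C) ^ (1 / 2 : ℝ) * Y ^ (1 / 2 : ℝ) := by
  rw [← ENNReal.mul_rpow_of_nonneg _ _ (by norm_num), mul_assoc]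
  calc X = (X ^ 2) ^ (1 / 2 : ℝ) := by
        rw [← ENNReal.rpow_natCast, ← ENNReal.rpow_mul]; norm_num
    _ ≤ _ := by gcongr

theorem lintegral_gagliardoDensity (s : ℝ) (φ : 𝓢(ℝ, ℝ)) : ∫⁻ x, gagliardoDensity s φ x =
    ∫⁻ h : ℝ, ENNReal.ofReal (|h| ^ (-1 - 2 * s)) * ∫⁻ x, ‖φ x - φ (x + h)‖ₑ ^ 2 := by
  have hφ := φ.continuous.measurable
  unfold gagliardoDensity
  rw [lintegral_lintegral_swap (by fun_prop)]
  simp only [lintegral_const_mul' _ _ ENNReal.ofReal_ne_top]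

theorem eLpNorm_two_eq {α E : Type*} [MeasurableSpace α] {μ : Measure α} [NormedAddCommGroup E]
    (f : α → E) : eLpNorm f 2 μ = (∫⁻ x, ‖f x‖ₑ ^ 2 ∂μ) ^ (1 / 2 : ℝ) := by
  rw [eLpNorm_eq_lintegral_rpow_enorm_toReal (by norm_num) (by norm_num)]
  simp

theorem schwartz_eLpNorm_ne_top (φ : 𝓢(ℝ, ℝ)) (p : ℝ≥0∞) : eLpNorm φ p volume ≠ ⊤ := by
  have h := φ.memLp p
  exact h.eLpNorm_ne_top

theorem schwartz_sobolev {s : ℝ} (hs : 0 < s) (hs' : s < 1 / 2) :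
    ∃ C : ℝ≥0, ∀ φ : 𝓢(ℝ, ℝ), eLpNorm φ (ENNReal.ofReal (1 / (1 / 2 - s))) volume ≤
      C * eLpNorm (fracLaplacian s φ) 2 volume := by
  obtain ⟨C, hC⟩ := gagliardo_le_fracLaplacian hs hs'
  obtain ⟨B, hBtop, hB⟩ : ∃ B : ℝ≥0∞, B ≠ ⊤ ∧ ∀ φ : 𝓢(ℝ, ℝ),
      eLpNorm φ (ENNReal.ofReal (1 / (1 / 2 - s))) volume ^ 2 ≤
        B * ∫⁻ x, gagliardoDensity s φ x :=
    ⟨_, ENNReal.ofReal_ne_top, fun φ => eLpNorm_sq_le_gagliardo hs hs' φ.continuous.measurable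
      (schwartz_eLpNorm_ne_top φ _)⟩
  have hfin : (B * C) ^ (1 / 2 : ℝ) ≠ ⊤ :=
    ENNReal.rpow_ne_top_of_nonneg (by norm_num) (ENNReal.mul_ne_top hBtop ENNReal.coe_ne_top)
  refine ⟨((B * C) ^ (1 / 2 : ℝ)).toNNReal, fun φ => ?_⟩
  rw [ENNReal.coe_toNNReal hfin, eLpNorm_two_eq]
  refine le_rpow_half_mul_of_sq_le ((hB φ).trans (mul_le_mul' le_rfl ?_))
  rw [lintegral_gagliardoDensity]
  exact hC φ

/-- Convergence in L¹ on a bounded interval gives an almost everywhere convergent subsequence, and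
Fatou transfers the inequality. The resulting bound does not depend on the interval, so the
intervals may exhaust the line. -/
theorem IsFracLaplacian.eLpNorm_le {s : ℝ} {C : ℝ≥0} {p : ℝ≥0∞} (hp0 : p ≠ 0) (hp : p ≠ ⊤)
    (hC : ∀ φ : 𝓢(ℝ, ℝ), eLpNorm φ p volume ≤ C * eLpNorm (fracLaplacian s φ) 2 volume)
    {f g : ℝ → ℝ} (hf : AEStronglyMeasurable f volume) (h : IsFracLaplacian s f g) :
    eLpNorm f p volume ≤ C * eLpNorm g 2 volume := by
  obtain ⟨hg, φ, hφ, hφg⟩ := h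
  have hbound : ∀ R : ℝ, eLpNorm f p (volume.restrict (Set.Icc (-R) R)) ≤
      C * eLpNorm g 2 volume := by
    intro R
    set μ := volume.restrict (Set.Icc (-R) R)
    have hm : TendstoInMeasure μ (fun n => (φ n : ℝ → ℝ)) atTop f := by
      refine tendstoInMeasure_of_tendsto_eLpNorm (p := 1) one_ne_zero
        (fun n => (φ n).continuous.aestronglyMeasurable) hf.restrict ?_
      simpa [eLpNorm_one_eq_lintegral_enorm] using hφ R
    obtain ⟨ns, hns, hae⟩ := hm.exists_seq_tendsto_ae
    have h1 := Lp.eLpNorm_lim_le_liminf_eLpNorm (p := p)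
      (fun n => (φ (ns n)).continuous.aestronglyMeasurable) f hae
    have h2 : Tendsto (fun n => (C : ℝ≥0∞) *
        (eLpNorm (fun x => fracLaplacian s (φ (ns n)) x - g x) 2 volume + eLpNorm g 2 volume)) atTop
        (𝓝 (C * (0 + eLpNorm g 2 volume))) :=
      ENNReal.Tendsto.const_mul ((hφg.comp hns.tendsto_atTop).add tendsto_const_nhds)
        (Or.inr ENNReal.coe_ne_top)
    rw [zero_add] at h2
    rw [← h2.liminf_eq]
    refine h1.trans (liminf_le_liminf (.of_forall fun n => ?_))
    calc eLpNorm (φ (ns n)) p μ ≤ eLpNorm (φ (ns n)) p volume :=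
          eLpNorm_mono_measure _ Measure.restrict_le_self
      _ ≤ C * eLpNorm (fracLaplacian s (φ (ns n))) 2 volume := hC _
      _ ≤ _ := by
        gcongr
        have h3 := eLpNorm_add_le (p := 2)
          ((aestronglyMeasurable_fracLaplacian s (φ (ns n))).sub hg.1) hg.1 (by norm_num)
        rw [sub_add_cancel] at h3
        exact h3
  have hcov : AECover (volume : Measure ℝ) atTop (fun n : ℕ => Set.Icc (-(n : ℝ)) n) :=
    aecover_Icc (tendsto_neg_atTop_atBot.comp tendsto_natCast_atTop_atTop)
      tendsto_natCast_atTop_atTop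
  have hlim := hcov.lintegral_tendsto_of_countably_generated
    (hf.enorm.pow_const p.toReal)
  have hpp : 0 < p.toReal := ENNReal.toReal_pos hp0 hp
  rw [eLpNorm_eq_lintegral_rpow_enorm_toReal hp0 hp, one_div, ENNReal.rpow_inv_le_iff hpp]
  refine le_of_tendsto' hlim fun n => ?_
  have h1 := hbound n
  rwa [eLpNorm_eq_lintegral_rpow_enorm_toReal hp0 hp, one_div, ENNReal.rpow_inv_le_iff hpp] at h1

variable {m : ℕ}

/-- The matrix as an element of a Euclidean space, whose norm is the Frobenius norm. -/
noncomputable def flat (A : Mat m) : EuclideanSpace ℝ (Fin m × Fin m) :=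
  WithLp.toLp 2 fun ij => A ij.1 ij.2

theorem norm_flat (A : Mat m) : ‖flat A‖ = frob A := by
  rw [EuclideanSpace.norm_eq, frob, Fintype.sum_prod_type]
  simp [flat]

theorem frob_nonneg (A : Mat m) : 0 ≤ frob A := Real.sqrt_nonneg _

theorem frob_sq (A : Mat m) : frob A ^ 2 = ∑ i, ∑ j, A i j ^ 2 :=
  Real.sq_sqrt (by positivity)

theorem eLpNorm_sq_real {f : ℝ → ℝ} (p : ℝ≥0∞) :
    eLpNorm (fun x => f x ^ 2) p volume = eLpNorm f (p * 2) volume ^ 2 := by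
  have h := eLpNorm_norm_rpow (p := p) (μ := volume) f (q := 2) two_pos
  simpa using h

/-- Minkowski in L^(p/2) for the squared entries, whence the condition on p. Together with the
equality at p = 2 it carries the scalar inequality to matrices with the same constant, free of m. -/
theorem eLpNorm_frob_sq_le {p : ℝ≥0∞} (hp : 2 ≤ p) {A : ℝ → Mat m}
    (hA : ∀ i j, AEStronglyMeasurable (fun x => A x i j) volume) :
    eLpNorm (fun x => frob (A x)) p volume ^ 2 ≤
      ∑ i, ∑ j, eLpNorm (fun x => A x i j) p volume ^ 2 := by
  have hp2 : p / 2 * 2 = p := ENNReal.div_mul_cancel (by norm_num) (by norm_num)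
  have h1 : 1 ≤ p / 2 := by
    rw [ENNReal.le_div_iff_mul_le (by simp) (by simp)]; simpa using hp
  rw [← hp2, ← eLpNorm_sq_real]
  simp only [← eLpNorm_sq_real, frob_sq]
  have h2 : (fun x => ∑ i, ∑ j, A x i j ^ 2) = ∑ i, ∑ j, fun x => A x i j ^ 2 := by
    ext x; simp
  rw [h2]
  refine (eLpNorm_sum_le (fun i _ => Finset.aestronglyMeasurable_sum _ fun j _ =>
    (hA i j).pow 2) h1).trans ?_
  gcongr with i
  exact eLpNorm_sum_le (fun j _ => (hA i j).pow 2) h1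

theorem eLpNorm_frob_two_sq {A : ℝ → Mat m}
    (hA : ∀ i j, AEStronglyMeasurable (fun x => A x i j) volume) :
    eLpNorm (fun x => frob (A x)) 2 volume ^ 2 =
      ∑ i, ∑ j, eLpNorm (fun x => A x i j) 2 volume ^ 2 := by
  have h : ∀ f : ℝ → ℝ, eLpNorm f 2 volume ^ 2 = ∫⁻ x, ENNReal.ofReal (f x ^ 2) := fun f => by
    have h1 := eLpNorm_sq_real (f := f) 1
    rw [one_mul] at h1
    rw [← h1, eLpNorm_one_eq_lintegral_enorm]
    simp only [Real.enorm_of_nonneg (sq_nonneg _)]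
  simp only [h, frob_sq]
  have hm : ∀ i j, AEMeasurable (fun x => ENNReal.ofReal (A x i j ^ 2)) volume := fun i j =>
    ((hA i j).pow 2).aemeasurable.ennreal_ofReal
  calc ∫⁻ x, ENNReal.ofReal (∑ i, ∑ j, A x i j ^ 2)
      = ∫⁻ x, ∑ i, ∑ j, ENNReal.ofReal (A x i j ^ 2) := by
        refine lintegral_congr fun x => ?_
        rw [ENNReal.ofReal_sum_of_nonneg fun i _ => by positivity]
        refine Finset.sum_congr rfl fun i _ => ?_
        rw [ENNReal.ofReal_sum_of_nonneg fun i _ => by positivity]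
    _ = ∑ i, ∑ j, ∫⁻ x, ENNReal.ofReal (A x i j ^ 2) := by
        rw [lintegral_finsetSum' _ fun i _ => Finset.aemeasurable_fun_sum _ fun j _ => hm i j]
        exact Finset.sum_congr rfl fun i _ => lintegral_finsetSum' _ fun j _ => hm i j

theorem eLpNorm_frob_le_of_isFracLaplacian {s : ℝ} {C : ℝ≥0} {p : ℝ≥0∞} (hp2 : 2 ≤ p) (hp : p ≠ ⊤)
    (hC : ∀ φ : 𝓢(ℝ, ℝ), eLpNorm φ p volume ≤ C * eLpNorm (fracLaplacian s φ) 2 volume)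
    {A B : ℝ → Mat m} (hA : ∀ i j, AEStronglyMeasurable (fun x => A x i j) volume)
    (h : ∀ i j, IsFracLaplacian s (fun x => A x i j) (fun x => B x i j)) :
    eLpNorm (fun x => frob (A x)) p volume ≤ C * eLpNorm (fun x => frob (B x)) 2 volume := by
  refine (ENNReal.pow_le_pow_left_iff two_ne_zero).1 ?_
  rw [mul_pow, eLpNorm_frob_two_sq fun i j => (h i j).1.1, Finset.mul_sum]
  refine (eLpNorm_frob_sq_le hp2 hA).trans ?_
  gcongr with i
  rw [Finset.mul_sum]
  gcongr with j
  rw [← mul_pow]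
  gcongr
  exact (h i j).eLpNorm_le (by positivity) hp hC (hA i j)

end MultiComm

/-! ### Weak L² and the trilinear estimate at one scale. -/

namespace MultiComm

/-- Distributional bound `|{w > t}| ≤ (M / t)²`. -/
def WeakBound (w : ℝ → ℝ≥0∞) (M : ℝ) : Prop :=
  ∀ t : ℝ, 0 < t → volume {x | ENNReal.ofReal t < w x} ≤ ENNReal.ofReal (M ^ 2 / t ^ 2)

theorem tsum_ofReal_geometric {r : ℝ} (hr : 0 ≤ r) (hr' : r < 1) (c : ℝ) (hc : 0 ≤ c) :
    ∑' k : ℕ, ENNReal.ofReal (c * r ^ k) = ENNReal.ofReal (c * (1 - r)⁻¹) := by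
  rw [← ENNReal.ofReal_tsum_of_nonneg (fun k => by positivity)
    ((summable_geometric_of_lt_one hr hr').mul_left c), tsum_mul_left, tsum_geometric_of_lt_one hr hr']

/-- Discrete layer cake: a function dominated by layers over superlevel sets of w is integrated
layer by layer. -/
theorem WeakBound.lintegral_le_of_le_tsum {w : ℝ → ℝ≥0∞} (hw : AEMeasurable w volume) {M : ℝ}
    (hM : WeakBound w M) {g : ℝ → ℝ≥0∞} (a t : ℕ → ℝ) (ha : ∀ k, 0 ≤ a k) (ht : ∀ k, 0 < t k)
    (hg : ∀ x, g x ≤ ∑' k, {x | ENNReal.ofReal (t k) < w x}.indicator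
      (fun _ => ENNReal.ofReal (a k)) x) :
    ∫⁻ x, g x ≤ ∑' k, ENNReal.ofReal (a k * (M ^ 2 / t k ^ 2)) := by
  have hmeas : ∀ k, NullMeasurableSet {x | ENNReal.ofReal (t k) < w x} volume := fun k =>
    nullMeasurableSet_lt aemeasurable_const hw
  calc ∫⁻ x, g x ≤ ∫⁻ x, ∑' k, {x | ENNReal.ofReal (t k) < w x}.indicator
            (fun _ => ENNReal.ofReal (a k)) x := lintegral_mono hg
    _ = ∑' k, ∫⁻ x, {x | ENNReal.ofReal (t k) < w x}.indicator
            (fun _ => ENNReal.ofReal (a k)) x :=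
        lintegral_tsum fun k => aemeasurable_const.indicator₀ (hmeas k)
    _ ≤ _ := by
        gcongr with k
        rw [lintegral_indicator_const₀ (hmeas k), ENNReal.ofReal_mul (ha k)]
        gcongr
        exact hM _ (ht k)

theorem pow_rpow_comm {a : ℝ} (ha : 0 ≤ a) (k : ℕ) (q : ℝ) : (a ^ k) ^ q = (a ^ q) ^ k := by
  rw [← Real.rpow_natCast, ← Real.rpow_natCast, ← Real.rpow_mul ha, ← Real.rpow_mul ha, mul_comm]

theorem WeakBound.lintegral_rpow_high_le {q : ℝ} (hq : 0 < q) (hq' : q < 2) :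
    ∃ C : ℝ, 0 < C ∧ ∀ (w : ℝ → ℝ≥0∞) (M l : ℝ), AEMeasurable w volume → (∀ x, w x ≠ ⊤) →
      WeakBound w M → 0 < l →
      ∫⁻ x, ({x | ENNReal.ofReal l < w x}.indicator w x) ^ q ≤
        ENNReal.ofReal (C * (l ^ (q - 2) * M ^ 2)) := by
  have hr : (2 : ℝ) ^ (q - 2) < 1 := Real.rpow_lt_one_of_one_lt_of_neg one_lt_two (by linarith)
  refine ⟨2 ^ q * 4 * (1 - 2 ^ (q - 2))⁻¹, by
    have : 0 < 1 - (2 : ℝ) ^ (q - 2) := by linarith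
    positivity, fun w M l hw hfin hM hl => ?_⟩
  -- The layer 2^k l ≤ w < 2^(k+1) l includes its lower end, while superlevel sets are strict. The
  -- level is therefore halved, which accounts for the 4 in the constant.
  refine (hM.lintegral_le_of_le_tsum hw (fun k => (2 ^ (k + 1) * l) ^ q)
    (fun k => 2 ^ k * l / 2) (fun k => by positivity) (fun k => by positivity) fun x => ?_).trans
    (le_of_eq ?_)
  · by_cases hx : ENNReal.ofReal l < w x
    · obtain ⟨y, hy⟩ : ∃ y : ℝ, w x = ENNReal.ofReal y := ⟨_, (ENNReal.ofReal_toReal (hfin x)).symm⟩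
      rw [hy] at hx
      have hly : l < y := (ENNReal.ofReal_lt_ofReal_iff_of_nonneg hl.le).1 hx
      obtain ⟨n, hn1, hn2⟩ := exists_nat_pow_near (x := y / l) (y := 2)
        ((one_le_div hl).2 hly.le) one_lt_two
      rw [le_div_iff₀ hl] at hn1
      rw [div_lt_iff₀ hl] at hn2
      refine le_trans ?_ (ENNReal.le_tsum n)
      have hmem : x ∈ {x | ENNReal.ofReal (2 ^ n * l / 2) < w x} := by
        change _ < w x
        rw [hy]
        exact (ENNReal.ofReal_lt_ofReal_iff (hl.trans hly)).2 (by
          have : 0 < 2 ^ n * l := by positivity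
          linarith)
      rw [Set.indicator_of_mem hmem, Set.indicator_of_mem (by rw [← hy] at hx; exact hx), hy,
        ENNReal.ofReal_rpow_of_pos (hl.trans hly)]
      exact ENNReal.ofReal_le_ofReal (Real.rpow_le_rpow (hl.trans hly).le hn2.le hq.le)
    · rw [Set.indicator_of_notMem (by exact hx), ENNReal.zero_rpow_of_pos hq]
      exact zero_le
  · have : ∀ k : ℕ, (2 ^ (k + 1) * l) ^ q * (M ^ 2 / (2 ^ k * l / 2) ^ 2) =
        2 ^ q * 4 * (l ^ (q - 2) * M ^ 2) * ((2 : ℝ) ^ (q - 2)) ^ k := fun k => by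
      rw [Real.mul_rpow (by positivity) hl.le, pow_succ (2 : ℝ) k,
        Real.mul_rpow (by positivity) (by norm_num), pow_rpow_comm two_pos.le,
        Real.rpow_sub two_pos, Real.rpow_sub hl, div_pow (2 ^ q : ℝ), Real.rpow_two,
        Real.rpow_two, pow_right_comm (2 : ℝ) 2 k]
      field_simp
      ring
    simp only [this]
    rw [tsum_ofReal_geometric (by positivity) hr _ (by positivity)]
    congr 1; ring

theorem WeakBound.lintegral_rpow_low_le {q : ℝ} (hq : 2 < q) :
    ∃ C : ℝ, 0 < C ∧ ∀ (w : ℝ → ℝ≥0∞) (M l : ℝ), AEMeasurable w volume →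
      WeakBound w M → 0 < l →
      ∫⁻ x, ({x | ENNReal.ofReal l < w x}ᶜ.indicator w x) ^ q ≤
        ENNReal.ofReal (C * (l ^ (q - 2) * M ^ 2)) := by
  have hr : (2 : ℝ)⁻¹ ^ (q - 2) < 1 := Real.rpow_lt_one (by norm_num) (by norm_num) (by linarith)
  refine ⟨4 * (1 - 2⁻¹ ^ (q - 2))⁻¹, by
    have : 0 < 1 - (2 : ℝ)⁻¹ ^ (q - 2) := by linarith
    positivity, fun w M l hw hM hl => ?_⟩
  refine (hM.lintegral_le_of_le_tsum hw (fun k => (2⁻¹ ^ k * l) ^ q)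
    (fun k => 2⁻¹ ^ (k + 1) * l) (fun k => by positivity) (fun k => by positivity) fun x => ?_).trans
    (le_of_eq ?_)
  · by_cases hx : ENNReal.ofReal l < w x
    · rw [Set.indicator_of_notMem (by simpa using hx), ENNReal.zero_rpow_of_pos (by linarith)]
      exact zero_le
    rcases eq_or_ne (w x) 0 with h0 | h0
    · rw [Set.indicator_of_mem (by exact hx), h0, ENNReal.zero_rpow_of_pos (by linarith)]
      exact zero_le
    obtain ⟨y, hy⟩ : ∃ y : ℝ, w x = ENNReal.ofReal y :=
      ⟨_, (ENNReal.ofReal_toReal ((not_lt.1 hx).trans_lt ENNReal.ofReal_lt_top).ne).symm⟩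
    have hy0 : 0 < y := by rw [hy] at h0; simpa using h0
    have hly : y ≤ l := by
      have := not_lt.1 hx
      rw [hy] at this
      exact (ENNReal.ofReal_le_ofReal_iff hl.le).1 this
    obtain ⟨n, hn1, hn2⟩ := exists_nat_pow_near_of_lt_one (x := y / l) (y := (2 : ℝ)⁻¹)
        (by positivity) ((div_le_one hl).2 hly) (by norm_num) (by norm_num)
    rw [lt_div_iff₀ hl] at hn1
    rw [div_le_iff₀ hl] at hn2
    refine le_trans ?_ (ENNReal.le_tsum n)
    have hmem : x ∈ {x | ENNReal.ofReal (2⁻¹ ^ (n + 1) * l) < w x} := by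
      change _ < w x
      rw [hy]
      exact (ENNReal.ofReal_lt_ofReal_iff hy0).2 hn1
    rw [Set.indicator_of_mem hmem, Set.indicator_of_mem (by exact hx), hy,
      ENNReal.ofReal_rpow_of_pos hy0]
    exact ENNReal.ofReal_le_ofReal (Real.rpow_le_rpow hy0.le hn2 (by linarith))
  · have : ∀ k : ℕ, (2⁻¹ ^ k * l) ^ q * (M ^ 2 / (2⁻¹ ^ (k + 1) * l) ^ 2) =
        4 * (l ^ (q - 2) * M ^ 2) * ((2 : ℝ)⁻¹ ^ (q - 2)) ^ k := fun k => by
      rw [Real.mul_rpow (by positivity) hl.le, pow_succ (2⁻¹ : ℝ) k,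
        pow_rpow_comm (by norm_num), Real.rpow_sub (by norm_num : (0 : ℝ) < 2⁻¹), Real.rpow_sub hl,
        div_pow (2⁻¹ ^ q : ℝ), Real.rpow_two, Real.rpow_two, pow_right_comm (2⁻¹ : ℝ) 2 k]
      have h0 : (0 : ℝ) < 2⁻¹ ^ k := by positivity
      generalize (2⁻¹ : ℝ) ^ k = z at *
      field_simp
      ring
    simp only [this]
    rw [tsum_ofReal_geometric (by positivity) hr _ (by positivity)]
    congr 1; ring

theorem lintegral_mul_mul_rpow_le {α : Type*} [MeasurableSpace α] {μ : Measure α}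
    {f g h : α → ℝ≥0∞} (hf : AEMeasurable f μ) (hg : AEMeasurable g μ) (hh : AEMeasurable h μ)
    {a b c : ℝ} (ha : 0 < a) (hb : 0 < b) (hc : 0 < c) (habc : a + b + c = 1) :
    ∫⁻ x, f x * g x * h x ∂μ ≤ (∫⁻ x, f x ^ (1 / a) ∂μ) ^ a * (∫⁻ x, g x ^ (1 / b) ∂μ) ^ b *
      (∫⁻ x, h x ^ (1 / c) ∂μ) ^ c := by
  have key := ENNReal.lintegral_prod_norm_pow_le (μ := μ) (Finset.univ : Finset (Fin 3))
    (f := ![fun x => f x ^ (1 / a), fun x => g x ^ (1 / b), fun x => h x ^ (1 / c)])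
    (p := ![a, b, c]) (by
      intro i _
      fin_cases i
      · exact hf.pow_const _
      · exact hg.pow_const _
      · exact hh.pow_const _)
    (by simpa [Fin.sum_univ_three] using habc)
    (by
      intro i _
      fin_cases i
      · exact ha.le
      · exact hb.le
      · exact hc.le)
  simpa [Fin.prod_univ_three, ← ENNReal.rpow_mul, ha.ne', hb.ne', hc.ne'] using key

theorem lintegral_mul_rpow_le {α : Type*} [MeasurableSpace α] {μ : Measure α}
    {f g : α → ℝ≥0∞} (hf : AEMeasurable f μ) (hg : AEMeasurable g μ)
    {a b : ℝ} (ha : 0 < a) (hb : 0 < b) (hab : a + b = 1) :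
    ∫⁻ x, f x * g x ∂μ ≤ (∫⁻ x, f x ^ (1 / a) ∂μ) ^ a * (∫⁻ x, g x ^ (1 / b) ∂μ) ^ b := by
  have key := ENNReal.lintegral_mul_norm_pow_le (μ := μ) (hf.pow_const (1 / a))
    (hg.pow_const (1 / b)) ha.le hb.le hab
  simpa [← ENNReal.rpow_mul, ha.ne', hb.ne'] using key

/-- The trilinear estimate for `u ∈ L² ∩ L^∞`, `k ∈ L^p` with `1/p = 1/2 - s`, and `w` in weak
`L²`. -/
theorem WeakBound.lintegral_mul_mul_le {s : ℝ} (hs : 0 < s) (hs' : s < 1 / 2) :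
    ∃ C : ℝ, 0 < C ∧ ∀ (u k w : ℝ → ℝ≥0∞) (M r : ℝ) (α : ℝ≥0∞), AEMeasurable u volume →
      AEMeasurable k volume → AEMeasurable w volume → (∀ x, w x ≠ ⊤) → WeakBound w M → 0 < M →
      0 < r → (∫⁻ x, u x ^ 2) ≤ α ^ 2 → (∀ᵐ x, u x ≤ α * ENNReal.ofReal (r ^ (-(1 / 2) : ℝ))) →
      ∫⁻ x, u x * k x * w x ≤ ENNReal.ofReal (C * r ^ (-(1 / 2 - s)) * M) * α *
        (∫⁻ x, k x ^ (1 / (1 / 2 - s))) ^ (1 / 2 - s) := by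
  have hθ : 0 < 1 / 2 - s := by linarith
  obtain ⟨C₁, hC₁, h₁⟩ := WeakBound.lintegral_rpow_high_le (q := 1 / (1 / 2 + s)) (by positivity)
    (by rw [div_lt_iff₀ (by positivity)]; linarith)
  obtain ⟨C₂, hC₂, h₂⟩ := WeakBound.lintegral_rpow_low_le (q := 1 / s)
    (by rw [lt_div_iff₀ hs]; linarith)
  refine ⟨C₂ ^ s + C₁ ^ (1 / 2 + s), by positivity,
    fun u k w M r α hu hk hw hwfin hM hM0 hr hu2 hui => ?_⟩
  -- At this level both parts of w contribute a multiple of r^(-(1/2-s)) M. Below it, Hölder is used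
  -- with reciprocal exponents 1/2, s, 1/2 - s for u, w, k; above it, u is bounded and the
  -- reciprocal exponents for w, k are 1/2 + s, 1/2 - s.
  set l := M * r ^ (-(1 / 2) : ℝ) with hl
  have hl0 : 0 < l := by positivity
  set E := {x | ENNReal.ofReal l < w x}
  have hE : NullMeasurableSet E volume := nullMeasurableSet_lt aemeasurable_const hw
  set K := (∫⁻ x, k x ^ (1 / (1 / 2 - s))) ^ (1 / 2 - s)
  have hsplit : ∀ x, u x * k x * w x =
      u x * Eᶜ.indicator w x * k x + u x * (E.indicator w x * k x) := fun x => by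
    have : Eᶜ.indicator w x + E.indicator w x = w x := Set.indicator_compl_add_self_apply E w x
    nth_rewrite 1 [← this]
    ring
  have hlow : ∫⁻ x, u x * Eᶜ.indicator w x * k x ≤
      ENNReal.ofReal (C₂ ^ s * r ^ (-(1 / 2 - s)) * M) * α * K := by
    refine (lintegral_mul_mul_rpow_le hu (hw.indicator₀ hE.compl) hk (a := 1 / 2) (b := s)
      (c := 1 / 2 - s) (by norm_num) hs hθ (by ring)).trans ?_
    refine mul_le_mul' ?_ le_rfl
    rw [mul_comm]
    refine mul_le_mul' ?_ ?_
    · refine (ENNReal.rpow_le_rpow (h₂ w M l hw hM hl0) hs.le).trans (le_of_eq ?_)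
      rw [ENNReal.ofReal_rpow_of_pos (by positivity), Real.mul_rpow (by positivity) (by positivity),
        Real.mul_rpow (by positivity) (by positivity), ← Real.rpow_mul hl0.le, hl,
        Real.mul_rpow hM0.le (by positivity), ← Real.rpow_mul hr.le,
        show (M ^ 2 : ℝ) = M ^ (2 : ℝ) by norm_cast, ← Real.rpow_mul hM0.le]
      have e1 : (1 / s - 2) * s = 1 - 2 * s := by field_simp
      have e2 : M ^ (1 - 2 * s) * M ^ (2 * s) = M := by
        rw [← Real.rpow_add hM0]; simp
      rw [e1, show -(1 / 2) * (1 - 2 * s) = -(1 / 2 - s) by ring]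
      congr 1
      calc _ = C₂ ^ s * r ^ (-(1 / 2 - s)) * (M ^ (1 - 2 * s) * M ^ (2 * s)) := by ring
        _ = _ := by rw [e2]
    · have : ∀ x, u x ^ (1 / (1 / 2) : ℝ) = u x ^ 2 := fun x => by
        rw [one_div_one_div]; norm_cast
      simp only [this]
      refine (ENNReal.rpow_le_rpow hu2 (by norm_num)).trans (le_of_eq ?_)
      rw [← ENNReal.rpow_natCast, ← ENNReal.rpow_mul]; norm_num
  have hhigh : ∫⁻ x, u x * (E.indicator w x * k x) ≤
      ENNReal.ofReal (C₁ ^ (1 / 2 + s) * r ^ (-(1 / 2 - s)) * M) * α * K := by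
    calc ∫⁻ x, u x * (E.indicator w x * k x)
        ≤ ∫⁻ x, α * ENNReal.ofReal (r ^ (-(1 / 2) : ℝ)) * (E.indicator w x * k x) := by
          refine lintegral_mono_ae ?_
          filter_upwards [hui] with x hx
          gcongr
      _ = α * ENNReal.ofReal (r ^ (-(1 / 2) : ℝ)) * ∫⁻ x, E.indicator w x * k x :=
          lintegral_const_mul'' _ ((hw.indicator₀ hE).mul hk)
      _ ≤ α * ENNReal.ofReal (r ^ (-(1 / 2) : ℝ)) *
          (ENNReal.ofReal (C₁ ^ (1 / 2 + s) * (M * r ^ s)) * K) := by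
        refine mul_le_mul' le_rfl ?_
        refine (lintegral_mul_rpow_le (hw.indicator₀ hE) hk (a := 1 / 2 + s) (b := 1 / 2 - s)
          (by positivity) hθ (by ring)).trans ?_
        refine mul_le_mul' ?_ le_rfl
        refine (ENNReal.rpow_le_rpow (h₁ w M l hw hwfin hM hl0) (by positivity)).trans
          (le_of_eq ?_)
        rw [ENNReal.ofReal_rpow_of_pos (by positivity),
          Real.mul_rpow (by positivity) (by positivity),
          Real.mul_rpow (by positivity) (by positivity), ← Real.rpow_mul hl0.le, hl,
          Real.mul_rpow hM0.le (by positivity), ← Real.rpow_mul hr.le,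
          show (M ^ 2 : ℝ) = M ^ (2 : ℝ) by norm_cast, ← Real.rpow_mul hM0.le]
        have e1 : (1 / (1 / 2 + s) - 2) * (1 / 2 + s) = -(2 * s) := by field_simp; ring
        have e2 : M ^ (-(2 * s)) * M ^ (2 * (1 / 2 + s)) = M := by
          rw [← Real.rpow_add hM0, show -(2 * s) + 2 * (1 / 2 + s) = 1 by ring, Real.rpow_one]
        rw [e1, show -(1 / 2) * (-(2 * s)) = s by ring]
        congr 1
        calc _ = C₁ ^ (1 / 2 + s) * ((M ^ (-(2 * s)) * M ^ (2 * (1 / 2 + s))) * r ^ s) := by ring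
          _ = _ := by rw [e2]
      _ = _ := by
        have e3 : r ^ (-(1 / 2 - s)) = r ^ (-(1 / 2) : ℝ) * r ^ s := by
          rw [← Real.rpow_add hr]; congr 1; ring
        have e4 : ENNReal.ofReal (C₁ ^ (1 / 2 + s) * r ^ (-(1 / 2 - s)) * M) =
            ENNReal.ofReal (r ^ (-(1 / 2) : ℝ)) *
              ENNReal.ofReal (C₁ ^ (1 / 2 + s) * (M * r ^ s)) := by
          rw [← ENNReal.ofReal_mul (by positivity), e3]; congr 1; ring
        rw [e4]; ring
  calc ∫⁻ x, u x * k x * w x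
      = (∫⁻ x, u x * Eᶜ.indicator w x * k x) + ∫⁻ x, u x * (E.indicator w x * k x) := by
        simp only [hsplit]
        exact lintegral_add_right' _ (hu.mul ((hw.indicator₀ hE).mul hk))
    _ ≤ ENNReal.ofReal (C₂ ^ s * r ^ (-(1 / 2 - s)) * M) * α * K +
        ENNReal.ofReal (C₁ ^ (1 / 2 + s) * r ^ (-(1 / 2 - s)) * M) * α * K :=
        add_le_add hlow hhigh
    _ = _ := by
      rw [← add_mul, ← add_mul, ← ENNReal.ofReal_add (by positivity) (by positivity)]
      congr 3; ring

end MultiComm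

/-! ### Mean oscillation and telescoping of dyadic averages. -/

namespace MultiComm

section Oscillation

variable {E : Type} [NormedAddCommGroup E]

/-- The square `‖P(· + h) - P‖_{L²}²` of the modulus of continuity. -/
noncomputable def diffSq (P : ℝ → E) (h : ℝ) : ℝ≥0∞ := ∫⁻ x, ‖P (x + h) - P x‖ₑ ^ 2

/-- The mean square oscillation of `P` on the interval between `x` and `x + s`. -/
noncomputable def meanOsc (P : ℝ → E) (s x : ℝ) : ℝ≥0∞ :=
  ∫⁻ η in Set.Ioc (-1 : ℝ) 1, ∫⁻ θ in Set.Ioc (0 : ℝ) 1, ‖P (x + s * θ + s * η) - P (x + s * θ)‖ₑ ^ 2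

/-- The average of the squared modulus of continuity over displacements up to `s`. -/
noncomputable def meanDiffSq (P : ℝ → E) (s : ℝ) : ℝ≥0∞ :=
  ∫⁻ η in Set.Ioc (-1 : ℝ) 1, diffSq P (s * η)

theorem measurable_enorm_sub_sq {P : ℝ → E} (hP : StronglyMeasurable P) :
    Measurable fun z : ℝ × ℝ => ‖P z.1 - P z.2‖ₑ ^ 2 :=
  ((hP.comp_measurable measurable_fst).sub
    (hP.comp_measurable measurable_snd)).enorm.pow_const 2

theorem measurable_meanOsc {P : ℝ → E} (hP : StronglyMeasurable P) :
    Measurable fun z : ℝ × ℝ => meanOsc P z.1 z.2 := by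
  refine Measurable.lintegral_prod_right (Measurable.lintegral_prod_right ?_)
  exact (measurable_enorm_sub_sq hP).comp
    (f := fun q : ((ℝ × ℝ) × ℝ) × ℝ => (q.1.1.2 + q.1.1.1 * q.2 + q.1.1.1 * q.1.2,
      q.1.1.2 + q.1.1.1 * q.2)) (by fun_prop)

theorem measurable_diffSq {P : ℝ → E} (hP : StronglyMeasurable P) : Measurable (diffSq P) :=
  Measurable.lintegral_prod_right ((measurable_enorm_sub_sq hP).comp
    (f := fun q : ℝ × ℝ => (q.2 + q.1, q.2)) (by fun_prop))

theorem lintegral_meanOsc {P : ℝ → E} (hP : StronglyMeasurable P) (s : ℝ) :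
    ∫⁻ x, meanOsc P s x = meanDiffSq P s := by
  unfold meanOsc meanDiffSq
  have hm := measurable_enorm_sub_sq hP
  rw [lintegral_lintegral_swap]
  · refine lintegral_congr fun η => ?_
    rw [lintegral_lintegral_swap]
    · have : ∀ θ : ℝ, ∫⁻ x, ‖P (x + s * θ + s * η) - P (x + s * θ)‖ₑ ^ 2 = diffSq P (s * η) :=
        fun θ => lintegral_add_right_eq_self (fun x => ‖P (x + s * η) - P x‖ₑ ^ 2) (s * θ)
      simp [this]
    · exact (hm.comp (f := fun q : ℝ × ℝ => (q.1 + s * q.2 + s * η, q.1 + s * q.2))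
        (by fun_prop)).aemeasurable
  · refine (Measurable.lintegral_prod_right ?_).aemeasurable
    exact hm.comp (f := fun q : (ℝ × ℝ) × ℝ => (q.1.1 + s * q.2 + s * q.1.2, q.1.1 + s * q.2))
      (by fun_prop)

/-- Extending the θ-integral to the whole line removes the dependence on x at the price of |s|⁻¹.
With `lintegral_meanOsc` this gives the L² and sup bounds, in ratio |s|^(-1/2) after the square
root, required by the trilinear estimate. -/
theorem meanOsc_le (P : ℝ → E) {s : ℝ} (hs : s ≠ 0) (x : ℝ) :
    meanOsc P s x ≤ ENNReal.ofReal |s⁻¹| * meanDiffSq P s := by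
  unfold meanOsc meanDiffSq
  rw [← lintegral_const_mul' _ _ ENNReal.ofReal_ne_top]
  refine lintegral_mono fun η => ?_
  refine (setLIntegral_le_lintegral _ _).trans (le_of_eq ?_)
  rw [lintegral_comp_mul_left (fun y => ‖P (x + y + s * η) - P (x + y)‖ₑ ^ 2) hs]
  congr 1
  exact lintegral_add_left_eq_self (fun y => ‖P (y + s * η) - P y‖ₑ ^ 2) x

/-- For fixed η, rescaling produces the factor |η|²/|η| ≤ 1; the 2 is the length of the η-interval.
-/
theorem lintegral_meanDiffSq_le {P : ℝ → E} (hP : StronglyMeasurable P) :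
    ∫⁻ s : ℝ, ENNReal.ofReal (|s| ^ (-2 : ℝ)) * meanDiffSq P s ≤
      2 * ∫⁻ h : ℝ, ENNReal.ofReal (|h| ^ (-2 : ℝ)) * diffSq P h := by
  have hd := measurable_diffSq hP
  set N := ∫⁻ h : ℝ, ENNReal.ofReal (|h| ^ (-2 : ℝ)) * diffSq P h
  have h1 : ∀ η : ℝ, η ≠ 0 → η ∈ Set.Ioc (-1 : ℝ) 1 →
      ∫⁻ s : ℝ, ENNReal.ofReal (|s| ^ (-2 : ℝ)) * diffSq P (s * η) ≤ N := by
    intro η h0 hη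
    have hη1 : |η| ≤ 1 := abs_le.2 ⟨hη.1.le, hη.2⟩
    have hpos : 0 < |η| := abs_pos.2 h0
    have h2 : ∀ s : ℝ, ENNReal.ofReal (|s| ^ (-2 : ℝ)) * diffSq P (s * η) =
        ENNReal.ofReal (|η| ^ (2 : ℝ)) *
          (ENNReal.ofReal (|η * s| ^ (-2 : ℝ)) * diffSq P (η * s)) := fun s => by
      rw [← mul_assoc, ← ENNReal.ofReal_mul (by positivity), abs_mul,
        Real.mul_rpow (abs_nonneg _) (abs_nonneg _), ← mul_assoc, ← Real.rpow_add hpos, mul_comm s]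
      simp
    simp only [h2]
    rw [lintegral_const_mul' _ _ ENNReal.ofReal_ne_top,
      lintegral_comp_mul_left (fun s => ENNReal.ofReal (|s| ^ (-2 : ℝ)) * diffSq P s) h0,
      ← mul_assoc, ← ENNReal.ofReal_mul (by positivity)]
    refine mul_le_of_le_one_left' ?_
    rw [ENNReal.ofReal_le_one, Real.rpow_two, abs_inv, pow_two, mul_assoc,
      mul_inv_cancel₀ hpos.ne', mul_one]
    exact hη1
  unfold meanDiffSq
  calc ∫⁻ s : ℝ, ENNReal.ofReal (|s| ^ (-2 : ℝ)) * ∫⁻ η in Set.Ioc (-1 : ℝ) 1, diffSq P (s * η)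
      = ∫⁻ s : ℝ, ∫⁻ η in Set.Ioc (-1 : ℝ) 1,
          ENNReal.ofReal (|s| ^ (-2 : ℝ)) * diffSq P (s * η) := by
        simp only [lintegral_const_mul' _ _ ENNReal.ofReal_ne_top]
    _ = ∫⁻ η in Set.Ioc (-1 : ℝ) 1, ∫⁻ s : ℝ,
          ENNReal.ofReal (|s| ^ (-2 : ℝ)) * diffSq P (s * η) := by
        refine lintegral_lintegral_swap ?_
        refine Measurable.aemeasurable (Measurable.mul (by fun_prop) ?_)
        exact hd.comp (f := fun q : ℝ × ℝ => q.1 * q.2) (by fun_prop)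
    _ ≤ ∫⁻ η in Set.Ioc (-1 : ℝ) 1, N := by
        refine lintegral_mono_ae ?_
        filter_upwards [ae_restrict_mem measurableSet_Ioc,
          ae_restrict_of_ae (Measure.ae_ne volume (0 : ℝ))] with η hη h0
        exact h1 η h0 hη
    _ = 2 * N := by
        rw [setLIntegral_const, Real.volume_Ioc, mul_comm]; norm_num

theorem intervalIntegrable_comp_affine {P : ℝ → E} (hP : LocallyIntegrable P volume)
    {s : ℝ} (hs : s ≠ 0) (x a b : ℝ) :
    IntervalIntegrable (fun θ => P (x + s * θ)) volume a b := by
  have h := (hP.integrableOn_isCompact (isCompact_uIcc (a := s * a + x)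
    (b := s * b + x))).intervalIntegrable.comp_add_right x
  have h2 := h.comp_mul_left (c := s)
  simpa [hs, add_comm] using h2

variable [NormedSpace ℝ E]

/-- The average of `P` over the interval between `x` and `x + s`. -/
noncomputable def avg (P : ℝ → E) (s x : ℝ) : E := ∫ θ in (0 : ℝ)..1, P (x + s * θ)

/-- The average over an interval is the same seen from either end; this joins the chains starting at
the two endpoints. -/
theorem avg_neg_add (P : ℝ → E) (s x : ℝ) : avg P (-s) (x + s) = avg P s x := by
  have h := intervalIntegral.integral_comp_sub_left (a := 0) (b := 1)
    (fun θ => P (x + s * θ)) 1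
  simp only [sub_self, sub_zero] at h
  rw [avg, avg, ← h]
  congr 1 with θ
  congr 1; ring

/-- The difference is the mean of P(x + sθ) - P(x + sθ'/2) over the unit square, and Cauchy-Schwarz
bounds it by the quadratic mean. With θ'/2 as base point the displacement θ - θ'/2 stays in (-1, 1];
the substitution of θ'/2 costs the factor 2. -/
theorem edist_avg_half_le {P : ℝ → E} (hP : StronglyMeasurable P) (hPl : LocallyIntegrable P volume)
    {s : ℝ} (hs : s ≠ 0) (x : ℝ) :
    edist (avg P s x) (avg P (2⁻¹ * s) x) ≤ (2 * meanOsc P s x) ^ (1 / 2 : ℝ) := by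
  have hm := measurable_enorm_sub_sq hP
  have hvol : volume.restrict (Set.Ioc (0 : ℝ) 1) Set.univ = 1 := by simp
  set ν := volume.restrict (Set.Ioc (0 : ℝ) 1) with hν
  have : IsProbabilityMeasure ν := ⟨hvol⟩
  have hI1 : Integrable (fun θ => P (x + s * θ)) ν :=
    (intervalIntegrable_iff_integrableOn_Ioc_of_le zero_le_one).1
      (intervalIntegrable_comp_affine hPl hs x 0 1)
  have hI2 : Integrable (fun θ => P (x + 2⁻¹ * s * θ)) ν :=
    (intervalIntegrable_iff_integrableOn_Ioc_of_le zero_le_one).1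
      (intervalIntegrable_comp_affine hPl (by simpa using hs) x 0 1)
  set f : ℝ × ℝ → ℝ≥0∞ := fun z => ‖P (x + s * z.1) - P (x + 2⁻¹ * s * z.2)‖ₑ with hf
  have hfm : Measurable f := ((hP.comp_measurable (by fun_prop)).sub
    (hP.comp_measurable (by fun_prop))).enorm
  have h1 : edist (avg P s x) (avg P (2⁻¹ * s) x) ≤ ∫⁻ z, f z ∂(ν.prod ν) := by
    have e1 : avg P s x - avg P (2⁻¹ * s) x =
        ∫ z, (P (x + s * z.1) - P (x + 2⁻¹ * s * z.2)) ∂(ν.prod ν) := by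
      have i1 : Integrable (fun z : ℝ × ℝ => P (x + s * z.1)) (ν.prod ν) := hI1.comp_fst ν
      have i2 : Integrable (fun z : ℝ × ℝ => P (x + 2⁻¹ * s * z.2)) (ν.prod ν) := hI2.comp_snd ν
      rw [integral_sub i1 i2, integral_fun_fst (fun θ => P (x + s * θ)),
        integral_fun_snd (fun θ => P (x + 2⁻¹ * s * θ))]
      simp [avg, intervalIntegral.integral_of_le, hν]
    rw [edist_eq_enorm_sub, e1]
    exact enorm_integral_le_lintegral_enorm _
  have h2 : ∫⁻ z, f z ∂(ν.prod ν) ≤ (∫⁻ z, f z ^ 2 ∂(ν.prod ν)) ^ (1 / 2 : ℝ) := by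
    have := lintegral_rpow_mul_measure_le (μ := ν.prod ν) hfm.aemeasurable (θ := 1 / 2)
      (by norm_num) (by norm_num)
    simpa using this
  refine h1.trans (h2.trans (ENNReal.rpow_le_rpow ?_ (by norm_num)))
  have hfm2 : Measurable fun z : ℝ × ℝ => f z ^ 2 := hfm.pow_const 2
  rw [lintegral_prod_symm' _ hfm2]
  have h3 : ∀ θ' : ℝ, θ' ∈ Set.Ioc (0 : ℝ) 1 → ∫⁻ θ, f (θ, θ') ^ 2 ∂ν ≤
      ∫⁻ η in Set.Ioc (-1 : ℝ) 1, ‖P (x + s * (2⁻¹ * θ') + s * η) - P (x + s * (2⁻¹ * θ'))‖ₑ ^ 2 := by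
    intro θ' hθ'
    rw [hν, ← lintegral_indicator measurableSet_Ioc, ← lintegral_indicator measurableSet_Ioc,
      ← lintegral_add_left_eq_self _ (2⁻¹ * θ')]
    refine lintegral_mono fun η => ?_
    by_cases hη : 2⁻¹ * θ' + η ∈ Set.Ioc (0 : ℝ) 1
    · have hη2 : η ∈ Set.Ioc (-1 : ℝ) 1 := by
        constructor <;> linarith [hη.1, hη.2, hθ'.1, hθ'.2]
      rw [Set.indicator_of_mem hη, Set.indicator_of_mem hη2]
      apply le_of_eq
      have e1 : x + s * (2⁻¹ * θ' + η) = x + s * (2⁻¹ * θ') + s * η := by ring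
      have e2 : x + 2⁻¹ * s * θ' = x + s * (2⁻¹ * θ') := by ring
      simp only [hf, e1, e2]
    · rw [Set.indicator_of_notMem hη]
      exact zero_le
  calc ∫⁻ θ', (∫⁻ θ, f (θ, θ') ^ 2 ∂ν) ∂ν
      ≤ ∫⁻ θ', (∫⁻ η in Set.Ioc (-1 : ℝ) 1,
          ‖P (x + s * (2⁻¹ * θ') + s * η) - P (x + s * (2⁻¹ * θ'))‖ₑ ^ 2) ∂ν := by
        refine lintegral_mono_ae ?_
        filter_upwards [ae_restrict_mem measurableSet_Ioc] with θ' hθ' using h3 θ' hθ'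
    _ ≤ 2 * ∫⁻ θ, (∫⁻ η in Set.Ioc (-1 : ℝ) 1,
          ‖P (x + s * θ + s * η) - P (x + s * θ)‖ₑ ^ 2) ∂ν := by
        have e := lintegral_comp_mul_left ((Set.Ioc (0 : ℝ) 1).indicator fun θ =>
          ∫⁻ η in Set.Ioc (-1 : ℝ) 1, ‖P (x + s * θ + s * η) - P (x + s * θ)‖ₑ ^ 2)
          (c := 2⁻¹) (by norm_num)
        rw [inv_inv, abs_of_pos two_pos, ENNReal.ofReal_ofNat] at e
        rw [hν, ← lintegral_indicator measurableSet_Ioc (fun θ =>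
          ∫⁻ η in Set.Ioc (-1 : ℝ) 1, ‖P (x + s * θ + s * η) - P (x + s * θ)‖ₑ ^ 2), ← e,
          ← lintegral_indicator measurableSet_Ioc]
        refine lintegral_mono fun θ => ?_
        by_cases hθ : θ ∈ Set.Ioc (0 : ℝ) 1
        · have hθ2 : 2⁻¹ * θ ∈ Set.Ioc (0 : ℝ) 1 := by
            constructor <;> linarith [hθ.1, hθ.2]
          rw [Set.indicator_of_mem hθ, Set.indicator_of_mem hθ2]
        · rw [Set.indicator_of_notMem hθ]
          exact zero_le
    _ = 2 * meanOsc P s x := by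
        unfold meanOsc
        rw [lintegral_lintegral_swap]
        exact (hm.comp (f := fun q : ℝ × ℝ => (x + s * q.1 + s * q.2, x + s * q.1))
          (by fun_prop)).aemeasurable

variable [CompleteSpace E]

/-- Lebesgue differentiation: the averages are difference quotients of the primitive of P at x. -/
theorem ae_tendsto_avg {P : ℝ → E} (hP : LocallyIntegrable P volume) :
    ∀ᵐ x, ∀ h : ℝ, h ≠ 0 → Tendsto (fun k : ℕ => avg P (2⁻¹ ^ k * h) x) atTop (𝓝 (P x)) := by
  filter_upwards [LocallyIntegrable.ae_hasDerivAt_integral hP] with x hx h hh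
  have h1 := (hx x).tendsto_slope_zero
  have h2 : Tendsto (fun k : ℕ => (2⁻¹ : ℝ) ^ k * h) atTop (𝓝[≠] 0) := by
    refine tendsto_nhdsWithin_iff.2 ⟨?_, .of_forall fun k => ?_⟩
    · simpa using (tendsto_pow_atTop_nhds_zero_of_lt_one (by norm_num)
        (by norm_num : (2⁻¹ : ℝ) < 1)).mul_const h
    · simpa using hh
  refine (h1.comp h2).congr fun k => ?_
  have h3 : (2⁻¹ : ℝ) ^ k * h ≠ 0 := by simpa using hh
  have h4 := intervalIntegral.integral_comp_add_mul (a := 0) (b := 1) P h3 x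
  simp only [mul_zero, add_zero, mul_one] at h4
  rw [avg, h4]
  simp

theorem edist_avg_le_tsum {P : ℝ → E} (hP : StronglyMeasurable P) (hPl : LocallyIntegrable P volume) :
    ∀ᵐ x, ∀ h : ℝ, h ≠ 0 →
      edist (avg P h x) (P x) ≤ ∑' k : ℕ, (2 * meanOsc P (2⁻¹ ^ k * h) x) ^ (1 / 2 : ℝ) := by
  filter_upwards [ae_tendsto_avg hPl] with x hx h hh
  have h1 := edist_le_tsum_of_edist_le_of_tendsto₀
    (fun k : ℕ => (2 * meanOsc P (2⁻¹ ^ k * h) x) ^ (1 / 2 : ℝ)) (fun k => ?_) (hx h hh)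
  · simpa using h1
  · have := edist_avg_half_le hP hPl (s := 2⁻¹ ^ k * h) (by simpa using hh) x
    rwa [← mul_assoc, ← pow_succ'] at this

theorem enorm_sub_le_tsum {P : ℝ → E} (hP : StronglyMeasurable P)
    (hPl : LocallyIntegrable P volume) {h : ℝ} (hh : h ≠ 0) :
    ∀ᵐ x, ‖P x - P (x + h)‖ₑ ≤ ∑' k : ℕ, ((2 * meanOsc P (2⁻¹ ^ k * h) x) ^ (1 / 2 : ℝ) +
      (2 * meanOsc P (2⁻¹ ^ k * -h) (x + h)) ^ (1 / 2 : ℝ)) := by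
  have h1 := edist_avg_le_tsum hP hPl
  have h2 := (measurePreserving_add_right volume h).quasiMeasurePreserving.ae h1
  filter_upwards [h1, h2] with x hx hx2
  rw [ENNReal.tsum_add, ← edist_eq_enorm_sub]
  have h3 := hx h hh
  have h4 := hx2 (-h) (neg_ne_zero.2 hh)
  rw [avg_neg_add] at h4
  rw [edist_comm] at h3
  exact (edist_triangle _ _ _).trans (add_le_add h3 h4)

end Oscillation

end MultiComm

/-! ### Summation over scales: the trilinear estimate for differences of P. -/

namespace MultiComm

theorem lintegral_mul_sq_le {α : Type*} [MeasurableSpace α] {μ : Measure α} {f g : α → ℝ≥0∞}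
    (hf : AEMeasurable f μ) (hg : AEMeasurable g μ) :
    ∫⁻ x, f x * g x ∂μ ≤ (∫⁻ x, f x ^ 2 ∂μ) ^ (1 / 2 : ℝ) * (∫⁻ x, g x ^ 2 ∂μ) ^ (1 / 2 : ℝ) := by
  simpa using lintegral_mul_rpow_le hf hg (a := 1 / 2) (b := 1 / 2) (by norm_num) (by norm_num)
    (by norm_num)

/-- The weighted norm `(∫ |h|^(1+2s) ‖k(h, ·)‖_{L^p}² dh)^(1/2)` with `1/p = 1/2 - s`. -/
noncomputable def mixedNorm (s : ℝ) (k : ℝ → ℝ → ℝ≥0∞) : ℝ≥0∞ :=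
  (∫⁻ h : ℝ, ENNReal.ofReal (|h| ^ (1 + 2 * s)) *
    ((∫⁻ x, k h x ^ (1 / (1 / 2 - s))) ^ (1 / 2 - s)) ^ 2) ^ (1 / 2 : ℝ)

/-- The squared powers combine to |c|^(1+2s) |ch|^(-2), the weight of the Sobolev norm in the
variable ch. Rescaling takes back one factor |c|. -/
theorem lintegral_scaled_meanDiffSq_le {E : Type} [NormedAddCommGroup E] {P : ℝ → E}
    (hP : StronglyMeasurable P) {s : ℝ} {c : ℝ} (hc : c ≠ 0) :
    ∫⁻ h : ℝ, (ENNReal.ofReal (|h| ^ (-((1 + 2 * s) / 2)) * |c * h| ^ (-(1 / 2 - s))) *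
        (2 * meanDiffSq P (c * h)) ^ (1 / 2 : ℝ)) ^ 2 ≤
      ENNReal.ofReal (4 * |c| ^ (2 * s)) *
        ∫⁻ h : ℝ, ENNReal.ofReal (|h| ^ (-2 : ℝ)) * diffSq P h := by
  have hcpos : 0 < |c| := abs_pos.2 hc
  have h1 : ∀ᵐ h : ℝ, (ENNReal.ofReal (|h| ^ (-((1 + 2 * s) / 2)) * |c * h| ^ (-(1 / 2 - s))) *
        (2 * meanDiffSq P (c * h)) ^ (1 / 2 : ℝ)) ^ 2 =
      ENNReal.ofReal (2 * |c| ^ (1 + 2 * s)) *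
        (ENNReal.ofReal (|c * h| ^ (-2 : ℝ)) * meanDiffSq P (c * h)) := by
    filter_upwards [Measure.ae_ne volume (0 : ℝ)] with h hh
    have hpos : 0 < |h| := abs_pos.2 hh
    have e1 : ((2 * meanDiffSq P (c * h)) ^ (1 / 2 : ℝ)) ^ 2 = 2 * meanDiffSq P (c * h) := by
      rw [← ENNReal.rpow_natCast, ← ENNReal.rpow_mul]; norm_num
    have e2 : (|h| ^ (-((1 + 2 * s) / 2)) * |c * h| ^ (-(1 / 2 - s))) ^ 2 =
        |c| ^ (1 + 2 * s) * |c * h| ^ (-2 : ℝ) := by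
      rw [abs_mul, Real.mul_rpow hcpos.le hpos.le, Real.mul_rpow hcpos.le hpos.le, mul_pow, mul_pow,
        ← Real.rpow_natCast, ← Real.rpow_natCast, ← Real.rpow_natCast, ← Real.rpow_mul hpos.le,
        ← Real.rpow_mul hpos.le, ← Real.rpow_mul hcpos.le, mul_left_comm, ← mul_assoc,
        mul_assoc, ← Real.rpow_add hpos, ← mul_assoc (|c| ^ (1 + 2 * s)), ← Real.rpow_add hcpos]
      push_cast
      congr 2 <;> ring
    rw [mul_pow, e1, ← ENNReal.ofReal_pow (by positivity), e2, ENNReal.ofReal_mul (by positivity),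
      ENNReal.ofReal_mul (by positivity)]
    simp only [ENNReal.ofReal_ofNat]
    ring
  rw [lintegral_congr_ae h1, lintegral_const_mul' _ _ ENNReal.ofReal_ne_top,
    lintegral_comp_mul_left (fun h => ENNReal.ofReal (|h| ^ (-2 : ℝ)) * meanDiffSq P h) hc]
  refine (mul_le_mul' le_rfl (mul_le_mul' le_rfl (lintegral_meanDiffSq_le hP))).trans
    (le_of_eq ?_)
  rw [← mul_assoc, ← mul_assoc, ← ENNReal.ofReal_mul (by positivity), ← ENNReal.ofReal_ofNat,
    ← ENNReal.ofReal_mul (by positivity)]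
  congr 2
  rw [abs_inv, Real.rpow_add hcpos, Real.rpow_one]
  field_simp
  norm_num

/-- The one-scale estimate is applied for each h with r = |ch|, followed by Cauchy-Schwarz in h with
the weights |h|^(±(1+2s)/2). The gain |c|^s is what makes the sum over dyadic c converge. -/
theorem lintegral_osc_mul_le {s : ℝ} (hs : 0 < s) (hs' : s < 1 / 2) :
    ∃ C : ℝ, 0 < C ∧ ∀ (E : Type) [NormedAddCommGroup E] (P : ℝ → E) (k : ℝ → ℝ → ℝ≥0∞)
      (w : ℝ → ℝ≥0∞) (M c τ : ℝ), StronglyMeasurable P → Measurable (Function.uncurry k) →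
      AEMeasurable w volume → (∀ x, w x ≠ ⊤) → WeakBound w M → 0 < M → c ≠ 0 →
      ∫⁻ h : ℝ, ∫⁻ x, (2 * meanOsc P (c * h) (x + τ * h)) ^ (1 / 2 : ℝ) * k h x * w x ≤
        ENNReal.ofReal (C * |c| ^ s * M) *
          (∫⁻ h : ℝ, ENNReal.ofReal (|h| ^ (-2 : ℝ)) * diffSq P h) ^ (1 / 2 : ℝ) *
            mixedNorm s k := by
  obtain ⟨C, hC0, hC⟩ := WeakBound.lintegral_mul_mul_le hs hs'
  refine ⟨2 * C, by positivity, fun E _ P k w M c τ hP hk hw hwf hM hM0 hc => ?_⟩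
  have hθ : 0 < 1 / 2 - s := by linarith
  have hmo := measurable_meanOsc hP
  have hkm : ∀ h, Measurable (k h) := fun h => hk.comp (measurable_prodMk_left)
  set κ : ℝ → ℝ≥0∞ := fun h => (∫⁻ x, k h x ^ (1 / (1 / 2 - s))) ^ (1 / 2 - s) with hκ
  have hκm : Measurable κ :=
    (Measurable.lintegral_prod_right (hk.pow_const _)).pow_const _
  have hmd : Measurable (meanDiffSq P) := Measurable.lintegral_prod_right
    ((measurable_diffSq hP).comp (f := fun q : ℝ × ℝ => q.1 * q.2) (by fun_prop))
  set b : ℝ → ℝ≥0∞ := fun h => (2 * meanDiffSq P (c * h)) ^ (1 / 2 : ℝ) with hb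
  have hbm : Measurable b := ((hmd.comp (by fun_prop)).const_mul 2).pow_const _
  have h1 : ∀ᵐ h : ℝ, ∫⁻ x, (2 * meanOsc P (c * h) (x + τ * h)) ^ (1 / 2 : ℝ) * k h x * w x ≤
      ENNReal.ofReal (C * M) *
        ((ENNReal.ofReal (|h| ^ (-((1 + 2 * s) / 2)) * |c * h| ^ (-(1 / 2 - s))) * b h) *
        (ENNReal.ofReal (|h| ^ ((1 + 2 * s) / 2)) * κ h)) := by
    filter_upwards [Measure.ae_ne volume (0 : ℝ)] with h hh
    have hch : c * h ≠ 0 := mul_ne_zero hc hh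
    have hpos : 0 < |c * h| := abs_pos.2 hch
    have hpos' : 0 < |h| := abs_pos.2 hh
    have hsq : ∀ y : ℝ≥0∞, (y ^ (1 / 2 : ℝ)) ^ 2 = y := fun y => by
      rw [← ENNReal.rpow_natCast, ← ENNReal.rpow_mul]; norm_num
    refine (hC (fun x => (2 * meanOsc P (c * h) (x + τ * h)) ^ (1 / 2 : ℝ)) (k h) w M |c * h| (b h)
      ?_ (hkm h).aemeasurable hw hwf hM hM0 hpos ?_ ?_).trans (le_of_eq ?_)
    · exact (((hmo.comp (f := fun x => (c * h, x + τ * h)) (by fun_prop)).const_mul 2).pow_const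
        _).aemeasurable
    · simp only [hb, hsq]
      rw [lintegral_const_mul' _ _ (by simp),
        lintegral_add_right_eq_self (fun x => meanOsc P (c * h) x), lintegral_meanOsc hP]
    · refine .of_forall fun x => ?_
      have := meanOsc_le P hch (x + τ * h)
      calc (2 * meanOsc P (c * h) (x + τ * h)) ^ (1 / 2 : ℝ)
          ≤ (2 * (ENNReal.ofReal |(c * h)⁻¹| * meanDiffSq P (c * h))) ^ (1 / 2 : ℝ) := by gcongr
        _ = _ := by
          rw [mul_left_comm, mul_comm, ENNReal.mul_rpow_of_nonneg _ _ (by norm_num), abs_inv,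
            ENNReal.ofReal_rpow_of_pos (by positivity), Real.inv_rpow hpos.le,
            ← Real.rpow_neg hpos.le]
    · rw [show ENNReal.ofReal (C * |c * h| ^ (-(1 / 2 - s)) * M) = ENNReal.ofReal (C * M) *
          (ENNReal.ofReal (|h| ^ (-((1 + 2 * s) / 2)) * |c * h| ^ (-(1 / 2 - s))) *
            ENNReal.ofReal (|h| ^ ((1 + 2 * s) / 2))) from ?_]
      · ring
      · rw [← ENNReal.ofReal_mul (by positivity), ← ENNReal.ofReal_mul (by positivity)]
        congr 1
        have : |h| ^ (-((1 + 2 * s) / 2)) * |h| ^ ((1 + 2 * s) / 2) = 1 := by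
          rw [← Real.rpow_add hpos']; simp
        linear_combination (-(C * M * |c * h| ^ (-(1 / 2 - s)))) * this
  refine (lintegral_mono_ae h1).trans ?_
  rw [lintegral_const_mul' _ _ ENNReal.ofReal_ne_top]
  have hm1 : Measurable fun h : ℝ =>
      ENNReal.ofReal (|h| ^ (-((1 + 2 * s) / 2)) * |c * h| ^ (-(1 / 2 - s))) * b h := by fun_prop
  have hm2 : Measurable fun h : ℝ => ENNReal.ofReal (|h| ^ ((1 + 2 * s) / 2)) * κ h := by fun_prop
  refine (mul_le_mul' le_rfl (lintegral_mul_sq_le hm1.aemeasurable hm2.aemeasurable)).trans ?_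
  have h2 := ENNReal.rpow_le_rpow (lintegral_scaled_meanDiffSq_le hP (s := s) hc)
    (show (0 : ℝ) ≤ 1 / 2 by norm_num)
  have h3 : (∫⁻ h : ℝ, (ENNReal.ofReal (|h| ^ ((1 + 2 * s) / 2)) * κ h) ^ 2) ^ (1 / 2 : ℝ) =
      mixedNorm s k := by
    unfold mixedNorm
    congr 2 with h
    rw [mul_pow, ← ENNReal.ofReal_pow (by positivity), ← Real.rpow_natCast,
      ← Real.rpow_mul (abs_nonneg _)]
    congr 3
    push_cast; ring
  rw [h3, ← mul_assoc]
  refine mul_le_mul' ?_ le_rfl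
  refine (mul_le_mul' le_rfl h2).trans (le_of_eq ?_)
  have hcpos : 0 < |c| := abs_pos.2 hc
  rw [ENNReal.mul_rpow_of_nonneg _ _ (by norm_num), ENNReal.ofReal_rpow_of_pos (by positivity),
    ← mul_assoc, ← ENNReal.ofReal_mul (by positivity), Real.mul_rpow (by norm_num) (by positivity),
    ← Real.rpow_mul hcpos.le, show (4 : ℝ) = 2 ^ (2 : ℝ) by norm_num,
    ← Real.rpow_mul (by norm_num)]
  congr 2
  rw [show 2 * s * (1 / 2) = s by ring]
  norm_num
  ring

/-- The main estimate: the differences of a map in `H^(1/2)`, integrated against a kernel and a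
function in weak `L²`. -/
theorem lintegral_sub_mul_le {s : ℝ} (hs : 0 < s) (hs' : s < 1 / 2) :
    ∃ C : ℝ, 0 < C ∧ ∀ (E : Type) [NormedAddCommGroup E] [NormedSpace ℝ E] [CompleteSpace E]
      (P : ℝ → E) (k : ℝ → ℝ → ℝ≥0∞)
      (w : ℝ → ℝ≥0∞) (M : ℝ), StronglyMeasurable P → LocallyIntegrable P volume →
      Measurable (Function.uncurry k) →
      AEMeasurable w volume → (∀ x, w x ≠ ⊤) → WeakBound w M → 0 < M →
      ∫⁻ h : ℝ, ∫⁻ x, ‖P x - P (x + h)‖ₑ * k h x * w x ≤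
        ENNReal.ofReal (C * M) *
          (∫⁻ h : ℝ, ENNReal.ofReal (|h| ^ (-2 : ℝ)) * diffSq P h) ^ (1 / 2 : ℝ) *
            mixedNorm s k := by
  obtain ⟨C, hC0, hC⟩ := lintegral_osc_mul_le hs hs'
  have hr : (2⁻¹ : ℝ) ^ s < 1 := Real.rpow_lt_one (by norm_num) (by norm_num) hs
  have hr' : 0 < 1 - (2⁻¹ : ℝ) ^ s := by linarith
  refine ⟨2 * C * (1 - 2⁻¹ ^ s)⁻¹, by positivity,
    fun E _ _ _ P k w M hP hPl hk hw hwf hM hM0 => ?_⟩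
  have hmo := measurable_meanOsc hP
  have hkm : ∀ h, Measurable (k h) := fun h => hk.comp (measurable_prodMk_left)
  set N := (∫⁻ h : ℝ, ENNReal.ofReal (|h| ^ (-2 : ℝ)) * diffSq P h) ^ (1 / 2 : ℝ)
  set K := mixedNorm s k
  -- τ = 0 is the chain based at x and τ = 1 the one based at x + h, whose displacements have the
  -- opposite sign 1 - 2τ.
  set F : ℕ → ℝ → ℝ → ℝ → ℝ≥0∞ := fun n τ h x =>
    (2 * meanOsc P ((1 - 2 * τ) * 2⁻¹ ^ n * h) (x + τ * h)) ^ (1 / 2 : ℝ) * k h x * w x with hF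
  have hFmeas : ∀ n τ, AEMeasurable (Function.uncurry (F n τ)) (volume.prod volume) := by
    intro n τ
    refine AEMeasurable.mul (AEMeasurable.mul (Measurable.aemeasurable ?_) hk.aemeasurable)
      hw.comp_snd
    exact ((hmo.comp (f := fun z : ℝ × ℝ => ((1 - 2 * τ) * 2⁻¹ ^ n * z.1, z.2 + τ * z.1))
      (by fun_prop)).const_mul 2).pow_const _
  have hFx : ∀ n τ h, AEMeasurable (F n τ h) volume := by
    intro n τ h
    refine AEMeasurable.mul (AEMeasurable.mul (Measurable.aemeasurable ?_) (hkm h).aemeasurable) hw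
    exact ((hmo.comp (f := fun x : ℝ => ((1 - 2 * τ) * 2⁻¹ ^ n * h, x + τ * h))
      (by fun_prop)).const_mul 2).pow_const _
  have hFh : ∀ n τ, AEMeasurable (fun h => ∫⁻ x, F n τ h x) volume := fun n τ =>
    (hFmeas n τ).lintegral_prod_right'
  have h1 : ∀ᵐ h : ℝ, ∫⁻ x, ‖P x - P (x + h)‖ₑ * k h x * w x ≤
      ∑' n, ((∫⁻ x, F n 0 h x) + ∫⁻ x, F n 1 h x) := by
    filter_upwards [Measure.ae_ne volume (0 : ℝ)] with h hh
    calc ∫⁻ x, ‖P x - P (x + h)‖ₑ * k h x * w x ≤ ∫⁻ x, ∑' n, (F n 0 h x + F n 1 h x) := by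
          refine lintegral_mono_ae ?_
          filter_upwards [enorm_sub_le_tsum hP hPl hh] with x hx
          have e : ∀ n, F n 0 h x + F n 1 h x = ((2 * meanOsc P (2⁻¹ ^ n * h) x) ^ (1 / 2 : ℝ) +
              (2 * meanOsc P (2⁻¹ ^ n * -h) (x + h)) ^ (1 / 2 : ℝ)) * (k h x * w x) := by
            intro n
            simp only [hF]
            rw [show (1 - 2 * (0 : ℝ)) * 2⁻¹ ^ n * h = 2⁻¹ ^ n * h by ring,
              show (1 - 2 * (1 : ℝ)) * 2⁻¹ ^ n * h = 2⁻¹ ^ n * -h by ring, zero_mul, add_zero,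
              one_mul]
            ring
          simp only [e]
          rw [ENNReal.tsum_mul_right, mul_assoc]
          gcongr
      _ = ∑' n, ∫⁻ x, (F n 0 h x + F n 1 h x) :=
          lintegral_tsum fun n => (hFx n 0 h).add (hFx n 1 h)
      _ = _ := by
          congr 1 with n
          exact lintegral_add_left' (hFx n 0 h) _
  have h2 : ∀ n (τ : ℝ), |1 - 2 * τ| = 1 → ∫⁻ h, ∫⁻ x, F n τ h x ≤
      ENNReal.ofReal (C * M * (2⁻¹ ^ s) ^ n) * (N * K) := by
    intro n τ hτ
    have hne : (1 - 2 * τ) * 2⁻¹ ^ n ≠ 0 := by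
      refine mul_ne_zero (fun h0 => ?_) (by positivity)
      rw [h0] at hτ; simp at hτ
    refine (hC E P k w M _ τ hP hk hw hwf hM hM0 hne).trans (le_of_eq ?_)
    rw [abs_mul, hτ, one_mul, abs_of_pos (by positivity), pow_rpow_comm (by norm_num), mul_assoc]
    congr 2
    ring
  calc ∫⁻ h : ℝ, ∫⁻ x, ‖P x - P (x + h)‖ₑ * k h x * w x
      ≤ ∫⁻ h, ∑' n, ((∫⁻ x, F n 0 h x) + ∫⁻ x, F n 1 h x) := lintegral_mono_ae h1
    _ = ∑' n, ((∫⁻ h, ∫⁻ x, F n 0 h x) + ∫⁻ h, ∫⁻ x, F n 1 h x) := by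
        have hm : ∀ n, AEMeasurable (fun h => (∫⁻ x, F n 0 h x) + ∫⁻ x, F n 1 h x) volume :=
          fun n => (hFh n 0).add (hFh n 1)
        rw [lintegral_tsum hm]
        congr 1 with n
        exact lintegral_add_left' (hFh n 0) _
    _ ≤ ∑' n, ENNReal.ofReal (2 * C * M * (2⁻¹ ^ s) ^ n) * (N * K) := by
        gcongr with n
        refine (add_le_add (h2 n 0 (by norm_num)) (h2 n 1 (by norm_num))).trans (le_of_eq ?_)
        rw [← add_mul, ← ENNReal.ofReal_add (by positivity) (by positivity)]
        congr 2; ring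
    _ = _ := by
        rw [ENNReal.tsum_mul_right, tsum_ofReal_geometric (by positivity) hr _ (by positivity),
          ← mul_assoc]
        congr 3; ring

end MultiComm

/-! ### Frobenius norm, orthogonal matrices, and kernels in the coordinates (h, x). -/

namespace MultiComm

variable {m : ℕ}

theorem frob_eq_sqrt_trace (A : Mat m) : frob A = Real.sqrt (Matrix.trace (Aᵀ * A)) := by
  rw [frob, Matrix.trace, Finset.sum_comm]
  simp [Matrix.mul_apply, pow_two]

theorem frob_transpose (A : Mat m) : frob Aᵀ = frob A := by
  rw [frob, frob, Finset.sum_comm]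
  rfl

theorem frob_orthogonal_mul_mul {P Q : Mat m} (hP : P ∈ Matrix.orthogonalGroup (Fin m) ℝ)
    (hQ : Q ∈ Matrix.orthogonalGroup (Fin m) ℝ) (A : Mat m) : frob (P * A * Qᵀ) = frob A := by
  have hP' : Pᵀ * P = 1 := (Matrix.mem_orthogonalGroup_iff' (Fin m) ℝ).1 hP
  have hQ' : Qᵀ * Q = 1 := (Matrix.mem_orthogonalGroup_iff' (Fin m) ℝ).1 hQ
  have h : (P * A * Qᵀ)ᵀ * (P * A * Qᵀ) = Q * (Aᵀ * A) * Qᵀ := by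
    simp only [Matrix.transpose_mul, Matrix.transpose_transpose]
    calc Q * (Aᵀ * Pᵀ) * (P * A * Qᵀ) = Q * (Aᵀ * (Pᵀ * P) * A) * Qᵀ := by
          simp only [Matrix.mul_assoc]
      _ = _ := by rw [hP', Matrix.mul_one]
  rw [frob_eq_sqrt_trace, frob_eq_sqrt_trace, h, Matrix.trace_mul_comm, ← Matrix.mul_assoc, hQ',
    Matrix.one_mul]

theorem abs_apply_le_frob (A : Mat m) (i j : Fin m) : |A i j| ≤ frob A := by
  refine Real.abs_le_sqrt ?_
  refine le_trans ?_ (Finset.single_le_sum (f := fun i => ∑ j, A i j ^ 2)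
    (fun i _ => by positivity) (Finset.mem_univ i))
  exact Finset.single_le_sum (f := fun j => A i j ^ 2) (fun j _ => by positivity) (Finset.mem_univ j)

theorem frob_le_sum (A : Mat m) : frob A ≤ ∑ i, ∑ j, |A i j| := by
  refine Real.sqrt_le_iff.2 ⟨by positivity, ?_⟩
  have h1 : ∀ i, ∑ j, A i j ^ 2 ≤ (∑ j, |A i j|) ^ 2 := fun i => by
    simpa using Finset.sum_sq_le_sq_sum_of_nonneg (s := Finset.univ) (f := fun j => |A i j|)
      fun j _ => abs_nonneg _
  refine (Finset.sum_le_sum fun i _ => h1 i).trans ?_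
  exact Finset.sum_sq_le_sq_sum_of_nonneg fun i _ => by positivity

theorem frob_orthogonal {P : Mat m} (hP : P ∈ Matrix.orthogonalGroup (Fin m) ℝ) :
    frob P = Real.sqrt m := by
  rw [frob_eq_sqrt_trace, (Matrix.mem_orthogonalGroup_iff' (Fin m) ℝ).1 hP]
  simp

/-- The action of a matrix as a continuous linear map. -/
noncomputable def actCLM (A : Mat m) : Vec m →L[ℝ] Vec m :=
  (Matrix.toEuclideanLin A).toContinuousLinearMap

theorem actCLM_apply (A : Mat m) (w : Vec m) : actCLM A w = act A w := rfl

theorem act_add (A : Mat m) (u w : Vec m) : act A (u + w) = act A u + act A w :=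
  (actCLM A).map_add u w

theorem act_smul (A : Mat m) (c : ℝ) (w : Vec m) : act A (c • w) = c • act A w :=
  (actCLM A).map_smul c w

theorem act_act (A B : Mat m) (w : Vec m) : act A (act B w) = act (A * B) w := by
  simp [act, Matrix.mulVec_mulVec]

theorem act_one (w : Vec m) : act 1 w = w := by simp [act]

theorem act_sub_left (A B : Mat m) (w : Vec m) : act (A - B) w = act A w - act B w := by
  simp [act, Matrix.sub_mulVec]

theorem act_neg_left (A : Mat m) (w : Vec m) : act (-A) w = -act A w := by
  simp [act, Matrix.neg_mulVec]

theorem inner_act_transpose (A : Mat m) (u w : Vec m) :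
    inner ℝ (act Aᵀ u) w = inner ℝ u (act A w) := by
  simp only [EuclideanSpace.inner_eq_star_dotProduct, act, star_trivial]
  rw [Matrix.dotProduct_mulVec, Matrix.vecMul_transpose, dotProduct_comm]

theorem norm_act_le (A : Mat m) (w : Vec m) : ‖act A w‖ ≤ frob A * ‖w‖ := by
  rw [EuclideanSpace.norm_eq, EuclideanSpace.norm_eq, frob, ← Real.sqrt_mul (by positivity)]
  refine Real.sqrt_le_sqrt ?_
  rw [Finset.sum_mul]
  refine Finset.sum_le_sum fun i _ => ?_
  have h := Finset.sum_mul_sq_le_sq_mul_sq Finset.univ (fun j => A i j) (fun j => w.ofLp j)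
  simpa [act, Matrix.mulVec, dotProduct] using h

theorem norm_act_orthogonal {P : Mat m} (hP : P ∈ Matrix.orthogonalGroup (Fin m) ℝ) (w : Vec m) :
    ‖act P w‖ = ‖w‖ := by
  have h : inner ℝ (act P w) (act P w) = inner ℝ w w := by
    rw [← inner_act_transpose, act_act, (Matrix.mem_orthogonalGroup_iff' (Fin m) ℝ).1 hP, act_one]
  rw [← sq_eq_sq₀ (norm_nonneg _) (norm_nonneg _), ← real_inner_self_eq_norm_sq,
    ← real_inner_self_eq_norm_sq, h]

/-- In these coordinates the slices at fixed h of the kernel norms become slices of the plane, so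
null sets and integrals pass between the two descriptions. -/
theorem measurePreserving_shear :
    MeasurePreserving (fun q : ℝ × ℝ => (q.2, q.2 + q.1)) volume volume :=
  (measurePreserving_prod_add (volume : Measure ℝ) volume).comp
    (Measure.measurePreserving_swap (μ := (volume : Measure ℝ)) (ν := volume))

theorem lintegral_eq_lintegral_shear {F : ℝ × ℝ → ℝ≥0∞} (hF : AEMeasurable F volume) :
    ∫⁻ z, F z = ∫⁻ h : ℝ, ∫⁻ x, F (x, x + h) := by
  have hmp := measurePreserving_shear
  have hF' := hF
  rw [← hmp.map_eq] at hF'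
  calc ∫⁻ z, F z = ∫⁻ q : ℝ × ℝ, F (q.2, q.2 + q.1) := by
        rw [← lintegral_map' hF' hmp.aemeasurable, hmp.map_eq]
    _ = _ := lintegral_prod _ (hF.comp_quasiMeasurePreserving hmp.quasiMeasurePreserving)

theorem ae_shear {p : ℝ × ℝ → Prop} (h : ∀ᵐ z, p z) : ∀ᵐ s : ℝ, ∀ᵐ x, p (x, x + s) :=
  Measure.ae_ae_of_ae_prod (measurePreserving_shear.quasiMeasurePreserving.ae h)

theorem ae_fst_ne_snd : ∀ᵐ z : ℝ × ℝ, z.1 ≠ z.2 := by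
  have hs : MeasurableSet {z : ℝ × ℝ | ¬ z.1 ≠ z.2} := by
    simpa using measurableSet_eq_fun measurable_fst measurable_snd
  rw [ae_iff, ← lintegral_indicator_one hs,
    lintegral_eq_lintegral_shear ((measurable_one.indicator hs).aemeasurable)]
  rw [lintegral_eq_zero_of_ae_eq_zero]
  filter_upwards [Measure.ae_ne volume (0 : ℝ)] with h hh
  simp [Set.indicator, hh]

theorem ae_prod_fst {p : ℝ → Prop} (h : ∀ᵐ x, p x) : ∀ᵐ z : ℝ × ℝ, p z.1 :=
  Measure.quasiMeasurePreserving_fst.ae h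

theorem ae_prod_snd {p : ℝ → Prop} (h : ∀ᵐ x, p x) : ∀ᵐ z : ℝ × ℝ, p z.2 :=
  Measure.quasiMeasurePreserving_snd.ae h

theorem enorm_frob (A : Mat m) : ‖frob A‖ₑ = ENNReal.ofReal (frob A) :=
  Real.enorm_of_nonneg (frob_nonneg A)

theorem continuous_frob : Continuous (frob : Mat m → ℝ) := by
  unfold frob
  fun_prop

/-- Measurability of a kernel, entry by entry. -/
def MeasKernel (K : ℝ → ℝ → Mat m) : Prop :=
  ∀ i j, AEStronglyMeasurable (fun z : ℝ × ℝ => K z.1 z.2 i j) volume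

theorem MeasKernel.aestronglyMeasurable {K : ℝ → ℝ → Mat m} (hK : MeasKernel K) :
    AEStronglyMeasurable (fun z : ℝ × ℝ => K z.1 z.2) volume :=
  (aemeasurable_pi_lambda _ fun i => aemeasurable_pi_lambda _ fun j =>
    (hK i j).aemeasurable).aestronglyMeasurable

theorem kernelNorm_congr {K G : ℝ → ℝ → Mat m} (h : ∀ᵐ z : ℝ × ℝ, frob (K z.1 z.2) = frob (G z.1 z.2))
    (s p q : ℝ) : kernelNorm s p q K = kernelNorm s p q G := by
  unfold kernelNorm
  congr 1
  refine lintegral_congr_ae ?_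
  filter_upwards [ae_shear h] with t ht
  rw [eLpNorm_congr_ae (by filter_upwards [ht] with x hx using hx)]

/-- A Borel representative differs from the kernel on a null set of the plane, hence on a null set
of almost every slice, and the mixed norm does not see it. -/
theorem MeasKernel.exists_measurable_repr {K : ℝ → ℝ → Mat m} (hK : MeasKernel K) {s : ℝ}
    (hs' : s < 1 / 2) :
    ∃ k : ℝ → ℝ → ℝ≥0∞, Measurable (Function.uncurry k) ∧
      (∀ᵐ h : ℝ, ∀ᵐ x, k h x = ENNReal.ofReal (frob (K x (x + h)))) ∧
      mixedNorm s k = kernelNorm (-s) (1 / (1 / 2 - s)) 2 K := by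
  have hm : AEMeasurable (fun z : ℝ × ℝ => ENNReal.ofReal (frob (K z.1 z.2))) volume :=
    (continuous_frob.comp_aestronglyMeasurable hK.aestronglyMeasurable).aemeasurable.ennreal_ofReal
  have hθ : 0 < 1 / 2 - s := by linarith
  have hae : ∀ᵐ h : ℝ, ∀ᵐ x, hm.mk _ (x, x + h) = ENNReal.ofReal (frob (K x (x + h))) := by
    filter_upwards [ae_shear hm.ae_eq_mk] with h hh
    filter_upwards [hh] with x hx using hx.symm
  refine ⟨fun h x => hm.mk _ (x, x + h), hm.measurable_mk.comp
    (f := fun q : ℝ × ℝ => (q.2, q.2 + q.1)) (by fun_prop), hae, ?_⟩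
  unfold mixedNorm kernelNorm
  congr 1
  refine lintegral_congr_ae ?_
  filter_upwards [hae] with h hh
  rw [eLpNorm_ofReal_eq (by positivity), one_div_one_div, ENNReal.rpow_two]
  have : ∫⁻ x, hm.mk _ (x, x + h) ^ (1 / (1 / 2 - s)) =
      ∫⁻ x, ‖frob (K x (x + h))‖ₑ ^ (1 / (1 / 2 - s)) := by
    refine lintegral_congr_ae ?_
    filter_upwards [hh] with x hx
    rw [hx, enorm_frob]
  rw [this]
  congr 4
  ring

theorem MeasKernel.ae_slice {K : ℝ → ℝ → Mat m} (hK : MeasKernel K) :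
    ∀ᵐ h : ℝ, ∀ i j, AEStronglyMeasurable (fun x => K x (x + h) i j) volume := by
  rw [ae_all_iff]
  intro i
  rw [ae_all_iff]
  intro j
  have h := (hK i j).comp_quasiMeasurePreserving measurePreserving_shear.quasiMeasurePreserving
  exact h.prodMk_left

theorem kernelNorm_sobolev {s : ℝ} (hs : 0 < s) (hs' : s < 1 / 2) :
    ∃ C : ℝ≥0, ∀ (m : ℕ) (K L : ℝ → ℝ → Mat m), MeasKernel K → IsKernelFracLaplacian s K L →
      kernelNorm (-s) (1 / (1 / 2 - s)) 2 K ≤ C * kernelNorm (-s) 2 2 L := by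
  obtain ⟨C, hC⟩ := schwartz_sobolev hs hs'
  have hθ : 0 < 1 / 2 - s := by linarith
  refine ⟨C, fun m K L hK hKL => ?_⟩
  unfold kernelNorm
  have hp2 : (2 : ℝ≥0∞) ≤ ENNReal.ofReal (1 / (1 / 2 - s)) := by
    rw [← ENNReal.ofReal_ofNat]
    refine ENNReal.ofReal_le_ofReal ?_
    rw [le_div_iff₀ hθ]; linarith
  have h1 : ∀ᵐ h : ℝ, ENNReal.ofReal (|h| ^ (1 - 2 * -s)) *
      eLpNorm (fun x => frob (K x (x + h))) (ENNReal.ofReal (1 / (1 / 2 - s))) volume ^ (2 : ℝ) ≤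
      C ^ (2 : ℝ) * (ENNReal.ofReal (|h| ^ (1 - 2 * -s)) *
      eLpNorm (fun x => frob (L x (x + h))) (ENNReal.ofReal 2) volume ^ (2 : ℝ)) := by
    filter_upwards [hK.ae_slice, hKL.2] with h h1 h2
    rw [mul_left_comm, ← ENNReal.mul_rpow_of_nonneg _ _ zero_le_two, ENNReal.ofReal_ofNat]
    gcongr
    exact eLpNorm_frob_le_of_isFracLaplacian hp2 ENNReal.ofReal_ne_top hC h1 h2
  have hfin : (C : ℝ≥0∞) ^ (2 : ℝ) ≠ ⊤ := by finiteness
  refine (ENNReal.rpow_le_rpow (lintegral_mono_ae h1) (by norm_num)).trans (le_of_eq ?_)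
  rw [lintegral_const_mul' _ _ hfin, ENNReal.mul_rpow_of_nonneg _ _ (by norm_num),
    ← ENNReal.rpow_mul]
  norm_num

end MultiComm

/-! ### Integrability of the remainder. -/

namespace MultiComm

variable {m : ℕ} {K : ℝ → ℝ → Mat m} {P : ℝ → Mat m} {v : ℝ → Vec m} {s : ℝ}

theorem continuous_act : Continuous fun q : Mat m × Vec m => act q.1 q.2 := by
  unfold act
  fun_prop

theorem LocIntegrableKernel.measKernel (hK : LocIntegrableKernel K) : MeasKernel K :=
  fun i j => (hK i j).aestronglyMeasurable

theorem aestronglyMeasurable_matrix_mul {α : Type*} [MeasurableSpace α] {μ : Measure α}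
    {A B : α → Mat m} (hA : AEStronglyMeasurable A μ) (hB : AEStronglyMeasurable B μ) :
    AEStronglyMeasurable (fun z => A z * B z) μ :=
  (continuous_fst.matrix_mul continuous_snd).comp_aestronglyMeasurable (hA.prodMk hB)

theorem MeasKernel.conj (hK : MeasKernel K) (hP : AEStronglyMeasurable P volume) :
    MeasKernel (conjKernel P K) := fun i j => by
  have h1 : AEStronglyMeasurable (fun z : ℝ × ℝ => P z.1) volume := hP.comp_fst
  have h2 : AEStronglyMeasurable (fun z : ℝ × ℝ => (P z.2)ᵀ) volume :=
    (continuous_id.matrix_transpose).comp_aestronglyMeasurable hP.comp_snd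
  exact (continuous_apply_apply i j).comp_aestronglyMeasurable
    (aestronglyMeasurable_matrix_mul (aestronglyMeasurable_matrix_mul h1 hK.aestronglyMeasurable) h2)

theorem MeasKernel.aestronglyMeasurable_rem (hK : MeasKernel K) (hP : AEStronglyMeasurable P volume)
    (hv : AEStronglyMeasurable v volume) :
    AEStronglyMeasurable (fun z : ℝ × ℝ => remIntegrand P K v z.1 z.2) volume := by
  have h1 : AEStronglyMeasurable (fun z : ℝ × ℝ => P z.1) volume := hP.comp_fst
  have h2 : AEStronglyMeasurable (fun z : ℝ × ℝ => P z.2) volume := hP.comp_snd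
  have h3 : AEStronglyMeasurable (fun z : ℝ × ℝ => v z.1) volume := hv.comp_fst
  have hc : Continuous fun q : Mat m × Mat m × Mat m => (q.1 - q.2.1) * q.2.2ᵀ := by fun_prop
  exact continuous_act.comp_aestronglyMeasurable ((hc.comp_aestronglyMeasurable
    (h1.prodMk (h2.prodMk hK.aestronglyMeasurable))).prodMk h3)

theorem ae_frob_conjKernel (hP : ∀ᵐ x : ℝ, P x ∈ Matrix.orthogonalGroup (Fin m) ℝ)
    (K : ℝ → ℝ → Mat m) :
    ∀ᵐ z : ℝ × ℝ, frob (K z.1 z.2) = frob (conjKernel P K z.1 z.2) := by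
  filter_upwards [ae_prod_fst hP, ae_prod_snd hP] with z h1 h2
  exact (frob_orthogonal_mul_mul h1 h2 _).symm

theorem LocIntegrableKernel.conj (hK : LocIntegrableKernel K)
    (hP : AEStronglyMeasurable P volume)
    (hP' : ∀ᵐ x : ℝ, P x ∈ Matrix.orthogonalGroup (Fin m) ℝ) :
    LocIntegrableKernel (conjKernel P K) := fun i j => by
  have h : LocallyIntegrable (fun z : ℝ × ℝ => ∑ i, ∑ j, |K z.1 z.2 i j|) volume :=
    locallyIntegrable_finsetSum _ fun i _ => locallyIntegrable_finsetSum _ fun j _ =>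
      LocallyIntegrable.mono (hK i j) (hK.measKernel i j).norm (by simp)
  refine h.mono (hK.measKernel.conj hP i j) ?_
  filter_upwards [ae_frob_conjKernel hP' K] with z hz
  rw [Real.norm_eq_abs, Real.norm_eq_abs]
  exact (abs_apply_le_frob _ i j).trans (hz ▸ (frob_le_sum _).trans (le_abs_self _))

theorem MemWeakL2.weakBound (hv : MemWeakL2 v) :
    WeakBound (fun x => ‖v x‖ₑ) (weakL2Norm v).toReal := by
  intro t ht
  have h : ENNReal.ofReal t * volume {x | ENNReal.ofReal t < ‖v x‖ₑ} ^ (1 / 2 : ℝ) ≤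
      ENNReal.ofReal (weakL2Norm v).toReal := by
    rw [ENNReal.ofReal_toReal hv.2.ne]
    exact le_iSup (fun t : ℝ≥0 => (t : ℝ≥0∞) *
      (volume {x : ℝ | (t : ℝ≥0∞) < ‖v x‖ₑ}) ^ (1 / 2 : ℝ)) t.toNNReal
  have h2 := ENNReal.rpow_le_rpow h zero_le_two
  rw [ENNReal.mul_rpow_of_nonneg _ _ zero_le_two, ← ENNReal.rpow_mul] at h2
  norm_num at h2
  rw [ENNReal.ofReal_div_of_pos (by positivity), ENNReal.ofReal_pow ht.le,
    ENNReal.ofReal_pow ENNReal.toReal_nonneg]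
  refine ENNReal.le_div_iff_mul_le (.inl ?_) (.inl (by finiteness)) |>.2 ?_
  · simpa using ht
  · rwa [mul_comm]

theorem ae_eq_zero_of_weakL2Norm_eq_zero (hv : MemWeakL2 v) (h : weakL2Norm v = 0) :
    ∀ᵐ x, v x = 0 := by
  have h1 : ∀ᵐ x, ∀ n : ℕ, ‖v x‖ₑ ≤ ENNReal.ofReal (1 / (n + 1)) := by
    rw [ae_all_iff]
    intro n
    have := hv.weakBound (1 / (n + 1)) (by positivity)
    simp only [h, ENNReal.toReal_zero, ne_eq, OfNat.ofNat_ne_zero, not_false_eq_true, zero_pow,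
      zero_div, ENNReal.ofReal_zero, nonpos_iff_eq_zero] at this
    rw [ae_iff]
    simpa using this
  filter_upwards [h1] with x hx
  have : ‖v x‖ ≤ 0 := ge_of_tendsto' tendsto_one_div_add_atTop_nhds_zero_nat fun n => by
    have := hx n
    rw [← ofReal_norm] at this
    exact (ENNReal.ofReal_le_ofReal_iff (by positivity)).1 this
  simpa using this

theorem flat_sub (A B : Mat m) : flat (A - B) = flat A - flat B := rfl

theorem continuous_flat : Continuous (flat : Mat m → _) := by
  unfold flat
  fun_prop

/-- Averages of P are taken in a complete normed space whose norm is the Frobenius norm, which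
`flat` provides. The bound √m coming from orthogonality gives local integrability only and never
enters a constant. -/
theorem MemHalfSobolevOrthogonal.exists_stronglyMeasurable (hP : MemHalfSobolevOrthogonal P) :
    ∃ Q : ℝ → EuclideanSpace ℝ (Fin m × Fin m), StronglyMeasurable Q ∧
      LocallyIntegrable Q volume ∧ (∀ᵐ x, Q x = flat (P x)) ∧
      halfSobolevNorm P = (∫⁻ h, ENNReal.ofReal (|h| ^ (-2 : ℝ)) * diffSq Q h) ^ (1 / 2 : ℝ) := by
  have hm : AEStronglyMeasurable (fun x => flat (P x)) volume :=
    continuous_flat.comp_aestronglyMeasurable hP.1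
  have hae : ∀ᵐ x, hm.mk _ x = flat (P x) := hm.ae_eq_mk.symm
  refine ⟨hm.mk _, hm.stronglyMeasurable_mk, ?_, hae, ?_⟩
  · refine (locallyIntegrable_const (Real.sqrt m)).mono hm.stronglyMeasurable_mk.aestronglyMeasurable ?_
    filter_upwards [hae, hP.2.1] with x h1 h2
    rw [h1, norm_flat, frob_orthogonal h2]
    exact le_abs_self _
  · unfold halfSobolevNorm
    congr 1
    refine lintegral_congr fun h => ?_
    congr 1
    rw [eLpNorm_two_eq, ← ENNReal.rpow_mul]
    norm_num
    rw [diffSq]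
    refine lintegral_congr_ae ?_
    filter_upwards [hae, (quasiMeasurePreserving_add_right volume h).ae hae] with x h1 h2
    rw [h1, h2, ← flat_sub, enorm_frob, ← ofReal_norm, norm_flat]

theorem enorm_act_le (A : Mat m) (w : Vec m) : ‖act A w‖ₑ ≤ ENNReal.ofReal (frob A) * ‖w‖ₑ := by
  rw [← ofReal_norm, ← ofReal_norm, ← ENNReal.ofReal_mul (frob_nonneg A)]
  exact ENNReal.ofReal_le_ofReal (norm_act_le A w)

theorem enorm_remIntegrand_le (P : ℝ → Mat m) (K : ℝ → ℝ → Mat m) (v : ℝ → Vec m) (x y : ℝ) :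
    ‖remIntegrand P K v x y‖ₑ ≤
      ‖flat (P x) - flat (P y)‖ₑ * ENNReal.ofReal (frob (K x y)) * ‖v x‖ₑ := by
  rw [remIntegrand, ← act_act, ← flat_sub, ← ofReal_norm (flat _), norm_flat, mul_assoc]
  refine (enorm_act_le _ _).trans ?_
  gcongr
  refine (enorm_act_le _ _).trans ?_
  rw [frob_transpose]

theorem lintegral_remIntegrand_le (hs : 0 < s) (hs' : s < 1 / 2) :
    ∃ C : ℝ≥0, ∀ (m : ℕ) (K : ℝ → ℝ → Mat m) (P : ℝ → Mat m) (v : ℝ → Vec m),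
      MeasKernel K → MemHalfSobolevOrthogonal P → MemWeakL2 v →
      ∫⁻ z : ℝ × ℝ, ‖remIntegrand P K v z.1 z.2‖ₑ ≤
        C * kernelNorm (-s) (1 / (1 / 2 - s)) 2 K * halfSobolevNorm P * weakL2Norm v := by
  obtain ⟨C, hC0, hC⟩ := lintegral_sub_mul_le hs hs'
  refine ⟨C.toNNReal, fun m K P v hK hP hv => ?_⟩
  -- The main estimate cuts v at a level proportional to M and so needs M > 0.
  rcases eq_or_ne (weakL2Norm v) 0 with h0 | h0
  · have hz : ∀ᵐ z : ℝ × ℝ, ‖remIntegrand P K v z.1 z.2‖ₑ = 0 := by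
      filter_upwards [ae_prod_fst (ae_eq_zero_of_weakL2Norm_eq_zero hv h0)] with z hz
      simp [remIntegrand, hz, act]
    rw [lintegral_eq_zero_of_ae_eq_zero hz]
    exact zero_le
  obtain ⟨Q, hQ, hQl, hQP, hQn⟩ := hP.exists_stronglyMeasurable
  obtain ⟨k, hk, hkK, hkn⟩ := hK.exists_measurable_repr hs'
  have hM : 0 < (weakL2Norm v).toReal := ENNReal.toReal_pos h0 hv.2.ne
  have hmain := hC _ Q k (fun x => ‖v x‖ₑ) _ hQ hQl hk hv.1.enorm (fun x => enorm_ne_top)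
    hv.weakBound hM
  have hle : ∫⁻ z : ℝ × ℝ, ‖remIntegrand P K v z.1 z.2‖ₑ ≤
      ∫⁻ h, ∫⁻ x, ‖Q x - Q (x + h)‖ₑ * k h x * ‖v x‖ₑ := by
    rw [lintegral_eq_lintegral_shear (hK.aestronglyMeasurable_rem hP.1 hv.1).enorm]
    refine lintegral_mono_ae ?_
    filter_upwards [hkK] with h hh
    refine lintegral_mono_ae ?_
    filter_upwards [hh, hQP, (quasiMeasurePreserving_add_right volume h).ae hQP] with x h1 h2 h3
    rw [h1, h2, h3]
    exact enorm_remIntegrand_le P K v x (x + h)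
  refine hle.trans (hmain.trans (le_of_eq ?_))
  rw [hkn, ← hQn, ENNReal.ofReal_mul hC0.le, ENNReal.ofReal_toReal hv.2.ne]
  change ENNReal.ofReal C * _ * _ * _ = ENNReal.ofReal C * _ * _ * _
  ring

end MultiComm

/-! ### The identity, at points and in the sense of distributions. -/

namespace MultiComm

variable {m : ℕ} {K : ℝ → ℝ → Mat m} {P : ℝ → Mat m} {v w φ : ℝ → Vec m} {s : ℝ}

theorem remOp_linear (a b : ℝ)
    (hv : Integrable (fun z : ℝ × ℝ => remIntegrand P K v z.1 z.2) volume)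
    (hw : Integrable (fun z : ℝ × ℝ => remIntegrand P K w z.1 z.2) volume) :
    remOp P K (fun x => a • v x + b • w x) =ᵐ[volume]
      fun x => a • remOp P K v x + b • remOp P K w x := by
  filter_upwards [hv.prod_right_ae, hw.prod_right_ae] with x h1 h2
  unfold remOp
  have h1' : Integrable (fun y => a • remIntegrand P K v x y) volume := h1.smul a
  have h2' : Integrable (fun y => b • remIntegrand P K w x y) volume := h2.smul b
  rw [← integral_smul, ← integral_smul, ← integral_add h1' h2']
  refine integral_congr_ae (.of_forall fun y => ?_)
  simp only [remIntegrand, act_add, act_smul]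

theorem MemWeakL2.orthogonal (hv : MemWeakL2 v) (hP : AEStronglyMeasurable P volume)
    (hP' : ∀ᵐ x : ℝ, P x ∈ Matrix.orthogonalGroup (Fin m) ℝ) :
    MemWeakL2 fun x => act (P x) (v x) := by
  refine ⟨continuous_act.comp_aestronglyMeasurable (hP.prodMk hv.1), ?_⟩
  refine lt_of_le_of_lt (le_of_eq ?_) hv.2
  unfold weakL2Norm
  refine iSup_congr fun t => ?_
  congr 2
  refine measure_congr ?_
  filter_upwards [hP'] with x hx
  refine propext ?_
  change _ < ‖act (P x) (v x)‖ₑ ↔ _ < ‖v x‖ₑ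
  rw [← ofReal_norm, norm_act_orthogonal hx, ofReal_norm]

theorem commIntegrand_conjKernel {x y : ℝ} (hx : P x ∈ Matrix.orthogonalGroup (Fin m) ℝ)
    (hy : P y ∈ Matrix.orthogonalGroup (Fin m) ℝ) :
    act (P x) (commIntegrand K v x y) =
      commIntegrand (conjKernel P K) (fun y => act (P y) (v y)) x y + remIntegrand P K v x y := by
  have hx' : (P x)ᵀ * P x = 1 := (Matrix.mem_orthogonalGroup_iff' (Fin m) ℝ).1 hx
  have hy' : (P y)ᵀ * P y = 1 := (Matrix.mem_orthogonalGroup_iff' (Fin m) ℝ).1 hy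
  simp only [commIntegrand, remIntegrand, conjKernel, act_add, act_act]
  have h1 : (P x * K x y * (P y)ᵀ)ᵀ * P x = P y * (K x y)ᵀ := by
    simp only [Matrix.transpose_mul, Matrix.transpose_transpose, Matrix.mul_assoc, hx',
      Matrix.mul_one]
  have h2 : P x * K x y * (P y)ᵀ * P y = P x * K x y := by
    rw [Matrix.mul_assoc, hy', Matrix.mul_one]
  rw [h1, h2, Matrix.sub_mul, act_sub_left]
  abel

theorem integrable_act_iff {α : Type*} [MeasurableSpace α] {μ : Measure α} {A : Mat m}
    (hA : A ∈ Matrix.orthogonalGroup (Fin m) ℝ) {f : α → Vec m} :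
    Integrable (fun y => act A (f y)) μ ↔ Integrable f μ := by
  refine ⟨fun h => ?_, fun h => (actCLM A).integrable_comp h⟩
  have h' := (actCLM Aᵀ).integrable_comp h
  refine h'.congr (.of_forall fun y => ?_)
  simp only [actCLM_apply, act_act, (Matrix.mem_orthogonalGroup_iff' (Fin m) ℝ).1 hA, act_one]

theorem ae_comm_identity (hP' : ∀ᵐ x : ℝ, P x ∈ Matrix.orthogonalGroup (Fin m) ℝ)
    (hR : Integrable (fun z : ℝ × ℝ => remIntegrand P K v z.1 z.2) volume) :
    ∀ᵐ x : ℝ,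
      (Integrable (commIntegrand K v x) volume ↔
        Integrable (commIntegrand (conjKernel P K) (fun y => act (P y) (v y)) x) volume) ∧
      (Integrable (commIntegrand K v x) volume →
        act (P x) (comm K v x) =
          comm (conjKernel P K) (fun y => act (P y) (v y)) x + remOp P K v x) := by
  filter_upwards [hP', hR.prod_right_ae] with x hx hRx
  have he : (fun y => act (P x) (commIntegrand K v x y)) =ᵐ[volume] fun y =>
      commIntegrand (conjKernel P K) (fun y => act (P y) (v y)) x y + remIntegrand P K v x y := by
    filter_upwards [hP'] with y hy using commIntegrand_conjKernel hx hy
  have hiff : Integrable (commIntegrand K v x) volume ↔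
      Integrable (commIntegrand (conjKernel P K) (fun y => act (P y) (v y)) x) volume := by
    rw [← integrable_act_iff hx, integrable_congr he]
    exact integrable_add_iff_integrable_left' hRx
  refine ⟨hiff, fun h => ?_⟩
  unfold comm remOp
  rw [← actCLM_apply, ← (actCLM (P x)).integral_comp_comm h]
  simp only [actCLM_apply]
  rw [integral_congr_ae he, integral_add (hiff.1 h) hRx]

/-- The truncated regions exhaust the complement of the diagonal, which is a null set. -/
theorem tendsto_setIntegral_dist_gt {f : ℝ × ℝ → ℝ} (hf : Integrable f volume) :
    Tendsto (fun ε : ℝ => ∫ z in {z : ℝ × ℝ | ε < |z.1 - z.2|}, f z) (𝓝[>] 0)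
      (𝓝 (∫ z, f z)) := by
  refine AECover.integral_tendsto_of_countably_generated (l := 𝓝[>] (0 : ℝ)) ⟨?_, fun ε => ?_⟩ hf
  · filter_upwards [ae_fst_ne_snd] with z hz
    have : 0 < |z.1 - z.2| := abs_pos.2 (sub_ne_zero.2 hz)
    exact mem_nhdsWithin_of_mem_nhds (eventually_lt_nhds this)
  · exact measurableSet_lt measurable_const (by fun_prop)

theorem integrable_inner_rem (hφ : ContDiff ℝ ∞ φ) (hφc : HasCompactSupport φ)
    (hR : Integrable (fun z : ℝ × ℝ => remIntegrand P K v z.1 z.2) volume) :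
    Integrable (fun z : ℝ × ℝ => inner ℝ (φ z.1) (remIntegrand P K v z.1 z.2)) volume := by
  obtain ⟨B, hB⟩ := hφc.exists_bound_of_continuous hφ.continuous
  have hm : AEStronglyMeasurable (fun z : ℝ × ℝ => φ z.1) volume :=
    (hφ.continuous.comp continuous_fst).aestronglyMeasurable
  refine (hR.norm.const_mul B).mono (hm.inner hR.1) (.of_forall fun z => ?_)
  refine (norm_inner_le_norm _ _).trans ?_
  rw [norm_mul, norm_norm]
  gcongr
  exact (hB _).trans (le_abs_self _)

theorem integral_inner_rem (hφ : ContDiff ℝ ∞ φ) (hφc : HasCompactSupport φ)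
    (hR : Integrable (fun z : ℝ × ℝ => remIntegrand P K v z.1 z.2) volume) :
    ∫ z : ℝ × ℝ, inner ℝ (φ z.1) (remIntegrand P K v z.1 z.2) =
      ∫ x, inner ℝ (φ x) (remOp P K v x) := by
  rw [Measure.volume_eq_prod, integral_prod _ (integrable_inner_rem hφ hφc hR)]
  refine integral_congr_ae ?_
  filter_upwards [hR.prod_right_ae] with x hx
  exact integral_inner hx (φ x)

/-- The truncated integrals of the two sides differ by that of an integrable function, whose limit
is the pairing with the remainder. -/
theorem hasCommPairing_iff (hP' : ∀ᵐ x : ℝ, P x ∈ Matrix.orthogonalGroup (Fin m) ℝ)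
    (hφ : ContDiff ℝ ∞ φ) (hφc : HasCompactSupport φ)
    (hR : Integrable (fun z : ℝ × ℝ => remIntegrand P K v z.1 z.2) volume) (a : ℝ) :
    HasCommPairing K v (fun x => act (P x)ᵀ (φ x)) a ↔
      HasCommPairing (conjKernel P K) (fun y => act (P y) (v y)) φ
        (a - ∫ x : ℝ, inner ℝ (φ x) (remOp P K v x)) := by
  have he : ∀ᵐ z : ℝ × ℝ, inner ℝ (act (P z.1)ᵀ (φ z.1)) (commIntegrand K v z.1 z.2) =
      inner ℝ (φ z.1) (commIntegrand (conjKernel P K) (fun y => act (P y) (v y)) z.1 z.2) +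
        inner ℝ (φ z.1) (remIntegrand P K v z.1 z.2) := by
    filter_upwards [ae_prod_fst hP', ae_prod_snd hP'] with z h1 h2
    rw [inner_act_transpose, commIntegrand_conjKernel h1 h2, inner_add_right]
  have hI := integrable_inner_rem hφ hφc hR
  have hlim := tendsto_setIntegral_dist_gt hI
  rw [integral_inner_rem hφ hφc hR] at hlim
  have hiff : ∀ ε : ℝ, IntegrableOn (fun z : ℝ × ℝ =>
      inner ℝ (act (P z.1)ᵀ (φ z.1)) (commIntegrand K v z.1 z.2)) {z | ε < |z.1 - z.2|} volume ↔
      IntegrableOn (fun z : ℝ × ℝ => inner ℝ (φ z.1)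
        (commIntegrand (conjKernel P K) (fun y => act (P y) (v y)) z.1 z.2))
        {z | ε < |z.1 - z.2|} volume := fun ε => by
    rw [IntegrableOn, integrable_congr (ae_restrict_of_ae he)]
    exact integrable_add_iff_integrable_left' hI.integrableOn
  have hint : ∀ ε : ℝ, IntegrableOn (fun z : ℝ × ℝ => inner ℝ (φ z.1)
        (commIntegrand (conjKernel P K) (fun y => act (P y) (v y)) z.1 z.2))
        {z | ε < |z.1 - z.2|} volume →
      ∫ z in {z : ℝ × ℝ | ε < |z.1 - z.2|},
        inner ℝ (act (P z.1)ᵀ (φ z.1)) (commIntegrand K v z.1 z.2) =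
      (∫ z in {z : ℝ × ℝ | ε < |z.1 - z.2|}, inner ℝ (φ z.1)
        (commIntegrand (conjKernel P K) (fun y => act (P y) (v y)) z.1 z.2)) +
      ∫ z in {z : ℝ × ℝ | ε < |z.1 - z.2|}, inner ℝ (φ z.1) (remIntegrand P K v z.1 z.2) :=
    fun ε h => by
      rw [integral_congr_ae (ae_restrict_of_ae he), integral_add h hI.integrableOn]
  constructor
  · rintro ⟨h1, h2⟩
    have h1' := fun ε hε => (hiff ε).1 (h1 ε hε)
    refine ⟨h1', (h2.sub hlim).congr' ?_⟩
    filter_upwards [self_mem_nhdsWithin] with ε hε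
    rw [hint ε (h1' ε hε), add_sub_cancel_right]
  · rintro ⟨h1, h2⟩
    refine ⟨fun ε hε => (hiff ε).2 (h1 ε hε), ?_⟩
    have h3 := h2.add hlim
    rw [sub_add_cancel] at h3
    refine h3.congr' ?_
    filter_upwards [self_mem_nhdsWithin] with ε hε
    rw [hint ε (h1 ε hε)]

theorem eLpNorm_remOp_le (P : ℝ → Mat m) (K : ℝ → ℝ → Mat m) (v : ℝ → Vec m)
    (hm : AEStronglyMeasurable (fun z : ℝ × ℝ => remIntegrand P K v z.1 z.2) volume) :
    eLpNorm (remOp P K v) 1 volume ≤ ∫⁻ z : ℝ × ℝ, ‖remIntegrand P K v z.1 z.2‖ₑ := by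
  rw [eLpNorm_one_eq_lintegral_enorm, Measure.volume_eq_prod, lintegral_prod _ hm.enorm]
  exact lintegral_mono fun x => enorm_integral_le_lintegral_enorm _

end MultiComm

/-! ### Existence of the pairings for anti-self-dual kernels. -/

namespace MultiComm

variable {m : ℕ} {K : ℝ → ℝ → Mat m} {v φ : ℝ → Vec m} {s : ℝ}

/-- Where w ≤ 1 the integral is at most the measure of T, and where w > 1 the bound for high levels
applies. The constant is uniform in the translation and in T, as Hölder on every slice requires. -/
theorem WeakBound.lintegral_indicator_rpow_lt_top {q : ℝ} (hq : 0 < q) (hq' : q < 2)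
    {w : ℝ → ℝ≥0∞} (hw : AEMeasurable w volume) (hwt : ∀ x, w x ≠ ⊤) {M : ℝ} (hM : WeakBound w M) :
    ∃ H : ℝ≥0, ∀ (h : ℝ) (T : Set ℝ), MeasurableSet T →
      ∫⁻ x, (T.indicator 1 x * w (x + h)) ^ q ≤ volume T + H := by
  obtain ⟨C, hC0, hC⟩ := WeakBound.lintegral_rpow_high_le hq hq'
  have hh := hC w M 1 hw hwt hM one_pos
  refine ⟨(C * (1 ^ (q - 2) * M ^ 2)).toNNReal, fun h T hT => ?_⟩
  have hle : ∀ x, (T.indicator 1 x * w (x + h)) ^ q ≤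
      T.indicator 1 x + ({x | ENNReal.ofReal 1 < w x}.indicator w (x + h)) ^ q := by
    intro x
    by_cases hx : x ∈ T
    · by_cases hx' : ENNReal.ofReal 1 < w (x + h)
      · rw [Set.indicator_of_mem hx, Set.indicator_of_mem (by exact hx'), Pi.one_apply, one_mul]
        exact le_add_self
      · rw [Set.indicator_of_mem hx, Pi.one_apply, one_mul]
        refine le_add_of_le_of_nonneg ?_ zero_le
        rw [ENNReal.ofReal_one, not_lt] at hx'
        exact ENNReal.rpow_le_one hx' hq.le
    · rw [Set.indicator_of_notMem hx, zero_mul, ENNReal.zero_rpow_of_pos hq]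
      exact zero_le
  refine (lintegral_mono hle).trans ?_
  rw [lintegral_add_left (measurable_one.indicator hT), lintegral_indicator_one hT,
    lintegral_add_right_eq_self (fun x => ({x | ENNReal.ofReal 1 < w x}.indicator w x) ^ q) h]
  gcongr
  exact hh

/-- Hölder in x with reciprocal exponents 1/2 - s and 1/2 + s, then Cauchy-Schwarz in h. The weight
left over, min(1,|h|)² |h|^(-1-2s), is integrable. -/
theorem lintegral_min_mul_lt_top (hs : 0 < s) (hs' : s < 1 / 2) {k : ℝ → ℝ → ℝ≥0∞}
    (hk : Measurable (Function.uncurry k)) (hkn : mixedNorm s k < ⊤)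
    {w : ℝ → ℝ≥0∞} (hw : AEMeasurable w volume) (hwt : ∀ x, w x ≠ ⊤) {M : ℝ} (hM : WeakBound w M)
    {S : Set ℝ} (hS : MeasurableSet S) (hSf : volume S ≠ ⊤) :
    ∫⁻ h, ENNReal.ofReal (min 1 |h|) *
      ∫⁻ x, k h x * ({x | x ∈ S ∨ x + h ∈ S}.indicator 1 x * w (x + h)) < ⊤ := by
  have ha : 0 < 1 / 2 - s := by linarith
  have hb : 0 < 1 / 2 + s := by linarith
  obtain ⟨H, hH⟩ := hM.lintegral_indicator_rpow_lt_top (q := 1 / (1 / 2 + s)) (by positivity)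
    (by rw [div_lt_iff₀ hb]; linarith) hw hwt
  set N : ℝ → ℝ≥0∞ := fun h => (∫⁻ x, k h x ^ (1 / (1 / 2 - s))) ^ (1 / 2 - s) with hN
  have hNm : Measurable N := (Measurable.lintegral_prod_right'
    (f := fun q : ℝ × ℝ => k q.1 q.2 ^ (1 / (1 / 2 - s))) (hk.pow_const _)).pow_const _
  have hW : (volume S + volume S + H) ^ (1 / 2 + s) ≠ ⊤ := by finiteness
  have hin : ∀ h, ∫⁻ x, k h x * ({x | x ∈ S ∨ x + h ∈ S}.indicator 1 x * w (x + h)) ≤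
      N h * (volume S + volume S + H) ^ (1 / 2 + s) := by
    intro h
    have hT : MeasurableSet {x | x ∈ S ∨ x + h ∈ S} :=
      hS.union (measurableSet_preimage (measurable_add_const h) hS)
    have hTv : volume {x | x ∈ S ∨ x + h ∈ S} ≤ volume S + volume S := by
      refine (measure_union_le S ((fun x => x + h) ⁻¹' S)).trans ?_
      rw [measure_preimage_add_right]
    have hkm : AEMeasurable (k h) volume := (hk.comp (measurable_prodMk_left (x := h))).aemeasurable
    have hwm : AEMeasurable (fun x => {x | x ∈ S ∨ x + h ∈ S}.indicator 1 x * w (x + h)) volume :=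
      (measurable_one.indicator hT).aemeasurable.mul
        (hw.comp_quasiMeasurePreserving (quasiMeasurePreserving_add_right volume h))
    refine (lintegral_mul_rpow_le hkm hwm ha hb (by ring)).trans ?_
    gcongr
    exact (hH h _ hT).trans (by gcongr)
  refine lt_of_le_of_lt (lintegral_mono fun h => mul_le_mul_right (hin h) _) ?_
  have hm1 : Measurable fun h : ℝ => ENNReal.ofReal (|h| ^ (-(1 / 2 + s)) * min 1 |h|) := by
    fun_prop
  have hm2 : Measurable fun h : ℝ => ENNReal.ofReal (|h| ^ (1 / 2 + s)) * N h :=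
    Measurable.mul (by fun_prop) hNm
  have heq : ∫⁻ h, ENNReal.ofReal (min 1 |h|) * (N h * (volume S + volume S + H) ^ (1 / 2 + s)) =
      (∫⁻ h, ENNReal.ofReal (|h| ^ (-(1 / 2 + s)) * min 1 |h|) *
        (ENNReal.ofReal (|h| ^ (1 / 2 + s)) * N h)) * (volume S + volume S + H) ^ (1 / 2 + s) := by
    rw [← lintegral_mul_const' _ _ hW]
    refine lintegral_congr_ae ?_
    filter_upwards [Measure.ae_ne volume (0 : ℝ)] with h hh
    have hp : 0 < |h| := abs_pos.2 hh
    have he : |h| ^ (-(1 / 2 + s)) * min 1 |h| * |h| ^ (1 / 2 + s) = min 1 |h| := by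
      rw [mul_right_comm, ← Real.rpow_add hp]
      simp
    rw [← mul_assoc, ← mul_assoc, ← ENNReal.ofReal_mul (by positivity), he]
  rw [heq]
  refine ENNReal.mul_lt_top ?_ hW.lt_top
  have hcs := lintegral_mul_sq_le hm1.aemeasurable hm2.aemeasurable (μ := volume)
  refine lt_of_le_of_lt hcs (ENNReal.mul_lt_top ?_ (lt_of_le_of_lt (le_of_eq ?_) hkn))
  · refine ENNReal.rpow_lt_top_of_nonneg (by norm_num) (ne_of_lt ?_)
    refine lt_of_le_of_lt (lintegral_mono_ae ?_)
      (lintegral_min_rpow_lt_top (s := 2 * s) (by linarith) (by linarith))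
    filter_upwards [Measure.ae_ne volume (0 : ℝ)] with h hh
    have hp : 0 < |h| := abs_pos.2 hh
    rw [← ENNReal.ofReal_pow (by positivity), mul_pow, ← Real.rpow_natCast, ← Real.rpow_mul hp.le]
    refine ENNReal.ofReal_le_ofReal ?_
    rw [show -(1 / 2 + s) * ((2 : ℕ) : ℝ) = -1 - 2 * s by push_cast; ring]
    gcongr
    exact pow_le_of_le_one (by positivity) (min_le_left _ _) two_ne_zero
  · unfold mixedNorm
    congr 1
    refine lintegral_congr_ae ?_
    filter_upwards [Measure.ae_ne volume (0 : ℝ)] with h hh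
    have hp : 0 < |h| := abs_pos.2 hh
    rw [mul_pow, ← ENNReal.ofReal_pow (by positivity), ← Real.rpow_natCast, ← Real.rpow_mul hp.le,
      show (1 / 2 + s) * ((2 : ℕ) : ℝ) = 1 + 2 * s by push_cast; ring]

theorem MeasKernel.lintegral_near_support_lt_top (hs : 0 < s) (hs' : s < 1 / 2) (hK : MeasKernel K)
    (hKn : kernelNorm (-s) (1 / (1 / 2 - s)) 2 K < ⊤) (hv : MemWeakL2 v)
    {S : Set ℝ} (hS : MeasurableSet S) (hSf : volume S ≠ ⊤) :
    ∫⁻ z : ℝ × ℝ, ENNReal.ofReal (min 1 |z.1 - z.2|) *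
      (ENNReal.ofReal (frob (K z.1 z.2)) *
        ({z : ℝ × ℝ | z.1 ∈ S ∨ z.2 ∈ S}.indicator 1 z * ‖v z.2‖ₑ)) < ⊤ := by
  obtain ⟨k, hk, hkK, hkn⟩ := hK.exists_measurable_repr hs'
  have hfin := lintegral_min_mul_lt_top hs hs' hk (hkn ▸ hKn) hv.1.enorm (fun x => enorm_ne_top)
    hv.weakBound hS hSf
  have hU : MeasurableSet {z : ℝ × ℝ | z.1 ∈ S ∨ z.2 ∈ S} :=
    (measurable_fst hS).union (measurable_snd hS)
  have hKm : AEMeasurable (fun z : ℝ × ℝ => ENNReal.ofReal (frob (K z.1 z.2))) volume :=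
    (continuous_frob.comp_aestronglyMeasurable hK.aestronglyMeasurable).aemeasurable.ennreal_ofReal
  have hvm : AEMeasurable (fun z : ℝ × ℝ => ‖v z.2‖ₑ) volume :=
    (hv.1.comp_snd (μ := (volume : Measure ℝ)) (ν := (volume : Measure ℝ))).enorm
  have hmin : Measurable fun z : ℝ × ℝ => ENNReal.ofReal (min 1 |z.1 - z.2|) := by fun_prop
  have hm : AEMeasurable (fun z : ℝ × ℝ => ENNReal.ofReal (min 1 |z.1 - z.2|) *
      (ENNReal.ofReal (frob (K z.1 z.2)) *
        ({z : ℝ × ℝ | z.1 ∈ S ∨ z.2 ∈ S}.indicator 1 z * ‖v z.2‖ₑ))) volume :=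
    hmin.aemeasurable.mul (hKm.mul ((measurable_one.indicator hU).aemeasurable.mul hvm))
  rw [lintegral_eq_lintegral_shear hm]
  refine lt_of_le_of_lt (lintegral_mono_ae ?_) hfin
  filter_upwards [hkK] with h hh
  rw [← lintegral_const_mul' _ _ ENNReal.ofReal_ne_top]
  refine lintegral_mono_ae ?_
  filter_upwards [hh] with x hx
  rw [hx]
  simp only [sub_add_cancel_left, abs_neg]
  exact le_rfl

theorem norm_sub_le_min_mul {B : ℝ} {Λ : ℝ≥0} (hB : ∀ x, ‖φ x‖ ≤ B) (hΛ : LipschitzWith Λ φ)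
    (x y : ℝ) : ‖φ x - φ y‖ ≤ (2 * B + Λ) * min 1 |x - y| := by
  have hB0 : 0 ≤ B := (norm_nonneg _).trans (hB 0)
  rcases le_total 1 |x - y| with h | h
  · rw [min_eq_left h, mul_one]
    have := norm_sub_le (φ x) (φ y)
    have := hB x
    have := hB y
    have := Λ.2
    change (0 : ℝ) ≤ Λ at this
    linarith
  · rw [min_eq_right h, ← Real.dist_eq, ← dist_eq_norm]
    refine (hΛ.dist_le_mul x y).trans ?_
    gcongr
    linarith

/-- The limit is the absolutely convergent integral of (φ(x) - φ(y)) · K(x,y) v(y): the truncation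
is symmetric in x and y, so one of the two terms may be reflected before the difference is taken. -/
theorem exists_hasCommPairing (hs : 0 < s) (hs' : s < 1 / 2) (hK : MeasKernel K)
    (hKn : kernelNorm (-s) (1 / (1 / 2 - s)) 2 K < ⊤) (hv : MemWeakL2 v) (hKa : AntiSelfDual K)
    (hφ : ContDiff ℝ ∞ φ) (hφc : HasCompactSupport φ) : ∃ b, HasCommPairing K v φ b := by
  obtain ⟨B, hB⟩ := hφc.exists_bound_of_continuous hφ.continuous
  obtain ⟨Λ, hΛ⟩ := hφ.lipschitzWith_of_hasCompactSupport hφc (by simp)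
  have hB0 : 0 ≤ B := (norm_nonneg _).trans (hB 0)
  set S := tsupport φ with hS
  have hSm : MeasurableSet S := (isClosed_tsupport φ).measurableSet
  have hS0 : ∀ x, x ∉ S → φ x = 0 := fun x hx => image_eq_zero_of_notMem_tsupport hx
  have hfin := hK.lintegral_near_support_lt_top hs hs' hKn hv hSm
    (IsCompact.measure_lt_top hφc).ne
  set Φ : ℝ × ℝ → ℝ≥0∞ := fun z => ENNReal.ofReal (min 1 |z.1 - z.2|) *
      (ENNReal.ofReal (frob (K z.1 z.2)) *
        ({z : ℝ × ℝ | z.1 ∈ S ∨ z.2 ∈ S}.indicator 1 z * ‖v z.2‖ₑ)) with hΦ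
  have hvm : AEStronglyMeasurable (fun z : ℝ × ℝ => v z.2) volume := hv.1.comp_snd
  have hKv : AEStronglyMeasurable (fun z : ℝ × ℝ => act (K z.1 z.2) (v z.2)) volume :=
    continuous_act.comp_aestronglyMeasurable (hK.aestronglyMeasurable.prodMk hvm)
  have hφ1 : AEStronglyMeasurable (fun z : ℝ × ℝ => φ z.1) volume :=
    (hφ.continuous.comp continuous_fst).aestronglyMeasurable
  have hφ2 : AEStronglyMeasurable (fun z : ℝ × ℝ => φ z.2) volume :=
    (hφ.continuous.comp continuous_snd).aestronglyMeasurable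
  have hdom : ∀ (c : ℝ) (u : Vec m) (z : ℝ × ℝ),
      (¬ (z.1 ∈ S ∨ z.2 ∈ S) → u = 0) → ‖u‖ ≤ c * min 1 |z.1 - z.2| → 0 ≤ c →
      ‖inner ℝ u (act (K z.1 z.2) (v z.2))‖ₑ ≤ ENNReal.ofReal c * Φ z := by
    intro c u z hu huc hc
    by_cases hz : z.1 ∈ S ∨ z.2 ∈ S
    · have h1 : ‖inner ℝ u (act (K z.1 z.2) (v z.2))‖ ≤
          c * (min 1 |z.1 - z.2| * (frob (K z.1 z.2) * ‖v z.2‖)) := by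
        refine (norm_inner_le_norm _ _).trans ?_
        rw [← mul_assoc]
        gcongr
        exact norm_act_le _ _
      rw [← ofReal_norm]
      refine (ENNReal.ofReal_le_ofReal h1).trans (le_of_eq ?_)
      rw [hΦ]
      simp only
      rw [Set.indicator_of_mem (by exact hz), Pi.one_apply, one_mul, ENNReal.ofReal_mul hc,
        ENNReal.ofReal_mul (by positivity), ENNReal.ofReal_mul (frob_nonneg _), ofReal_norm]
    · simp [hu hz]
  have hΦint : ∀ c : ℝ, ∫⁻ z, ENNReal.ofReal c * Φ z < ⊤ := fun c => by
    rw [lintegral_const_mul' _ _ ENNReal.ofReal_ne_top]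
    exact ENNReal.mul_lt_top ENNReal.ofReal_lt_top hfin
  have hD : Integrable (fun z : ℝ × ℝ =>
      inner ℝ (φ z.1 - φ z.2) (act (K z.1 z.2) (v z.2))) volume := by
    refine ⟨(hφ1.sub hφ2).inner hKv, lt_of_le_of_lt (lintegral_mono fun z => ?_)
      (hΦint (2 * B + Λ))⟩
    refine hdom _ _ z (fun hz => ?_) (norm_sub_le_min_mul hB hΛ _ _) (by positivity)
    rw [not_or] at hz
    rw [hS0 _ hz.1, hS0 _ hz.2, sub_zero]
  have hmeas : ∀ ε : ℝ, MeasurableSet {z : ℝ × ℝ | ε < |z.1 - z.2|} := fun ε =>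
    measurableSet_lt measurable_const (by fun_prop)
  -- Away from the diagonal min(1, |x-y|) ≥ min(1, ε), so the same majorant integrates each term
  -- separately and allows the splitting.
  have hε : ∀ ε : ℝ, 0 < ε → ∀ u : ℝ × ℝ → Vec m, AEStronglyMeasurable u volume →
      (∀ z, ¬ (z.1 ∈ S ∨ z.2 ∈ S) → u z = 0) → (∀ z, ‖u z‖ ≤ B) →
      IntegrableOn (fun z : ℝ × ℝ => inner ℝ (u z) (act (K z.1 z.2) (v z.2)))
        {z | ε < |z.1 - z.2|} volume := by
    intro ε hε u hum hu huB
    refine ⟨(hum.inner hKv).restrict, lt_of_le_of_lt (setLIntegral_mono_ae' (hmeas ε)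
      (g := fun z => ENNReal.ofReal (B * (min 1 ε)⁻¹) * Φ z) (.of_forall fun z hz => ?_))
      (lt_of_le_of_lt (setLIntegral_le_lintegral _ _) (hΦint _))⟩
    have hmin : 0 < min 1 ε := lt_min one_pos hε
    refine hdom _ _ z (hu z) ((huB z).trans ?_) (by positivity)
    rw [mul_assoc]
    refine le_mul_of_one_le_right hB0 ?_
    rw [inv_mul_eq_div, one_le_div hmin]
    exact min_le_min_left _ (le_of_lt hz)
  have hmp : MeasurePreserving (Prod.swap : ℝ × ℝ → ℝ × ℝ) volume volume :=
    Measure.measurePreserving_swap (μ := (volume : Measure ℝ)) (ν := volume)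
  have hpre : ∀ ε : ℝ, Prod.swap ⁻¹' {z : ℝ × ℝ | ε < |z.1 - z.2|} =
      {z : ℝ × ℝ | ε < |z.1 - z.2|} := fun ε => by
    ext z
    simp [abs_sub_comm]
  have hemb : MeasurableEmbedding (Prod.swap : ℝ × ℝ → ℝ × ℝ) :=
    MeasurableEquiv.prodComm.measurableEmbedding
  -- Anti-self-duality turns Kᵗ(x,y) v(x) into -K(y,x) v(x), the reflected form of the other term.
  have hae : ∀ᵐ z : ℝ × ℝ, inner ℝ (φ z.1) (commIntegrand K v z.1 z.2) =
      inner ℝ (φ z.1) (act (K z.1 z.2) (v z.2)) -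
        inner ℝ (φ z.swap.2) (act (K z.swap.1 z.swap.2) (v z.swap.2)) := by
    filter_upwards [hmp.quasiMeasurePreserving.ae hKa] with z hz
    simp only [Prod.fst_swap, Prod.snd_swap] at hz ⊢
    rw [commIntegrand, inner_add_right, hz, act_neg_left, inner_neg_right]
    ring
  have h1 := fun ε (h : 0 < ε) => hε ε h (fun z => φ z.1) hφ1
    (fun z hz => hS0 _ fun h => hz (.inl h)) fun z => hB _
  have h2 := fun ε (h : 0 < ε) => hε ε h (fun z => φ z.2) hφ2
    (fun z hz => hS0 _ fun h => hz (.inr h)) fun z => hB _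
  have h2' : ∀ ε : ℝ, 0 < ε → IntegrableOn (fun z : ℝ × ℝ =>
      inner ℝ (φ z.swap.2) (act (K z.swap.1 z.swap.2) (v z.swap.2)))
      {z | ε < |z.1 - z.2|} volume := fun ε h => by
    have := (hmp.integrableOn_comp_preimage hemb).2 (h2 ε h)
    rwa [hpre] at this
  refine ⟨_, fun ε h => ?_, (tendsto_setIntegral_dist_gt hD).congr' ?_⟩
  · exact (integrable_congr (ae_restrict_of_ae hae)).2 ((h1 ε h).sub (h2' ε h))
  · filter_upwards [self_mem_nhdsWithin] with ε h
    have hsw : ∫ z in {z : ℝ × ℝ | ε < |z.1 - z.2|},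
        inner ℝ (φ z.swap.2) (act (K z.swap.1 z.swap.2) (v z.swap.2)) =
        ∫ z in {z : ℝ × ℝ | ε < |z.1 - z.2|}, inner ℝ (φ z.2) (act (K z.1 z.2) (v z.2)) := by
      have := hmp.setIntegral_preimage_emb hemb
        (fun z : ℝ × ℝ => inner ℝ (φ z.2) (act (K z.1 z.2) (v z.2))) {z | ε < |z.1 - z.2|}
      rwa [hpre] at this
    rw [integral_congr_ae (ae_restrict_of_ae hae), integral_sub (h1 ε h) (h2' ε h), hsw,
      ← integral_sub (h1 ε h) (h2 ε h)]
    simp only [inner_sub_left]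

theorem AntiSelfDual.conj {P : ℝ → Mat m} (hK : AntiSelfDual K) :
    AntiSelfDual (conjKernel P K) := by
  filter_upwards [hK] with z hz
  simp only [conjKernel, Matrix.transpose_mul, Matrix.transpose_transpose]
  rw [hz]
  simp [Matrix.mul_assoc]

end MultiComm

/-! ### The proposition. -/

theorem proposition2p1 (σ : ℝ) (hσ : 0 < σ) (hσ' : σ < 1 / 2) :
    ∃ C : ℝ≥0, ∀ (m : ℕ) (K L : ℝ → ℝ → MultiComm.Mat m) (P : ℝ → MultiComm.Mat m),
      MultiComm.LocIntegrableKernel K →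
      MultiComm.IsKernelFracLaplacian σ K L →
      MultiComm.kernelNorm (-σ) 2 2 L < ⊤ →
      MultiComm.MemHalfSobolevOrthogonal P →
      -- the new kernel
      (∀ p : ℝ, 1 / p = 1 / 2 - σ →
        MultiComm.MemKernelSpace (-σ) p 2 (MultiComm.conjKernel P K)) ∧
      -- the remainder is a bounded linear operator from the weak space to the integrable functions
      (∀ v : ℝ → MultiComm.Vec m, MultiComm.MemWeakL2 v →
        Integrable (fun z : ℝ × ℝ => MultiComm.remIntegrand P K v z.1 z.2) volume ∧
        Integrable (MultiComm.remOp P K v) volume ∧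
        eLpNorm (MultiComm.remOp P K v) 1 volume ≤
          C * MultiComm.kernelNorm (-σ) 2 2 L * MultiComm.halfSobolevNorm P *
            MultiComm.weakL2Norm v) ∧
      (∀ (a b : ℝ) (v w : ℝ → MultiComm.Vec m), MultiComm.MemWeakL2 v → MultiComm.MemWeakL2 w →
        MultiComm.remOp P K (fun x => a • v x + b • w x) =ᵐ[volume]
          fun x => a • MultiComm.remOp P K v x + b • MultiComm.remOp P K w x) ∧
      -- the identity, at almost every point where the integrals converge absolutely
      (∀ v : ℝ → MultiComm.Vec m, MultiComm.MemWeakL2 v → ∀ᵐ x : ℝ,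
        (Integrable (MultiComm.commIntegrand K v x) volume ↔
          Integrable (MultiComm.commIntegrand (MultiComm.conjKernel P K)
            (fun y => MultiComm.act (P y) (v y)) x) volume) ∧
        (Integrable (MultiComm.commIntegrand K v x) volume →
          MultiComm.act (P x) (MultiComm.comm K v x) =
            MultiComm.comm (MultiComm.conjKernel P K) (fun y => MultiComm.act (P y) (v y)) x +
              MultiComm.remOp P K v x)) ∧
      -- the identity in the sense of distributions
      (∀ v : ℝ → MultiComm.Vec m, MultiComm.MemWeakL2 v →
        ∀ φ : ℝ → MultiComm.Vec m, ContDiff ℝ ∞ φ → HasCompactSupport φ →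
          (∀ a : ℝ,
            MultiComm.HasCommPairing K v (fun x => MultiComm.act (P x)ᵀ (φ x)) a ↔
            MultiComm.HasCommPairing (MultiComm.conjKernel P K)
              (fun y => MultiComm.act (P y) (v y)) φ
              (a - ∫ x : ℝ, inner ℝ (φ x) (MultiComm.remOp P K v x))) ∧
          (MultiComm.AntiSelfDual K →
            ∃ a b : ℝ,
              MultiComm.HasCommPairing K v (fun x => MultiComm.act (P x)ᵀ (φ x)) a ∧
              MultiComm.HasCommPairing (MultiComm.conjKernel P K)
                (fun y => MultiComm.act (P y) (v y)) φ b ∧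
              a = b + ∫ x : ℝ, inner ℝ (φ x) (MultiComm.remOp P K v x))) := by
  obtain ⟨C₁, hC₁⟩ := MultiComm.kernelNorm_sobolev hσ hσ'
  obtain ⟨C₂, hC₂⟩ := MultiComm.lintegral_remIntegrand_le hσ hσ'
  refine ⟨C₂ * C₁, fun m K L P hK hKL hL hP => ?_⟩
  have hKm := hK.measKernel
  have hsob := hC₁ m K L hKm hKL
  have hKn : MultiComm.kernelNorm (-σ) (1 / (1 / 2 - σ)) 2 K < ⊤ :=
    hsob.trans_lt (ENNReal.mul_lt_top ENNReal.coe_lt_top hL)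
  have hGn : MultiComm.kernelNorm (-σ) (1 / (1 / 2 - σ)) 2 (MultiComm.conjKernel P K) < ⊤ := by
    rwa [← MultiComm.kernelNorm_congr (MultiComm.ae_frob_conjKernel hP.2.1 K)]
  have hbound : ∀ v : ℝ → MultiComm.Vec m, MultiComm.MemWeakL2 v →
      ∫⁻ z : ℝ × ℝ, ‖MultiComm.remIntegrand P K v z.1 z.2‖ₑ ≤
        (C₂ * C₁ : ℝ≥0) * MultiComm.kernelNorm (-σ) 2 2 L * MultiComm.halfSobolevNorm P *
          MultiComm.weakL2Norm v := fun v hv => by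
    refine (hC₂ m K P v hKm hP hv).trans ?_
    rw [ENNReal.coe_mul, mul_assoc (C₂ : ℝ≥0∞) (C₁ : ℝ≥0∞)]
    gcongr
  have hint : ∀ v : ℝ → MultiComm.Vec m, MultiComm.MemWeakL2 v →
      Integrable (fun z : ℝ × ℝ => MultiComm.remIntegrand P K v z.1 z.2) volume := fun v hv =>
    ⟨hKm.aestronglyMeasurable_rem hP.1 hv.1, (hbound v hv).trans_lt
      (ENNReal.mul_lt_top (ENNReal.mul_lt_top (ENNReal.mul_lt_top ENNReal.coe_lt_top hL) hP.2.2)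
        hv.2)⟩
  refine ⟨fun p hp => ?_, fun v hv => ⟨hint v hv, (hint v hv).integral_prod_left, ?_⟩,
    fun a b v w hv hw => MultiComm.remOp_linear a b (hint v hv) (hint w hw),
    fun v hv => MultiComm.ae_comm_identity hP.2.1 (hint v hv), fun v hv φ hφ hφc => ⟨fun a =>
      MultiComm.hasCommPairing_iff hP.2.1 hφ hφc (hint v hv) a, fun hKa => ?_⟩⟩
  · have hp' : p = 1 / (1 / 2 - σ) := by rw [← hp, one_div_one_div]
    exact ⟨hK.conj hP.1 hP.2.1, hp' ▸ hGn⟩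
  · exact (MultiComm.eLpNorm_remOp_le P K v (hint v hv).1).trans (hbound v hv)
  -- Symmetrisation is carried out for the conjugated kernel, whose test function φ is Lipschitz;
  -- Pᵗφ need not be. The pairing for K then follows from the equivalence.
  · obtain ⟨b, hb⟩ := MultiComm.exists_hasCommPairing hσ hσ' (hKm.conj hP.1) hGn
      (hv.orthogonal hP.1 hP.2.1) hKa.conj hφ hφc
    refine ⟨b + ∫ x : ℝ, inner ℝ (φ x) (MultiComm.remOp P K v x), b, ?_, hb, rfl⟩
    rw [MultiComm.hasCommPairing_iff hP.2.1 hφ hφc (hint v hv), add_sub_cancel_right]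
    exact hb
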